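/- Consider $n$ fermionic modes with annihilation operators $f_1,\dots,f_n$ acting on Fock space of dimension $2^n$, Majorana operators $m_{2j-1}=f_j^\dagger+f_j$, $m_{2j}=i(f_j^\dagger-f_j)$, and an arbitrary division of the modes into a set $B$ and its complement $A$. The covariance matrix of an operator $X$ is $\frac i2\operatorname{tr}(X[m_j,m_l])$. An operator of trace one is Gaussian with covariance matrix $\Gamma$ if all traces $\operatorname{tr}(X m_{j_1}\cdots m_{j_q})$ with distinct indices vanish for odd $q$ and equal $(-i)^{p}\sum_\pi\operatorname{sgn}(\pi)\prod_{l=1}^p\Gamma_{j_{\pi(2l-1)},j_{\pi(2l)}}$ (sum over pairings) for $q=2p$; a Gaussian state is a positive semidefinite Gaussian operator. The partial transpose $\rho^{T_B}$ multiplies each Majorana monomial in the expansion of $\rho$ by $+1$ or $-1$ according to whether its number of factors belonging to $B$ is in $\{0,1\}$ or in $\{2,3\}$ modulo $4$. Let $\mathcal N=\frac12(\|\rho^{T_B}\|_1-1)$, $\mathcal E=\ln\|\rho^{T_B}\|_1$, and $S_\alpha(\rho)=\frac1{1-\alpha}\ln\operatorname{tr}\rho^\alpha$. For a matrix with nonnegative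 determinant put $\widetilde{\det}M=\sqrt{\det M}$. Let $\rho$ be a Gaussian state with covariance matrix $\gamma$, let $T_B^\pm=\mathbb 1_{2|A|}\oplus(\pm i)\mathbb 1_{2|B|}$, $\gamma_\pm=T_B^\pm\gamma T_B^\pm$, $R=\mathbb 1_{2|A|}\oplus(-\mathbb 1_{2|B|})$, and let $O_\pm$ be the Gaussian operators with covariance matrices $\gamma_\pm$. Then: 1. $O_-=O_+^\dagger$ and $\rho^{T_B}=\frac{1-i}2O_++\frac{1+i}2O_-$. 2. $O_+O_-$ is positive semidefinite, $\operatorname{tr}(O_+O_-)^{1/2}>0$, $\|\rho^{T_B}\|_1>0$, and, with $\hat{\mathcal E}=\ln\operatorname{tr}(O_+O_-)^{1/2}$, $$\mathcal N\le\tfrac12\left(\sqrt2\,\operatorname{tr}(O_+O_-)^{1/2}-1\right),\qquad \mathcal E\le\hat{\mathcal E}+\ln\sqrt2 .$$ 3. $\operatorname{tr}(O_+O_-)>0$, and $\rho_\times=O_+O_- /\operatorname{tr}(O_+O_-)$ is a Gaussian state; the matrices $\mathbb 1-\gamma_-\gamma_+$, $\mathbb 1-\gamma_+\gamma_-$ and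 $\mathbb 1-\gamma^2$ are invertible, and the covariance matrix $\gamma_\times$ of $\rho_\times$ is given by $$-i\gamma_\times=\mathbb 1-(\mathbb 1+i\gamma_+)(\mathbb 1-\gamma_-\gamma_+)^{-1}(\mathbb 1+i\gamma_-).$$ 4. $\|O_+\|_1=\operatorname{tr}(O_+O_-)^{1/2}=\operatorname{tr}(\rho_\times^{1/2})\,\bigl(\operatorname{tr}(O_+O_-)\bigr)^{1/2}$, where $$\operatorname{tr}(O_+O_-)=\widetilde{\det}\,\frac{\mathbb 1-\gamma_+\gamma_-}2=\widetilde{\det}\,\frac{\mathbb 1-\gamma^2}2 .$$ Moreover, $\frac{\mathbb 1\pm i\gamma_\times}2$ are positive semidefinite and, for every $\alpha>0$, $$\operatorname{tr}\rho_\times^\alpha=\widetilde{\det}\left[\left(\tfrac{\mathbb 1+i\gamma_\times}2\right)^\alpha+\left(\tfrac{\mathbb 1-i\gamma_\times}2\right)^\alpha\right].$$ 5. $\gamma_\times$ has the same characteristic polynomial as $(\mathbb 1-\gamma_+\gamma_-)^{-1}(\gamma_++\gamma_-)$ and as $\left(\frac{\mathbb 1-\gamma^2}2\right)^{-1}\frac{\gamma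 R+R\gamma}2$. 6. $\hat{\mathcal E}=\frac12\left[S_{1/2}(\rho_\times)-S_2(\rho)\right]$. 7. If $\rho$ is pure ($\rho^2=\rho$), then $O_+O_-=O_-O_+$, $S_2(\rho)=0$, $S_{1/2}(\rho_\times)=2S_{1/2}(\rho_A)$ and $\mathcal E=\hat{\mathcal E}=S_{1/2}(\rho_A)$, where $\rho_A$ is the reduced state on the modes in $A$, i.e. the operator on the Fock space of these modes that has the same Majorana moments as $\rho$; this $\rho_A$ is positive semidefinite. -/

import Mathlib

open scoped Matrix ComplexOrder

noncomputable section

namespace FermionNegativity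

/-! ### Fermionic modes on Fock space

`ι` is the finite, linearly ordered set of modes. The Fock space has the occupation-number basis
indexed by the subsets of `ι` (the sets of occupied modes), so that operators on it are square
matrices indexed by `Finset ι`. -/

/-- Operators on the Fock space of the modes `ι`. -/
abbrev FockOp (ι : Type*) : Type _ := Matrix (Finset ι) (Finset ι) ℂ

/-- Labels of the Majorana operators: two for every mode, ordered mode by mode, so that
`(j, 0)`, `(j, 1)` stand for the Majorana operators number `2 j - 1` and `2 j`. -/
abbrev MajoranaIndex (ι : Type*) : Type _ := ι ×ₗ Fin 2

section Modes

variable {ι : Type*} [Fintype ι] [LinearOrder ι]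

/-- The annihilation operator `f_j`: it sends the basis vector of `T ∋ j` to that of `T \ {j}`
with the sign `(-1) ^ #{i ∈ T | i < j}`, and kills the basis vectors of the sets `T ∌ j`. -/
def annihilation (j : ι) : FockOp ι :=
  Matrix.of fun S T =>
    if j ∈ T ∧ S = T.erase j then (-1 : ℂ) ^ (T.filter fun i => i < j).card else 0

/-- The Majorana operators `f_j† + f_j` and `i (f_j† - f_j)`. -/
def majorana (a : MajoranaIndex ι) : FockOp ι :=
  if (ofLex a).2 = 0 then
    (annihilation (ofLex a).1)ᴴ + annihilation (ofLex a).1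
  else
    Complex.I • ((annihilation (ofLex a).1)ᴴ - annihilation (ofLex a).1)

/-- The Majorana monomial of a set of labels: the product in increasing order. -/
def monomial (S : Finset (MajoranaIndex ι)) : FockOp ι :=
  (List.ofFn fun k : Fin S.card => majorana (S.orderEmbOfFin rfl k)).prod

/-- The coefficient `w_S` of the Majorana monomial of `S` in the expansion `X = ∑ S, w_S m_S`. -/
def majoranaCoeff (X : FockOp ι) (S : Finset (MajoranaIndex ι)) : ℂ :=
  ((monomial S)ᴴ * X).trace / 2 ^ Fintype.card ι

/-- The number of labels in `S` that belong to modes in `B`. -/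
def countIn (B : Finset ι) (S : Finset (MajoranaIndex ι)) : ℕ :=
  (S.filter fun a => (ofLex a).1 ∈ B).card

/-- Partial transposition with respect to the modes in `B`: the coefficient of a Majorana monomial
is multiplied by `1` if the number of its factors in `B` is `0` or `1` modulo `4`, and by `-1` if
that number is `2` or `3` modulo `4`. -/
def partialTranspose (B : Finset ι) (X : FockOp ι) : FockOp ι :=
  ∑ S : Finset (MajoranaIndex ι),
    ((if countIn B S % 4 = 0 ∨ countIn B S % 4 = 1 then 1 else -1) * majoranaCoeff X S) •
      monomial S

/-- The covariance matrix `γ_{j,k} = (i / 2) tr (X [m_j, m_k])` of an operator. -/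
def covarianceMatrix (X : FockOp ι) : Matrix (MajoranaIndex ι) (MajoranaIndex ι) ℂ :=
  Matrix.of fun j k =>
    Complex.I / 2 * (X * (majorana j * majorana k - majorana k * majorana j)).trace

/-- The Pfaffian of a `k × k` (antisymmetric) matrix, that is, the signed sum over all pairings of
the indices, written as a sum over all permutations; every pairing comes from `2 ^ p * p!`
permutations, where `p = k / 2`. It is `0` when `k` is odd. -/
def pfaffian {k : ℕ} (A : Matrix (Fin k) (Fin k) ℂ) : ℂ :=
  if Even k then
    (1 / (2 ^ (k / 2) * (Nat.factorial (k / 2) : ℂ))) *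
      ∑ σ : Equiv.Perm (Fin k), ((Equiv.Perm.sign σ : ℤ) : ℂ) *
        ∏ l : Fin (k / 2),
          A (σ ⟨2 * (l : ℕ), by have := l.isLt; omega⟩)
            (σ ⟨2 * (l : ℕ) + 1, by have := l.isLt; omega⟩)
  else 0

/-- The right-hand side of Wick's formula for the labels in `S`: `(-i) ^ p` times the signed sum
over all pairings of the `2 p` labels in `S`, and `0` if the number of labels is odd. -/
def wickValue (Γ : Matrix (MajoranaIndex ι) (MajoranaIndex ι) ℂ)
    (S : Finset (MajoranaIndex ι)) : ℂ :=
  (-Complex.I) ^ (S.card / 2) *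
    pfaffian (Γ.submatrix (S.orderEmbOfFin rfl) (S.orderEmbOfFin rfl))

/-- `X` is Gaussian with covariance matrix `Γ`: it has trace one (the case `S = ∅`) and all its
Majorana moments are given by Wick's formula. -/
def IsGaussianWith (X : FockOp ι) (Γ : Matrix (MajoranaIndex ι) (MajoranaIndex ι) ℂ) : Prop :=
  covarianceMatrix X = Γ ∧
    ∀ S : Finset (MajoranaIndex ι), (X * monomial S).trace = wickValue Γ S

/-- The Gaussian operator with covariance matrix `Γ` (an antisymmetric complex matrix), through
its Majorana expansion. -/
def gaussianOperator (Γ : Matrix (MajoranaIndex ι) (MajoranaIndex ι) ℂ) : FockOp ι :=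
  ∑ S : Finset (MajoranaIndex ι), (wickValue Γ S / 2 ^ Fintype.card ι) • (monomial S)ᴴ

/-- Fermionic Gaussian states: density operators all of whose Majorana moments are given by
Wick's formula in terms of the covariance matrix. -/
def IsGaussianState (ρ : FockOp ι) : Prop :=
  ρ.PosSemidef ∧ ρ.trace = 1 ∧ IsGaussianWith ρ (covarianceMatrix ρ)

/-- The reduced state on the modes in `A`: the operator on the Fock space of these modes that has
the same Majorana moments as `ρ`. -/
def reducedState (A : Finset ι) (ρ : FockOp ι) : FockOp {i // i ∈ A} :=
  ∑ S : Finset (MajoranaIndex {i // i ∈ A}),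
    ((ρ * monomial (S.image fun a => toLex (((ofLex a).1 : ι), (ofLex a).2))).trace /
      2 ^ A.card) • (monomial S)ᴴ

/-- The diagonal matrix with entries `1` at the labels of modes outside `B` and `s` at the labels
of modes in `B`; `T_B^±` is the case `s = ± i`, and `(T_B^±)^2` is the case `s = -1`. -/
def cutMatrix (B : Finset ι) (s : ℂ) : Matrix (MajoranaIndex ι) (MajoranaIndex ι) ℂ :=
  Matrix.diagonal fun a => if (ofLex a).1 ∈ B then s else 1

end Modes

/-! ### Powers, trace norm, entropies and negativities -/

section Functionals

variable {κ : Type*} [Fintype κ] [DecidableEq κ]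

/-- The power `M ^ α` of a positive semidefinite matrix, by functional calculus. -/
def matPow (M : Matrix κ κ ℂ) (α : ℝ) : Matrix κ κ ℂ :=
  cfc (fun x : ℝ => x ^ α) M

/-- The trace norm `‖M‖₁ = tr (M† M)^{1/2}`. -/
def traceNorm (M : Matrix κ κ ℂ) : ℝ :=
  (matPow (Mᴴ * M) (1 / 2)).trace.re

/-- The Rényi entropy `S_α (ρ) = (1 - α)⁻¹ ln tr ρ ^ α`. -/
def renyiEntropy (α : ℝ) (ρ : Matrix κ κ ℂ) : ℝ :=
  1 / (1 - α) * Real.log (matPow ρ α).trace.re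

end Functionals

section Negativity

variable {ι : Type*} [Fintype ι] [LinearOrder ι]

/-- The entanglement negativity between the modes in `B` and the others. -/
def negativity (B : Finset ι) (ρ : FockOp ι) : ℝ :=
  (traceNorm (partialTranspose B ρ) - 1) / 2

/-- The logarithmic negativity between the modes in `B` and the others. -/
def logNegativity (B : Finset ι) (ρ : FockOp ι) : ℝ :=
  Real.log (traceNorm (partialTranspose B ρ))

end Negativity

end FermionNegativity

end

open scoped Matrix ComplexOrder

noncomputable section

namespace FermionNegativity

/-! Everything rests on a linear description of Gaussian operators. Exterior multiplication `create
a` and contraction `annihilate a` by Majorana operators act on the space of operators as fermionic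
creation and annihilation operators, and Wick's formula says that `gaussianOperator Γ` is `2⁻ⁿ
exp(q)` applied to `1`, with `q` quadratic in the `create a`. Contraction passes through the
exponential like a derivative. This gives `X · field (w(1 + iΓ)) = field (w(1 - iΓ)) · X` for all
vectors `w`, which together with evenness is `GaussianRelation`. The relation expresses every moment
through moments of degree two lower, so it fixes `X` up to the factor `tr X`
(`GaussianRelation.eq_smul`). Operator identities thereby become matrix identities plus a comparison
of traces.

Intertwining relations compose, so a product of Gaussian operators is a multiple of a Gaussian
operator, with the stated covariance matrix (`GaussianRelation.mul`). Rescaling the labels in `B` by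
`s` multiplies a moment with `k` factors in `B` by `s ^ k`. The signs 1, 1, -1, -1 of the partial
transpose are a combination of `i ^ k` and `(-i) ^ k`, which is the decomposition into `O_±`, and
Hermiticity of `ρ` gives `O_- = O_+†`. The bound is the triangle inequality: both coefficients have
modulus `1/√2`, and `O_±` have the same trace norm.

For a real covariance matrix an orthogonal change of Majorana operators, implemented by a unitary
because reflections generate the orthogonal group, leads to independent modes with eigenvalue
weights `∏ (1 ± c_k)/2` (`gaussian_normal_form`). Traces of powers are then products over modes.
Each `c_k` appears twice in the spectrum of `Γ²`, hence the square roots of determinants. This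
applies to `ρ_×` because `O_+ O_- = O_+ O_+†` is positive. By orthogonality of monomials and `i ·
(-i) = 1`, `tr O_+ O_- = tr ρ²`, which yields the entropy formula. After conjugation by `T_B⁺`, `1 +
iγ_×` becomes `(R + iγ)(1 - γ²)⁻¹(R + iγ)`, and `(R + iγ)² = 1 - γ² + i(γR + Rγ)` gives the
spectrum.

If `ρ` is pure, then `γ² = -1` and `γ_+ γ_- = γ_- γ_+ = -1`. Then `O_+ O_-` and `O_- O_+` satisfy
the relation of the mean `(γ_+ + γ_-)/2`, as do the products of the parity with `O_+²` and `O_-²`.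
Comparing traces gives commutativity and `O_+² = O_-²`, whence `(ρ^{T_B})² = O_+ O_-`. The mean is
`γ_A ⊕ (-γ_B)`. The squares of these blocks have the same spectrum apart from the eigenvalue `-1`,
which contributes a factor one, so `ρ_×` has the power traces of two copies of `ρ_A`. -/

set_option linter.unusedSectionVars false

/-! ### Majorana operators in the occupation basis and the Clifford relations. -/

section Clifford

variable {ι : Type*} [Fintype ι] [LinearOrder ι]

/-- The Jordan-Wigner sign of the mode `j` on the basis vector of `T`. -/
def jwSign (j : ι) (T : Finset ι) : ℂ := (-1 : ℂ) ^ (T.filter fun i => i < j).card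

lemma jwSign_mul_self (j : ι) (T : Finset ι) : jwSign j T * jwSign j T = 1 := by
  rw [jwSign, ← pow_add, ← two_mul, pow_mul]; simp

/-- The sign counts occupied modes below `j`, so only a flip of a lower mode changes it. This
asymmetry in `j` and `k` is the source of anticommutation between different modes. -/
lemma jwSign_symmDiff (j k : ι) (T : Finset ι) :
    jwSign j (symmDiff T {k}) = (if k < j then -1 else 1) * jwSign j T := by
  have key : ∀ T : Finset ι, k ∉ T →
      jwSign j (insert k T) = (if k < j then -1 else 1) * jwSign j T := by
    intro T hT
    unfold jwSign
    rw [Finset.filter_insert]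
    split_ifs with h
    · rw [Finset.card_insert_of_notMem (by simp [hT]), pow_succ]; ring
    · simp
  by_cases hk : k ∈ T
  · have h1 : symmDiff T {k} = T.erase k := by
      ext x; simp only [Finset.mem_symmDiff, Finset.mem_singleton, Finset.mem_erase]
      by_cases hx : x = k <;> simp_all
    have h2 := key (T.erase k) (by simp)
    rw [Finset.insert_erase hk] at h2
    rw [h1, h2]
    split_ifs <;> simp
  · have h1 : symmDiff T {k} = insert k T := by
      ext x; simp only [Finset.mem_symmDiff, Finset.mem_singleton, Finset.mem_insert]
      by_cases hx : x = k <;> simp_all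
    rw [h1, key T hk]

/-- The only nonzero entry of the column `T` of a Majorana operator. -/
def majoranaEntry (a : MajoranaIndex ι) (T : Finset ι) : ℂ :=
  if (ofLex a).2 = 0 then jwSign (ofLex a).1 T
  else Complex.I * (if (ofLex a).1 ∈ T then -1 else 1) * jwSign (ofLex a).1 T

lemma majorana_apply (a : MajoranaIndex ι) (S T : Finset ι) :
    majorana a S T = if S = symmDiff T {(ofLex a).1} then majoranaEntry a T else 0 := by
  set j := (ofLex a).1 with hj
  have h1 : annihilation j S T = if S = symmDiff T {j} ∧ j ∈ T then jwSign j T else 0 := by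
    simp only [annihilation, Matrix.of_apply, jwSign]
    by_cases hT : j ∈ T
    · have : symmDiff T {j} = T.erase j := by
        ext x; simp only [Finset.mem_symmDiff, Finset.mem_singleton, Finset.mem_erase]
        by_cases hx : x = j <;> simp_all
      simp [hT, this]
    · simp [hT]
  have h2 : (annihilation j)ᴴ S T = if S = symmDiff T {j} ∧ j ∉ T then jwSign j T else 0 := by
    simp only [annihilation, Matrix.conjTranspose_apply, Matrix.of_apply, jwSign]
    by_cases hT : j ∈ T
    · have : ¬ (j ∈ S ∧ T = S.erase j) := by
        rintro ⟨_, h⟩; rw [h] at hT; simp at hT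
      simp [hT, this]
    · have : symmDiff T {j} = insert j T := by
        ext x; simp only [Finset.mem_symmDiff, Finset.mem_singleton, Finset.mem_insert]
        by_cases hx : x = j <;> simp_all
      have h3 : (j ∈ S ∧ T = S.erase j) ↔ S = insert j T := by
        constructor
        · rintro ⟨h, rfl⟩; rw [Finset.insert_erase h]
        · rintro rfl; simp [Finset.erase_insert hT]
      simp only [h3, this, hT, not_false_eq_true, and_true]
      split_ifs with h
      · rw [h, Finset.filter_insert]; simp
      · simp
  unfold majorana majoranaEntry
  rw [← hj]
  by_cases hT : j ∈ T <;> split_ifs <;> simp_all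

lemma majorana_mul_apply (a b : MajoranaIndex ι) (S T : Finset ι) :
    (majorana a * majorana b) S T =
      if S = symmDiff (symmDiff T {(ofLex b).1}) {(ofLex a).1} then
        majoranaEntry a (symmDiff T {(ofLex b).1}) * majoranaEntry b T else 0 := by
  rw [Matrix.mul_apply]
  simp_rw [majorana_apply]
  rw [Finset.sum_eq_single (symmDiff T {(ofLex b).1})]
  · simp
  · intro U _ hU; simp [hU]
  · simp

lemma majoranaEntry_symmDiff_of_ne (a : MajoranaIndex ι) {k : ι} (h : (ofLex a).1 ≠ k)
    (T : Finset ι) : majoranaEntry a (symmDiff T {k}) =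
      (if k < (ofLex a).1 then -1 else 1) * majoranaEntry a T := by
  have : (ofLex a).1 ∈ symmDiff T {k} ↔ (ofLex a).1 ∈ T := by
    simp [Finset.mem_symmDiff, h]
  unfold majoranaEntry
  simp only [this, jwSign_symmDiff]
  split_ifs <;> simp

lemma majoranaIndex_ext {a b : MajoranaIndex ι} (h1 : (ofLex a).1 = (ofLex b).1)
    (h2 : (ofLex a).2 = (ofLex b).2) : a = b :=
  ofLex.injective (Prod.ext h1 h2)

/-- For different modes, exactly one of the two orders picks up a Jordan-Wigner sign, since exactly
one of the modes lies below the other. Within one mode the Jordan-Wigner signs cancel, and the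
occupation sign in the second Majorana operator changes under the flip. -/
theorem majorana_anticomm (a b : MajoranaIndex ι) :
    majorana a * majorana b + majorana b * majorana a = if a = b then 2 else 0 := by
  ext S T
  rw [Matrix.add_apply, majorana_mul_apply, majorana_mul_apply]
  by_cases hjk : (ofLex a).1 = (ofLex b).1
  · have hs := jwSign_mul_self (ofLex b).1 T
    have hmem : (ofLex b).1 ∈ symmDiff T {(ofLex b).1} ↔ (ofLex b).1 ∉ T := by
      simp [Finset.mem_symmDiff]
    rw [hjk, symmDiff_symmDiff_cancel_right]
    by_cases hST : S = T
    swap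
    · split_ifs <;> simp [hST, Matrix.ofNat_apply]
    subst hST
    have h2 : (2 : FockOp ι) S S = 2 := by
      simp [Matrix.ofNat_apply]
    by_cases hab : a = b
    · subst hab
      simp only [if_true, h2]
      unfold majoranaEntry
      simp only [hmem, jwSign_symmDiff]
      by_cases h3 : (ofLex a).2 = 0 <;> by_cases hT : (ofLex a).1 ∈ S <;>
        simp only [h3, hT, lt_irrefl, not_true_eq_false, not_false_eq_true, if_true, if_false,
          one_mul]
      · linear_combination 2 * hs
      · linear_combination 2 * hs
      all_goals
        linear_combination 2 * hs - 2 * (jwSign (ofLex a).1 S) ^ 2 * Complex.I_sq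
    · have h12 : (ofLex a).2 ≠ (ofLex b).2 := fun h => hab (majoranaIndex_ext hjk h)
      simp only [hab, if_true, if_false]
      unfold majoranaEntry
      simp only [hjk, hmem, jwSign_symmDiff]
      have : ((ofLex a).2 = 0 ∧ (ofLex b).2 ≠ 0) ∨ ((ofLex a).2 ≠ 0 ∧ (ofLex b).2 = 0) := by
        omega
      rcases this with ⟨h3, h4⟩ | ⟨h3, h4⟩ <;> by_cases hT : (ofLex b).1 ∈ S <;>
        simp [h3, h4, hT] <;> ring
  · have hab : a ≠ b := fun h => hjk (by rw [h])
    rw [symmDiff_right_comm T {(ofLex a).1}, majoranaEntry_symmDiff_of_ne a hjk,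
      majoranaEntry_symmDiff_of_ne b (Ne.symm hjk)]
    rcases lt_or_gt_of_ne hjk with h | h
    · simp [hab, h, h.not_gt]; split_ifs <;> ring
    · simp [hab, h, h.not_gt]; split_ifs <;> ring

lemma majorana_mul_self (a : MajoranaIndex ι) : majorana a * majorana a = 1 := by
  have h := majorana_anticomm a a
  rw [if_pos rfl, ← two_mul] at h
  ext S T
  have h' := congrFun (congrFun h S) T
  rw [two_mul, Matrix.add_apply, ← one_add_one_eq_two, Matrix.add_apply] at h'
  linear_combination h' / 2

lemma majorana_mul_of_ne {a b : MajoranaIndex ι} (h : a ≠ b) :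
    majorana a * majorana b = -(majorana b * majorana a) := by
  rw [eq_neg_iff_add_eq_zero, majorana_anticomm, if_neg h]

lemma conjTranspose_majorana (a : MajoranaIndex ι) : (majorana a)ᴴ = majorana a := by
  unfold majorana
  split_ifs
  · simp [add_comm]
  · simp [Matrix.conjTranspose_smul, ← smul_neg]

end Clifford
-- Majorana monomials form an orthogonal basis of the operators.
section Monomials

variable {ι : Type*} [Fintype ι] [LinearOrder ι]

/-- The fermion parity operator. -/
def parity : FockOp ι := Matrix.diagonal fun T => (-1 : ℂ) ^ T.card

lemma parity_mul_self : (parity : FockOp ι) * parity = 1 := by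
  rw [parity, Matrix.diagonal_mul_diagonal, ← Matrix.diagonal_one]
  congr 1; ext T
  rw [← pow_add, ← two_mul, pow_mul]; simp

lemma conjTranspose_parity : (parity : FockOp ι)ᴴ = parity := by
  rw [parity, Matrix.diagonal_conjTranspose]
  congr 1; ext T; simp

lemma neg_one_pow_card_symmDiff (T : Finset ι) (k : ι) :
    (-1 : ℂ) ^ (symmDiff T {k}).card = -(-1) ^ T.card := by
  by_cases hk : k ∈ T
  · have h1 : symmDiff T {k} = T.erase k := by
      ext x; simp only [Finset.mem_symmDiff, Finset.mem_singleton, Finset.mem_erase]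
      by_cases hx : x = k <;> simp_all
    rw [h1, ← Finset.card_erase_add_one hk, pow_succ]; simp
  · have h1 : symmDiff T {k} = insert k T := by
      ext x; simp only [Finset.mem_symmDiff, Finset.mem_singleton, Finset.mem_insert]
      by_cases hx : x = k <;> simp_all
    rw [h1, Finset.card_insert_of_notMem hk, pow_succ]; simp

lemma parity_mul_majorana (a : MajoranaIndex ι) :
    parity * majorana a = -(majorana a * parity) := by
  ext S T
  rw [parity, Matrix.diagonal_mul, Matrix.neg_apply, Matrix.mul_diagonal, majorana_apply]
  split_ifs with h
  · rw [h, neg_one_pow_card_symmDiff]; ring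
  · simp

/-- The product of the Majorana operators in a list of labels. -/
def majoranaProd (l : List (MajoranaIndex ι)) : FockOp ι := (l.map majorana).prod

@[simp] lemma majoranaProd_nil : majoranaProd ([] : List (MajoranaIndex ι)) = 1 := rfl

@[simp] lemma majoranaProd_cons (a : MajoranaIndex ι) (l : List (MajoranaIndex ι)) :
    majoranaProd (a :: l) = majorana a * majoranaProd l := by
  simp [majoranaProd]

lemma parity_mul_majoranaProd (l : List (MajoranaIndex ι)) :
    parity * majoranaProd l = (-1 : ℂ) ^ l.length • (majoranaProd l * parity) := by
  induction l with
  | nil => simp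
  | cons a l ih =>
    rw [majoranaProd_cons, ← mul_assoc, parity_mul_majorana, neg_mul, mul_assoc, ih,
      List.length_cons, pow_succ, mul_assoc]
    simp

lemma majorana_mul_majoranaProd_of_notMem {a : MajoranaIndex ι} {l : List (MajoranaIndex ι)}
    (h : a ∉ l) :
    majorana a * majoranaProd l = (-1 : ℂ) ^ l.length • (majoranaProd l * majorana a) := by
  induction l with
  | nil => simp
  | cons b l ih =>
    rw [List.mem_cons, not_or] at h
    rw [majoranaProd_cons, ← mul_assoc, majorana_mul_of_ne h.1, neg_mul, mul_assoc, ih h.2,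
      List.length_cons, pow_succ, mul_assoc]
    simp

lemma majorana_mul_majoranaProd_of_mem {a : MajoranaIndex ι} {l : List (MajoranaIndex ι)}
    (hl : l.Nodup) (h : a ∈ l) :
    majorana a * majoranaProd l = -(-1 : ℂ) ^ l.length • (majoranaProd l * majorana a) := by
  induction l with
  | nil => simp at h
  | cons b l ih =>
    rw [List.nodup_cons] at hl
    rw [majoranaProd_cons, List.length_cons, pow_succ]
    by_cases hab : a = b
    · subst hab
      rw [← mul_assoc, majorana_mul_self, one_mul, mul_assoc]
      have : majorana a * (majoranaProd l * majorana a) =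
          (-1 : ℂ) ^ l.length • majoranaProd l := by
        rw [← mul_assoc, majorana_mul_majoranaProd_of_notMem hl.1, Matrix.smul_mul, mul_assoc,
          majorana_mul_self, mul_one]
      rw [this, smul_smul]
      have h2 : (-1 : ℂ) ^ l.length * (-1) ^ l.length = 1 := by
        rw [← pow_add, ← two_mul, pow_mul]; simp
      simp [h2]
    · have h' : a ∈ l := by simpa [hab] using h
      rw [← mul_assoc, majorana_mul_of_ne hab, neg_mul, mul_assoc, ih hl.2 h', mul_assoc]
      simp

/-- The labels of `S` in increasing order. -/
def labelList (S : Finset (MajoranaIndex ι)) : List (MajoranaIndex ι) :=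
  List.ofFn fun k : Fin S.card => S.orderEmbOfFin rfl k

lemma monomial_eq_majoranaProd (S : Finset (MajoranaIndex ι)) :
    monomial S = majoranaProd (labelList S) := by
  simp [monomial, majoranaProd, labelList, List.map_ofFn, Function.comp_def]

lemma length_labelList (S : Finset (MajoranaIndex ι)) : (labelList S).length = S.card := by
  simp [labelList]

lemma nodup_labelList (S : Finset (MajoranaIndex ι)) : (labelList S).Nodup :=
  List.nodup_ofFn.2 (S.orderEmbOfFin rfl).injective

lemma mem_labelList {S : Finset (MajoranaIndex ι)} {a : MajoranaIndex ι} :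
    a ∈ labelList S ↔ a ∈ S := by
  have h := Finset.range_orderEmbOfFin S rfl
  rw [labelList, List.mem_ofFn', h, Finset.mem_coe]

lemma parity_mul_monomial (S : Finset (MajoranaIndex ι)) :
    parity * monomial S = (-1 : ℂ) ^ S.card • (monomial S * parity) := by
  rw [monomial_eq_majoranaProd, parity_mul_majoranaProd, length_labelList]

/-- The sign in the commutation of `m_a` with the monomial of `S`. -/
def commSign (a : MajoranaIndex ι) (S : Finset (MajoranaIndex ι)) : ℂ :=
  (if a ∈ S then -1 else 1) * (-1) ^ S.card

lemma majorana_mul_monomial (a : MajoranaIndex ι) (S : Finset (MajoranaIndex ι)) :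
    majorana a * monomial S = commSign a S • (monomial S * majorana a) := by
  rw [monomial_eq_majoranaProd, commSign]
  split_ifs with h
  · rw [majorana_mul_majoranaProd_of_mem (nodup_labelList S) (mem_labelList.2 h),
      length_labelList, neg_one_mul]
  · rw [majorana_mul_majoranaProd_of_notMem (fun h' => h (mem_labelList.1 h')),
      length_labelList, one_mul]

lemma majorana_mul_monomial_mul_majorana (a : MajoranaIndex ι) (S : Finset (MajoranaIndex ι)) :
    majorana a * monomial S * majorana a = commSign a S • monomial S := by
  rw [majorana_mul_monomial, Matrix.smul_mul, mul_assoc, majorana_mul_self, mul_one]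

lemma conjTranspose_majoranaProd_mul_self (l : List (MajoranaIndex ι)) :
    (majoranaProd l)ᴴ * majoranaProd l = 1 := by
  induction l with
  | nil => simp
  | cons a l ih =>
    rw [majoranaProd_cons, Matrix.conjTranspose_mul, conjTranspose_majorana, mul_assoc,
      ← mul_assoc (majorana a), majorana_mul_self, one_mul, ih]

lemma star_commSign (a : MajoranaIndex ι) (S : Finset (MajoranaIndex ι)) :
    star (commSign a S) = commSign a S := by
  unfold commSign; split_ifs <;> simp

lemma majorana_mul_conjTranspose_monomial_mul_majorana (a : MajoranaIndex ι)
    (S : Finset (MajoranaIndex ι)) :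
    majorana a * (monomial S)ᴴ * majorana a = commSign a S • (monomial S)ᴴ := by
  have h := congrArg Matrix.conjTranspose (majorana_mul_monomial_mul_majorana a S)
  rw [Matrix.conjTranspose_mul, Matrix.conjTranspose_mul, conjTranspose_majorana,
    Matrix.conjTranspose_smul, star_commSign, ← mul_assoc] at h
  exact h

lemma parity_mul_conjTranspose_monomial (S : Finset (MajoranaIndex ι)) :
    parity * (monomial S)ᴴ = (-1 : ℂ) ^ S.card • ((monomial S)ᴴ * parity) := by
  have h := congrArg Matrix.conjTranspose (parity_mul_monomial S)
  rw [Matrix.conjTranspose_mul, Matrix.conjTranspose_smul, Matrix.conjTranspose_mul,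
    conjTranspose_parity] at h
  rw [h, smul_smul]
  have h2 : (-1 : ℂ) ^ S.card * star ((-1) ^ S.card) = 1 := by
    rw [star_pow, star_neg, star_one, ← pow_add, ← two_mul, pow_mul]; simp
  rw [h2, one_smul]

lemma trace_eq_zero_of_conj {X U V : FockOp ι} (hVU : V * U = 1) (h : U * X * V = -X) :
    X.trace = 0 := by
  have h1 : (U * X * V).trace = X.trace := by
    rw [Matrix.trace_mul_cycle, hVU, one_mul]
  rw [h, Matrix.trace_neg] at h1
  linear_combination -h1 / 2

lemma neg_one_pow_mul_of_odd_add {a b : ℕ} (h : Odd (a + b)) :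
    (-1 : ℂ) ^ a * (-1) ^ b = -1 := by
  rw [← pow_add, h.neg_one_pow]

/-- For `S ≠ T` some unitary conjugation reverses the sign of the product, which kills the trace:
the parity if the cardinalities differ in parity, and otherwise `m_a` for a label `a` in exactly one
of the two sets. -/
theorem trace_conjTranspose_monomial_mul_monomial (S T : Finset (MajoranaIndex ι)) :
    ((monomial S)ᴴ * monomial T).trace = if S = T then (2 : ℂ) ^ Fintype.card ι else 0 := by
  split_ifs with hST
  · subst hST
    rw [monomial_eq_majoranaProd, conjTranspose_majoranaProd_mul_self, Matrix.trace_one]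
    simp
  · by_cases hodd : Odd (S.card + T.card)
    · refine trace_eq_zero_of_conj (U := parity) (V := parity) parity_mul_self ?_
      rw [← mul_assoc, parity_mul_conjTranspose_monomial, Matrix.smul_mul, mul_assoc,
        parity_mul_monomial, Matrix.mul_smul, Matrix.smul_mul, Matrix.smul_mul, smul_smul,
        mul_assoc, mul_assoc, parity_mul_self, mul_one, neg_one_pow_mul_of_odd_add hodd,
        neg_one_smul]
    · have : ∃ a, (a ∈ S ∧ a ∉ T) ∨ (a ∉ S ∧ a ∈ T) := by
        by_contra! h
        exact hST (Finset.ext fun a => ⟨fun ha => (h a).1 ha, fun ha => by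
          by_contra h'; exact (h a).2 h' ha⟩)
      obtain ⟨a, ha⟩ := this
      refine trace_eq_zero_of_conj (U := majorana a) (V := majorana a) (majorana_mul_self a) ?_
      have h1 : majorana a * ((monomial S)ᴴ * monomial T) * majorana a =
          (majorana a * (monomial S)ᴴ * majorana a) * (majorana a * monomial T * majorana a) := by
        simp only [mul_assoc]
        rw [← mul_assoc (majorana a) (majorana a), majorana_mul_self, one_mul]
      rw [h1, majorana_mul_conjTranspose_monomial_mul_majorana,
        majorana_mul_monomial_mul_majorana, Matrix.smul_mul, Matrix.mul_smul, smul_smul]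
      have h2 : commSign a S * commSign a T = -1 := by
        rw [Nat.not_odd_iff_even] at hodd
        have h3 : (-1 : ℂ) ^ S.card * (-1) ^ T.card = 1 := by rw [← pow_add, hodd.neg_one_pow]
        unfold commSign
        rcases ha with ⟨h4, h5⟩ | ⟨h4, h5⟩ <;> simp only [h4, h5, if_true, if_false] <;>
          linear_combination -h3
      rw [h2, neg_one_smul]

lemma linearIndependent_monomial :
    LinearIndependent ℂ (monomial : Finset (MajoranaIndex ι) → FockOp ι) := by
  rw [Fintype.linearIndependent_iff]
  intro g hg S
  have h := congrArg (fun X => ((monomial S)ᴴ * X).trace) hg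
  simp only [Matrix.mul_sum, Matrix.trace_sum, Matrix.mul_smul, Matrix.trace_smul,
    trace_conjTranspose_monomial_mul_monomial, mul_zero, Matrix.trace_zero, smul_eq_mul,
    mul_ite, Finset.sum_ite_eq, Finset.mem_univ, if_true] at h
  simpa using h

/-- There are as many monomials, `2 ^ (2n)`, as the dimension of the operator space. -/
lemma span_monomial :
    Submodule.span ℂ (Set.range (monomial : Finset (MajoranaIndex ι) → FockOp ι)) = ⊤ := by
  refine linearIndependent_monomial.span_eq_top_of_card_eq_finrank' ?_
  rw [Module.finrank_matrix, Fintype.card_finset, Fintype.card_finset]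
  simp only [Module.finrank_self, mul_one]
  rw [← pow_add]
  congr 1
  rw [Fintype.card_lex, Fintype.card_prod, Fintype.card_fin, mul_two]

theorem ext_moments {X Y : FockOp ι}
    (h : ∀ S, (X * monomial S).trace = (Y * monomial S).trace) : X = Y := by
  rw [Matrix.ext_iff_trace_mul_right]
  intro Z
  have hZ : Z ∈ Submodule.span ℂ (Set.range (monomial : _ → FockOp ι)) := by
    rw [span_monomial]; trivial
  induction hZ using Submodule.span_induction with
  | mem x hx => obtain ⟨S, rfl⟩ := hx; exact h S
  | zero => simp
  | add x y _ _ hx hy => rw [mul_add, mul_add, Matrix.trace_add, Matrix.trace_add, hx, hy]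
  | smul c x _ hx => rw [Matrix.mul_smul, Matrix.mul_smul, Matrix.trace_smul, Matrix.trace_smul, hx]

lemma two_pow_card_ne_zero : (2 : ℂ) ^ Fintype.card ι ≠ 0 := pow_ne_zero _ two_ne_zero

/-- Moments of an operator given by its expansion in adjoint monomials. -/
lemma trace_sum_smul_conjTranspose_monomial (c : Finset (MajoranaIndex ι) → ℂ)
    (T : Finset (MajoranaIndex ι)) :
    ((∑ S, (c S / 2 ^ Fintype.card ι) • (monomial S)ᴴ) * monomial T).trace = c T := by
  simp only [Matrix.sum_mul, Matrix.trace_sum, Matrix.smul_mul, Matrix.trace_smul,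
    trace_conjTranspose_monomial_mul_monomial, smul_eq_mul, mul_ite, mul_zero,
    Finset.sum_ite_eq', Finset.mem_univ, if_true]
  exact div_mul_cancel₀ _ two_pow_card_ne_zero

lemma monomial_empty : monomial (∅ : Finset (MajoranaIndex ι)) = 1 := by
  simp [monomial]

/-- Reversing the order of anticommuting factors costs a sign. Its value never matters below, only
that it is real and squares to one. -/
lemma conjTranspose_monomial (S : Finset (MajoranaIndex ι)) :
    ∃ ε : ℂ, ε * ε = 1 ∧ star ε = ε ∧ (monomial S)ᴴ = ε • monomial S := by
  rw [monomial_eq_majoranaProd]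
  have : ∀ l : List (MajoranaIndex ι), l.Nodup →
      ∃ ε : ℂ, ε * ε = 1 ∧ star ε = ε ∧ (majoranaProd l)ᴴ = ε • majoranaProd l := by
    intro l hl
    induction l with
    | nil => exact ⟨1, by simp⟩
    | cons a l ih =>
      rw [List.nodup_cons] at hl
      obtain ⟨ε, h1, h2, h3⟩ := ih hl.2
      have h4 : (-1 : ℂ) ^ l.length * (-1) ^ l.length = 1 := by
        rw [← pow_add, ← two_mul, pow_mul]; simp
      refine ⟨ε * (-1) ^ l.length, by rw [mul_mul_mul_comm, h1, h4, one_mul], ?_, ?_⟩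
      · rw [star_mul', h2]; simp
      · rw [majoranaProd_cons, Matrix.conjTranspose_mul, conjTranspose_majorana, h3,
          majorana_mul_majoranaProd_of_notMem hl.1, smul_smul, mul_assoc ε, h4, mul_one,
          Matrix.smul_mul]
  exact this _ (nodup_labelList S)

end Monomials
-- Exterior multiplication and contraction as operators on operators.
section Exterior

variable {ι : Type*} [Fintype ι] [LinearOrder ι]

/-- Conjugation with the parity operator. -/
def parityConj (Y : FockOp ι) : FockOp ι := parity * Y * parity

lemma parityConj_parityConj (Y : FockOp ι) : parityConj (parityConj Y) = Y := by
  unfold parityConj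
  rw [← mul_assoc, ← mul_assoc, parity_mul_self, one_mul, mul_assoc, parity_mul_self, mul_one]

lemma parityConj_mul (Y Z : FockOp ι) : parityConj (Y * Z) = parityConj Y * parityConj Z := by
  unfold parityConj
  simp only [mul_assoc]
  rw [← mul_assoc parity parity, parity_mul_self, one_mul]

lemma parityConj_add (Y Z : FockOp ι) : parityConj (Y + Z) = parityConj Y + parityConj Z := by
  simp [parityConj, mul_add, add_mul]

lemma parityConj_smul (c : ℂ) (Y : FockOp ι) : parityConj (c • Y) = c • parityConj Y := by
  simp [parityConj]

lemma parityConj_sub (Y Z : FockOp ι) : parityConj (Y - Z) = parityConj Y - parityConj Z := by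
  simp [parityConj, mul_sub, sub_mul]

lemma parityConj_majorana (a : MajoranaIndex ι) : parityConj (majorana a) = -majorana a := by
  rw [parityConj, parity_mul_majorana, neg_mul, mul_assoc, parity_mul_self, mul_one]

lemma parityConj_one : parityConj (1 : FockOp ι) = 1 := by
  rw [parityConj, mul_one, parity_mul_self]

/-- Exterior multiplication by `m_a` from the right, on operators. -/
def create (a : MajoranaIndex ι) : Module.End ℂ (FockOp ι) where
  toFun Y := (1 / 2 : ℂ) • (Y * majorana a + majorana a * parityConj Y)
  map_add' Y Z := by rw [parityConj_add, add_mul, mul_add, ← smul_add]; congr 1; abel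
  map_smul' c Y := by
    rw [parityConj_smul, Matrix.smul_mul, Matrix.mul_smul, ← smul_add, smul_comm]; rfl

/-- Contraction with `m_a` from the right, on operators. -/
def annihilate (a : MajoranaIndex ι) : Module.End ℂ (FockOp ι) where
  toFun Y := (1 / 2 : ℂ) • (Y * majorana a - majorana a * parityConj Y)
  map_add' Y Z := by rw [parityConj_add, add_mul, mul_add, ← smul_add]; congr 1; abel
  map_smul' c Y := by
    rw [parityConj_smul, Matrix.smul_mul, Matrix.mul_smul, ← smul_sub, smul_comm]; rfl

lemma create_apply (a : MajoranaIndex ι) (Y : FockOp ι) :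
    create a Y = (1 / 2 : ℂ) • (Y * majorana a + majorana a * parityConj Y) := rfl

lemma annihilate_apply (a : MajoranaIndex ι) (Y : FockOp ι) :
    annihilate a Y = (1 / 2 : ℂ) • (Y * majorana a - majorana a * parityConj Y) := rfl

/-- In the symmetrized product the mixed terms cancel. What remains is a quarter of the commutator
of `Y` with the anticommutator of `m_a` and `m_b`, and the latter is a scalar. -/
lemma create_mul_create (a b : MajoranaIndex ι) :
    (create a * create b : Module.End ℂ (FockOp ι)) = -(create b * create a) := by
  rw [eq_neg_iff_add_eq_zero]
  ext1 Y
  simp only [LinearMap.add_apply, Module.End.mul_apply, create_apply, parityConj_smul,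
    parityConj_add, parityConj_mul, parityConj_parityConj, parityConj_majorana]
  simp only [Matrix.mul_smul, Matrix.smul_mul, ← smul_add, smul_smul]
  have h1 := congrArg (fun Z => Y * Z) (majorana_anticomm a b)
  have h2 := congrArg (fun Z => Z * Y) (majorana_anticomm a b)
  have h3 : Y * (if a = b then (2 : FockOp ι) else 0) = (if a = b then 2 else 0) * Y := by
    split_ifs
    · rw [mul_two, two_mul]
    · simp
  rw [h3, ← h2] at h1
  refine Eq.trans (congrArg _ ?_) (smul_zero (1 / 2 * (1 / 2) : ℂ))
  simp only [add_mul, mul_add, mul_assoc, neg_mul, mul_neg] at h1 ⊢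
  refine Eq.trans ?_ (sub_eq_zero.2 h1)
  abel

lemma annihilate_mul_create (a b : MajoranaIndex ι) :
    (annihilate a * create b : Module.End ℂ (FockOp ι)) =
      (if a = b then 1 else 0) - create b * annihilate a := by
  rw [eq_sub_iff_add_eq]
  ext1 Y
  simp only [LinearMap.add_apply, Module.End.mul_apply, create_apply, annihilate_apply,
    parityConj_smul, parityConj_sub,
    parityConj_add, parityConj_mul, parityConj_parityConj, parityConj_majorana]
  simp only [Matrix.mul_smul, Matrix.smul_mul, ← smul_sub, ← smul_add, smul_smul]
  have h1 := congrArg (fun Z => Y * Z) (majorana_anticomm a b)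
  have h2 := congrArg (fun Z => Z * Y) (majorana_anticomm a b)
  have h3 : ((if a = b then 1 else 0 : Module.End ℂ (FockOp ι))) Y =
      (1 / 2 * (1 / 2) : ℂ) • (Y * (if a = b then (2 : FockOp ι) else 0) +
        (if a = b then 2 else 0) * Y) := by
    split_ifs
    · rw [mul_two, two_mul, ← two_smul ℂ Y, ← add_smul, smul_smul]; norm_num
    · simp
  rw [h3, ← h1, ← h2]
  congr 1
  simp only [add_mul, mul_add, sub_mul, mul_sub, mul_assoc, neg_mul, mul_neg]
  abel

/-- The linear map `v ↦ ∑ v_a create a`, extended to the exterior algebra. -/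
def createHom : ExteriorAlgebra ℂ (MajoranaIndex ι → ℂ) →ₐ[ℂ] Module.End ℂ (FockOp ι) :=
  ExteriorAlgebra.lift ℂ ⟨∑ a, (LinearMap.proj a).smulRight (create a), by
    intro v
    simp only [LinearMap.sum_apply, LinearMap.smulRight_apply, LinearMap.proj_apply]
    have hz : ∀ x : Module.End ℂ (FockOp ι), x + x = 0 → x = 0 := fun x hx => by
      rw [← two_smul ℂ x] at hx
      exact (smul_eq_zero.1 hx).resolve_left two_ne_zero
    refine hz _ ?_
    rw [Finset.sum_mul_sum]
    nth_rewrite 2 [Finset.sum_comm]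
    rw [← Finset.sum_add_distrib]
    refine Finset.sum_eq_zero fun a _ => ?_
    rw [← Finset.sum_add_distrib]
    refine Finset.sum_eq_zero fun b _ => ?_
    rw [smul_mul_smul_comm, smul_mul_smul_comm, create_mul_create, mul_comm (v b)]
    simp⟩

lemma createHom_ι_single (a : MajoranaIndex ι) :
    createHom (ExteriorAlgebra.ι ℂ (Pi.single a (1 : ℂ))) = create a := by
  rw [createHom, ExteriorAlgebra.lift_ι_apply]
  simp only [LinearMap.sum_apply, LinearMap.smulRight_apply, LinearMap.proj_apply]
  rw [Finset.sum_eq_single a]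
  · simp
  · intro b _ hb; simp [hb]
  · simp

/-- The product of the operators `create (g 0)`, `create (g 1)`, ... -/
def createProd {k : ℕ} (g : Fin k → MajoranaIndex ι) : Module.End ℂ (FockOp ι) :=
  (List.ofFn fun i => create (g i)).prod

lemma createProd_eq {k : ℕ} (g : Fin k → MajoranaIndex ι) :
    createProd g = createHom (ExteriorAlgebra.ιMulti ℂ k fun i => Pi.single (g i) (1 : ℂ)) := by
  rw [ExteriorAlgebra.ιMulti_apply, map_list_prod, List.map_ofFn, createProd]
  simp only [Function.comp_def, createHom_ι_single]

/-- The anticommuting family extends to the exterior algebra, where permutation signs are already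
known. They become the signs in the Pfaffian. -/
lemma createProd_comp_perm {k : ℕ} (g : Fin k → MajoranaIndex ι) (σ : Equiv.Perm (Fin k)) :
    createProd (g ∘ σ) = ((Equiv.Perm.sign σ : ℤ) : ℂ) • createProd g := by
  rw [createProd_eq, createProd_eq]
  have h := (ExteriorAlgebra.ιMulti ℂ k).map_perm (fun i => (Pi.single (g i) 1 : MajoranaIndex ι → ℂ)) σ
  simp only [Function.comp_apply] at h ⊢
  simp only [Function.comp_def] at h
  rw [h, Units.smul_def, map_zsmul, ← Int.cast_smul_eq_zsmul ℂ]

lemma createProd_of_not_injective {k : ℕ} (g : Fin k → MajoranaIndex ι)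
    (hg : ¬ Function.Injective g) : createProd g = 0 := by
  rw [createProd_eq, AlternatingMap.map_eq_zero_of_not_injective, map_zero]
  intro h
  exact hg fun i j hij => h (by simp only [hij])

lemma parityConj_conjTranspose_majoranaProd (l : List (MajoranaIndex ι)) :
    parityConj (majoranaProd l)ᴴ = (-1 : ℂ) ^ l.length • (majoranaProd l)ᴴ := by
  induction l with
  | nil => simp [parityConj_one]
  | cons a l ih =>
    rw [majoranaProd_cons, Matrix.conjTranspose_mul, conjTranspose_majorana, parityConj_mul, ih,
      parityConj_majorana, List.length_cons, pow_succ]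
    simp

/-- The last factor of the list acts first and each one multiplies from the right, so the order is
reversed; this is why the adjoint monomial appears. -/
lemma list_create_prod_one (l : List (MajoranaIndex ι)) (hl : l.Nodup) :
    (l.map create).prod (1 : FockOp ι) = (majoranaProd l)ᴴ := by
  induction l with
  | nil => simp
  | cons a l ih =>
    rw [List.nodup_cons] at hl
    rw [List.map_cons, List.prod_cons, Module.End.mul_apply, ih hl.2, create_apply,
      parityConj_conjTranspose_majoranaProd, majoranaProd_cons, Matrix.conjTranspose_mul,
      conjTranspose_majorana]
    have h := congrArg Matrix.conjTranspose (majorana_mul_majoranaProd_of_notMem hl.1)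
    rw [Matrix.conjTranspose_mul, Matrix.conjTranspose_smul, Matrix.conjTranspose_mul,
      conjTranspose_majorana] at h
    rw [Matrix.mul_smul]
    have h2 : star ((-1 : ℂ) ^ l.length) = (-1) ^ l.length := by simp
    rw [h2] at h
    rw [← h, ← two_smul ℂ, smul_smul]; norm_num

lemma createProd_orderEmb_one (S : Finset (MajoranaIndex ι)) {k : ℕ} (h : S.card = k) :
    createProd (S.orderEmbOfFin h) (1 : FockOp ι) = (monomial S)ᴴ := by
  subst h
  rw [monomial_eq_majoranaProd, ← list_create_prod_one _ (nodup_labelList S), createProd,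
    labelList, List.map_ofFn]
  rfl

end Exterior
-- Wick's formula as the exponential of a quadratic form.
section WickExpansion

variable {ι : Type*} [Fintype ι] [LinearOrder ι]

/-- The quadratic form whose exponential generates the Gaussian operator. -/
def quadForm (Γ : Matrix (MajoranaIndex ι) (MajoranaIndex ι) ℂ) : Module.End ℂ (FockOp ι) :=
  (-Complex.I / 2) • ∑ a, ∑ b, Γ a b • (create a * create b)

/-- The product of the entries of `Γ` along consecutive pairs of a sequence of labels. -/
def pairProd (Γ : Matrix (MajoranaIndex ι) (MajoranaIndex ι) ℂ) {p : ℕ}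
    (g : Fin (2 * p) → MajoranaIndex ι) : ℂ :=
  ∏ l : Fin p, Γ (g ⟨2 * (l : ℕ), by have := l.isLt; omega⟩)
    (g ⟨2 * (l : ℕ) + 1, by have := l.isLt; omega⟩)

lemma sum_fin_cons {M L : Type*} [AddCommMonoid M] [Fintype L] {q : ℕ}
    (F : (Fin (q + 1) → L) → M) : ∑ g, F g = ∑ a, ∑ g, F (Fin.cons a g) := by
  rw [← (Fin.consEquiv fun _ : Fin (q + 1) => L).sum_comp, Fintype.sum_prod_type]
  rfl

lemma createProd_cons {q : ℕ} (a : MajoranaIndex ι) (g : Fin q → MajoranaIndex ι) :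
    createProd (Fin.cons a g : Fin (q + 1) → MajoranaIndex ι) = create a * createProd g := by
  rw [createProd, List.ofFn_succ, List.prod_cons]
  simp [createProd]

lemma quadForm_pow (Γ : Matrix (MajoranaIndex ι) (MajoranaIndex ι) ℂ) (p : ℕ) :
    quadForm Γ ^ p = (-Complex.I / 2) ^ p •
      ∑ g : Fin (2 * p) → MajoranaIndex ι, pairProd Γ g • createProd g := by
  induction p with
  | zero =>
    rw [pow_zero, pow_zero, one_smul]
    have : IsEmpty (Fin (2 * 0)) := Fin.isEmpty
    rw [Fintype.sum_unique]
    simp [pairProd, createProd]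
  | succ p ih =>
    have h1 : ∑ g : Fin (2 * (p + 1)) → MajoranaIndex ι, pairProd Γ g • createProd g =
        ∑ a, ∑ b, ∑ g : Fin (2 * p) → MajoranaIndex ι,
          (Γ a b * pairProd Γ g) • (create a * create b * createProd g) := by
      refine (sum_fin_cons (q := 2 * p + 1) _).trans (Finset.sum_congr rfl fun a _ => ?_)
      refine (sum_fin_cons _).trans (Finset.sum_congr rfl fun b _ =>
        Finset.sum_congr rfl fun g _ => ?_)
      rw [createProd_cons, createProd_cons, mul_assoc]
      congr 1
      rw [pairProd, Fin.prod_univ_succ]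
      rfl
    rw [pow_succ', ih, h1, quadForm, smul_mul_smul_comm, ← pow_succ']
    congr 1
    rw [Finset.sum_mul]
    refine Finset.sum_congr rfl fun a _ => ?_
    rw [Finset.sum_mul]
    refine Finset.sum_congr rfl fun b _ => ?_
    rw [Finset.mul_sum]
    exact Finset.sum_congr rfl fun g _ => smul_mul_smul_comm _ _ _ _

lemma sum_orderEmb_comp_perm {M L : Type*} [AddCommMonoid M] [Fintype L] [LinearOrder L] {k : ℕ}
    (F : (Fin k → L) → M) (S : Finset L) (h : S.card = k) :
    ∑ σ : Equiv.Perm (Fin k), F (S.orderEmbOfFin h ∘ σ) =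
      ∑ g ∈ (Finset.univ : Finset (Fin k → L)).filter
        (fun g => Function.Injective g ∧ Finset.univ.image g = S), F g := by
  have himg : ∀ g : Fin k → L, Finset.univ.image g = S →
      ∀ i, ∃ j, S.orderEmbOfFin h j = g i := by
    intro g hg i
    have h1 : g i ∈ S := hg ▸ Finset.mem_image_of_mem g (Finset.mem_univ i)
    have h2 : g i ∈ Set.range (S.orderEmbOfFin h) := by
      rw [Finset.range_orderEmbOfFin]; exact h1
    exact h2
  refine Finset.sum_bij (fun σ _ => S.orderEmbOfFin h ∘ σ) ?_ ?_ ?_ (fun _ _ => rfl)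
  · intro σ _
    rw [Finset.mem_filter]
    refine ⟨Finset.mem_univ _, (S.orderEmbOfFin h).injective.comp σ.injective, ?_⟩
    refine Finset.coe_injective ?_
    rw [Finset.coe_image, Finset.coe_univ, Set.image_univ, σ.surjective.range_comp,
      Finset.range_orderEmbOfFin]
  · intro σ _ τ _ hστ
    ext i
    exact congrArg _ ((S.orderEmbOfFin h).injective (congrFun hστ i))
  · intro g hg
    rw [Finset.mem_filter] at hg
    choose f hf using himg g hg.2.2
    have hfi : Function.Injective f := fun i j hij => hg.2.1 (by rw [← hf, ← hf, hij])
    refine ⟨Equiv.ofBijective f (Finite.injective_iff_bijective.1 hfi), Finset.mem_univ _, ?_⟩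
    funext i
    exact hf i

/-- Tuples with a repetition contribute nothing, and an injective tuple is the increasing
enumeration of its image followed by a unique permutation. -/
lemma sum_card_eq_sum_perm {M L : Type*} [AddCommMonoid M] [Fintype L] [LinearOrder L] {k : ℕ}
    (F : (Fin k → L) → M) (hF : ∀ g, ¬ Function.Injective g → F g = 0) (G : Finset L → M)
    (hG : ∀ S (h : S.card = k), G S = ∑ σ : Equiv.Perm (Fin k), F (S.orderEmbOfFin h ∘ σ)) :
    ∑ S ∈ (Finset.univ : Finset (Finset L)).filter (fun S => S.card = k), G S = ∑ g, F g := by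
  have h1 : ∑ g, F g = ∑ g ∈ Finset.univ.filter (fun g : Fin k → L => Function.Injective g),
      F g := by
    rw [Finset.sum_filter]
    refine Finset.sum_congr rfl fun g _ => ?_
    split_ifs with h
    · rfl
    · exact hF g h
  rw [h1, ← Finset.sum_fiberwise_of_maps_to (s := Finset.univ.filter
    (fun g : Fin k → L => Function.Injective g))
    (t := Finset.univ.filter (fun S : Finset L => S.card = k)) (g := fun g => Finset.univ.image g)]
  · refine Finset.sum_congr rfl fun S hS => ?_
    rw [hG S (Finset.mem_filter.1 hS).2, sum_orderEmb_comp_perm, Finset.filter_filter]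
  · intro g hg
    rw [Finset.mem_filter] at hg ⊢
    exact ⟨Finset.mem_univ _, by rw [Finset.card_image_of_injective _ hg.2, Finset.card_univ,
      Fintype.card_fin]⟩

lemma pfaffian_two_mul {p : ℕ} (A : Matrix (Fin (2 * p)) (Fin (2 * p)) ℂ) :
    pfaffian A = (1 / (2 ^ p * (p.factorial : ℂ))) *
      ∑ σ : Equiv.Perm (Fin (2 * p)), ((Equiv.Perm.sign σ : ℤ) : ℂ) *
        ∏ l : Fin p, A (σ ⟨2 * (l : ℕ), by have := l.isLt; omega⟩)
          (σ ⟨2 * (l : ℕ) + 1, by have := l.isLt; omega⟩) := by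
  have hp : 2 * p / 2 = p := by omega
  rw [pfaffian, if_pos (even_two_mul p)]
  congr 1
  · rw [hp]
  refine Finset.sum_congr rfl fun σ _ => ?_
  congr 1
  exact Fintype.prod_equiv (finCongr hp) _ _ fun l => rfl

lemma wickValue_of_card {S : Finset (MajoranaIndex ι)} {p : ℕ} (h : S.card = 2 * p)
    (Γ : Matrix (MajoranaIndex ι) (MajoranaIndex ι) ℂ) :
    wickValue Γ S = (-Complex.I / 2) ^ p / (p.factorial : ℂ) *
      ∑ σ : Equiv.Perm (Fin (2 * p)), ((Equiv.Perm.sign σ : ℤ) : ℂ) *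
        pairProd Γ (S.orderEmbOfFin h ∘ σ) := by
  have key : ∀ k (hk : S.card = k) (hk2 : k = 2 * p), wickValue Γ S = (-Complex.I) ^ p *
      pfaffian (Γ.submatrix (S.orderEmbOfFin h) (S.orderEmbOfFin h)) := by
    intro k hk hk2
    have h3 : S.card / 2 = p := by omega
    rw [wickValue, h3]
    congr 1
    have : ∀ k (hk : S.card = k),
        pfaffian (Γ.submatrix (S.orderEmbOfFin hk) (S.orderEmbOfFin hk)) =
        pfaffian (Γ.submatrix (S.orderEmbOfFin rfl) (S.orderEmbOfFin rfl)) := by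
      intro k hk; subst hk; rfl
    exact (this _ h).symm
  rw [key _ rfl h, pfaffian_two_mul, ← mul_assoc]
  congr 1
  rw [div_pow]; field_simp

lemma wickValue_of_odd {S : Finset (MajoranaIndex ι)} (h : ¬ Even S.card)
    (Γ : Matrix (MajoranaIndex ι) (MajoranaIndex ι) ℂ) : wickValue Γ S = 0 := by
  rw [wickValue, pfaffian, if_neg h, mul_zero]

lemma sum_wick_smul_monomial (Γ : Matrix (MajoranaIndex ι) (MajoranaIndex ι) ℂ) (p : ℕ) :
    ∑ S ∈ (Finset.univ : Finset (Finset (MajoranaIndex ι))).filter (fun S => S.card = 2 * p),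
      wickValue Γ S • (monomial S)ᴴ = (1 / (p.factorial : ℂ)) • (quadForm Γ ^ p) 1 := by
  rw [quadForm_pow, LinearMap.smul_apply, LinearMap.sum_apply, smul_smul, Finset.smul_sum]
  refine sum_card_eq_sum_perm (L := MajoranaIndex ι) _ ?_ _ ?_
  · intro g hg
    rw [createProd_of_not_injective g hg]; simp
  · intro S h
    rw [wickValue_of_card h, mul_smul, Finset.sum_smul, Finset.smul_sum]
    refine Finset.sum_congr rfl fun σ _ => ?_
    rw [createProd_comp_perm, ← createProd_orderEmb_one S h]
    simp only [LinearMap.smul_apply, smul_smul]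
    congr 1; ring

/-- The truncation is exact, since a monomial has at most `2n` factors. `N` is left free so that two
different truncations can be compared. -/
lemma gaussianOperator_eq_exp (Γ : Matrix (MajoranaIndex ι) (MajoranaIndex ι) ℂ) {N : ℕ}
    (hN : Fintype.card ι < N) :
    gaussianOperator Γ = (1 / 2 ^ Fintype.card ι : ℂ) •
      ∑ p ∈ Finset.range N, (1 / (p.factorial : ℂ)) • (quadForm Γ ^ p) 1 := by
  simp_rw [← sum_wick_smul_monomial, Finset.sum_filter]
  rw [Finset.sum_comm, gaussianOperator, Finset.smul_sum]
  refine Finset.sum_congr rfl fun S _ => ?_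
  by_cases hS : Even S.card
  · obtain ⟨p, hp⟩ := hS
    have := Finset.card_le_univ S
    rw [Fintype.card_lex, Fintype.card_prod, Fintype.card_fin] at this
    rw [Finset.sum_eq_single p, if_pos (by omega), smul_smul]
    · congr 1; ring
    · intro q _ hq; rw [if_neg (by omega)]
    · intro h; rw [Finset.mem_range] at h; omega
  · rw [wickValue_of_odd hS]; simp

lemma create_commute_quadForm (Γ : Matrix (MajoranaIndex ι) (MajoranaIndex ι) ℂ)
    (a : MajoranaIndex ι) : Commute (create a) (quadForm Γ) := by
  refine Commute.smul_right (Commute.sum_right _ _ _ fun b _ => Commute.sum_right _ _ _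
    fun c _ => Commute.smul_right ?_ _) _
  change create a * (create b * create c) = create b * create c * create a
  rw [← mul_assoc, create_mul_create a b]
  change -(create b * create a * create c) = _
  rw [mul_assoc, create_mul_create a c]
  have h : create b * -(create c * create a) =
      -(create b * (create c * create a) : Module.End ℂ (FockOp ι)) :=
    LinearMap.ext fun Y => map_neg (create b) _
  rw [h, neg_neg, mul_assoc]

/-- Contraction acts as a derivation on the even element `q`. Antisymmetry of `Γ` makes the two
contributions equal, which cancels the factor one half in `quadForm`. -/
lemma annihilate_mul_quadForm {Γ : Matrix (MajoranaIndex ι) (MajoranaIndex ι) ℂ}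
    (hΓ : Γᵀ = -Γ) (j : MajoranaIndex ι) :
    annihilate j * quadForm Γ =
      quadForm Γ * annihilate j + (-Complex.I) • ∑ k, Γ j k • create k := by
  have h1 : ∀ a b, annihilate j * (create a * create b : Module.End ℂ (FockOp ι)) =
      create a * create b * annihilate j + ((if j = a then create b else 0) -
        if j = b then create a else 0) := by
    intro a b
    rw [← mul_assoc, annihilate_mul_create, sub_mul, mul_assoc (create a), annihilate_mul_create,
      mul_sub, ← mul_assoc]
    split_ifs <;> simp <;> abel
  have h2 : ∀ a, Γ a j = -Γ j a := fun a => by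
    have := congrFun (congrFun hΓ j) a
    simpa using this
  simp only [quadForm, mul_smul_comm, smul_mul_assoc, Finset.mul_sum, Finset.sum_mul, h1, smul_add,
    Finset.sum_add_distrib]
  congr 1
  have h3 : ∑ a, ∑ b, Γ a b • ((if j = a then create b else 0) -
        if j = b then (create a : Module.End ℂ (FockOp ι)) else 0) =
      (2 : ℂ) • ∑ k, Γ j k • create k := by
    simp only [smul_sub, Finset.sum_sub_distrib, smul_ite, smul_zero, Finset.sum_ite_eq,
      Finset.mem_univ, if_true]
    rw [Finset.sum_comm]
    simp only [Finset.sum_ite_eq, Finset.mem_univ, if_true, h2, neg_smul, Finset.sum_neg_distrib]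
    rw [two_smul, sub_neg_eq_add]
  rw [h3, smul_smul]; congr 1; ring

lemma annihilate_mul_quadForm_pow {Γ : Matrix (MajoranaIndex ι) (MajoranaIndex ι) ℂ}
    (hΓ : Γᵀ = -Γ) (j : MajoranaIndex ι) (p : ℕ) :
    annihilate j * quadForm Γ ^ (p + 1) = quadForm Γ ^ (p + 1) * annihilate j +
      ((p + 1 : ℕ) : ℂ) • (((-Complex.I) • ∑ k, Γ j k • create k) * quadForm Γ ^ p) := by
  set v : Module.End ℂ (FockOp ι) := (-Complex.I) • ∑ k, Γ j k • create k with hv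
  have hc : Commute (quadForm Γ) v :=
    (Commute.smul_left (Commute.sum_left _ _ _ fun k _ =>
      Commute.smul_left (create_commute_quadForm Γ k) _) _).symm
  induction p with
  | zero => simp [annihilate_mul_quadForm hΓ, ← hv]
  | succ p ih =>
    rw [pow_succ' _ (p + 1), ← mul_assoc, annihilate_mul_quadForm hΓ, ← hv, add_mul, mul_assoc, ih,
      mul_add, mul_smul_comm, ← mul_assoc, ← mul_assoc, hc.eq, mul_assoc v, ← pow_succ', ← pow_succ', add_assoc]
    congr 1
    rw [Nat.cast_succ (p + 1), add_smul, one_smul]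

lemma annihilate_one (j : MajoranaIndex ι) : annihilate j (1 : FockOp ι) = 0 := by
  rw [annihilate_apply, parityConj_one]; simp

/-- This is the derivative of an exponential: the commutator of contraction with `q` commutes with
`q`, and contraction kills `1`. -/
theorem annihilate_gaussianOperator {Γ : Matrix (MajoranaIndex ι) (MajoranaIndex ι) ℂ}
    (hΓ : Γᵀ = -Γ) (j : MajoranaIndex ι) :
    annihilate j (gaussianOperator Γ) =
      (-Complex.I) • ∑ k, Γ j k • create k (gaussianOperator Γ) := by
  have hR : (-Complex.I) • ∑ k, Γ j k • create k (gaussianOperator Γ) =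
      ((-Complex.I) • ∑ k, Γ j k • create k : Module.End ℂ (FockOp ι)) (gaussianOperator Γ) := by
    simp [LinearMap.sum_apply]
  rw [hR]
  -- Contraction lowers the power of `q` by one, so the left side is given one more term than the
  -- right and the sums then match termwise.
  conv_lhs => rw [gaussianOperator_eq_exp Γ (N := Fintype.card ι + 1 + 1) (by omega), map_smul]
  conv_rhs => rw [gaussianOperator_eq_exp Γ (N := Fintype.card ι + 1) (by omega), map_smul]
  congr 1
  rw [Finset.sum_range_succ', map_add, map_smul (annihilate j) (1 / ((0 : ℕ).factorial : ℂ)),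
    pow_zero, Module.End.one_apply, annihilate_one, smul_zero, add_zero, map_sum, map_sum]
  refine Finset.sum_congr rfl fun p _ => ?_
  rw [map_smul, map_smul, ← Module.End.mul_apply, annihilate_mul_quadForm_pow hΓ,
    LinearMap.add_apply, Module.End.mul_apply, annihilate_one, map_zero, zero_add,
    LinearMap.smul_apply, smul_smul, Module.End.mul_apply]
  congr 1
  rw [Nat.factorial_succ, Nat.cast_mul]
  have h1 : ((p + 1 : ℕ) : ℂ) ≠ 0 := Nat.cast_ne_zero.2 p.succ_ne_zero
  have h2 : (p.factorial : ℂ) ≠ 0 := Nat.cast_ne_zero.2 p.factorial_ne_zero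
  field_simp

end WickExpansion
-- The linear relation characterizing Gaussian operators, and their products.
section GaussianRelation

variable {ι : Type*} [Fintype ι] [LinearOrder ι]

/-- The linear combination `∑ u_a m_a` of Majorana operators. -/
def field : (MajoranaIndex ι → ℂ) →ₗ[ℂ] FockOp ι :=
  ∑ a, (LinearMap.proj a).smulRight (majorana a)

lemma field_apply (u : MajoranaIndex ι → ℂ) : field u = ∑ a, u a • majorana a := by
  simp [field]

lemma field_vecMul (w : MajoranaIndex ι → ℂ) (A : Matrix (MajoranaIndex ι) (MajoranaIndex ι) ℂ) :
    field (w ᵥ* A) = ∑ a, w a • field (A a) := by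
  rw [← map_smul_sum_eq_vecMul w A]
where
  map_smul_sum_eq_vecMul (w : MajoranaIndex ι → ℂ)
      (A : Matrix (MajoranaIndex ι) (MajoranaIndex ι) ℂ) :
      ∑ a, w a • field (A a) = field (w ᵥ* A) := by
    simp_rw [← map_smul, ← map_sum]
    congr 1
    ext b
    simp [Matrix.vecMul, dotProduct]

/-- `X` intertwines the linear substitutions `A` and `B` of the Majorana operators. -/
def Intertwines (X : FockOp ι) (A B : Matrix (MajoranaIndex ι) (MajoranaIndex ι) ℂ) : Prop :=
  ∀ w : MajoranaIndex ι → ℂ, X * field (w ᵥ* A) = field (w ᵥ* B) * X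

lemma intertwines_of_rows {X : FockOp ι} {A B : Matrix (MajoranaIndex ι) (MajoranaIndex ι) ℂ}
    (h : ∀ j, X * field (A j) = field (B j) * X) : Intertwines X A B := by
  intro w
  rw [field_vecMul, field_vecMul, Finset.mul_sum, Finset.sum_mul]
  exact Finset.sum_congr rfl fun j _ => by rw [Matrix.mul_smul, Matrix.smul_mul, h]

lemma Intertwines.row {X : FockOp ι} {A B : Matrix (MajoranaIndex ι) (MajoranaIndex ι) ℂ}
    (h : Intertwines X A B) (j : MajoranaIndex ι) : X * field (A j) = field (B j) * X := by
  have := h (Pi.single j 1)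
  rwa [Matrix.single_one_vecMul, Matrix.single_one_vecMul] at this

/-- The freedom of a common left factor is what allows the relations of two operators to be matched
in the middle and composed. -/
lemma Intertwines.mul_left {X : FockOp ι} {A B : Matrix (MajoranaIndex ι) (MajoranaIndex ι) ℂ}
    (h : Intertwines X A B) (Q : Matrix (MajoranaIndex ι) (MajoranaIndex ι) ℂ) :
    Intertwines X (Q * A) (Q * B) := by
  intro w
  rw [← Matrix.vecMul_vecMul, ← Matrix.vecMul_vecMul]
  exact h _

lemma Intertwines.comp {X Y : FockOp ι}
    {A B C : Matrix (MajoranaIndex ι) (MajoranaIndex ι) ℂ}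
    (hX : Intertwines X B C) (hY : Intertwines Y A B) : Intertwines (X * Y) A C := by
  intro w
  rw [mul_assoc, hY, ← mul_assoc, hX, mul_assoc]

/-- The linear relation that characterizes the multiples of the Gaussian operator of `Γ`. -/
def GaussianRelation (X : FockOp ι)
    (Γ : Matrix (MajoranaIndex ι) (MajoranaIndex ι) ℂ) : Prop :=
  parity * X = X * parity ∧ Intertwines X (1 + Complex.I • Γ) (1 - Complex.I • Γ)

lemma field_one_add (Γ : Matrix (MajoranaIndex ι) (MajoranaIndex ι) ℂ) (j : MajoranaIndex ι) :
    field ((1 + Complex.I • Γ) j) = majorana j + Complex.I • ∑ k, Γ j k • majorana k := by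
  have h : (1 + Complex.I • Γ) j = Pi.single j (1 : ℂ) + Complex.I • Γ j := by
    ext k; simp [Matrix.one_apply, Pi.single_apply, eq_comm]
  rw [h, map_add, map_smul, field_apply, field_apply]
  congr 1
  rw [Finset.sum_eq_single j] <;> simp +contextual

lemma field_one_sub (Γ : Matrix (MajoranaIndex ι) (MajoranaIndex ι) ℂ) (j : MajoranaIndex ι) :
    field ((1 - Complex.I • Γ) j) = majorana j - Complex.I • ∑ k, Γ j k • majorana k := by
  have h := field_one_add (-Γ) j
  rw [smul_neg, ← sub_eq_add_neg] at h
  rw [h]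
  simp [sub_eq_add_neg]

lemma gaussianRelation_iff {X : FockOp ι}
    {Γ : Matrix (MajoranaIndex ι) (MajoranaIndex ι) ℂ} :
    GaussianRelation X Γ ↔ parity * X = X * parity ∧ ∀ j, X * majorana j - majorana j * X =
      (-Complex.I) • ∑ k, Γ j k • (X * majorana k + majorana k * X) := by
  have key : ∀ j, (X * field ((1 + Complex.I • Γ) j) = field ((1 - Complex.I • Γ) j) * X ↔
      X * majorana j - majorana j * X =
        (-Complex.I) • ∑ k, Γ j k • (X * majorana k + majorana k * X)) := by
    intro j
    rw [field_one_add, field_one_sub, mul_add, sub_mul]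
    simp only [smul_add, Finset.sum_add_distrib, Matrix.mul_smul, Matrix.smul_mul, neg_smul,
      Finset.mul_sum, Finset.sum_mul]
    constructor <;> intro h
    · rw [← sub_eq_zero] at h ⊢
      rw [← h]; abel
    · rw [← sub_eq_zero] at h ⊢
      rw [← h]; abel
  rw [GaussianRelation]
  refine and_congr_right fun _ => ⟨fun h j => (key j).1 (h.row j),
    fun h => intertwines_of_rows fun j => (key j).2 (h j)⟩

lemma trace_gaussianOperator (Γ : Matrix (MajoranaIndex ι) (MajoranaIndex ι) ℂ) :
    (gaussianOperator Γ).trace = 1 := by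
  have h := trace_sum_smul_conjTranspose_monomial (wickValue Γ) ∅
  rw [monomial_empty, mul_one] at h
  rw [gaussianOperator, h]
  rw [wickValue_of_card (p := 0) (by simp)]
  simp [pairProd]

lemma parity_mul_gaussianOperator (Γ : Matrix (MajoranaIndex ι) (MajoranaIndex ι) ℂ) :
    parity * gaussianOperator Γ = gaussianOperator Γ * parity := by
  rw [gaussianOperator, Finset.mul_sum, Finset.sum_mul]
  refine Finset.sum_congr rfl fun S _ => ?_
  by_cases h : Even S.card
  · rw [Matrix.mul_smul, parity_mul_conjTranspose_monomial, h.neg_one_pow, one_smul,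
      Matrix.smul_mul]
  · rw [wickValue_of_odd h]; simp

lemma parityConj_of_even {X : FockOp ι} (h : parity * X = X * parity) : parityConj X = X := by
  rw [parityConj, h, mul_assoc, parity_mul_self, mul_one]

theorem gaussianRelation_gaussianOperator {Γ : Matrix (MajoranaIndex ι) (MajoranaIndex ι) ℂ}
    (hΓ : Γᵀ = -Γ) : GaussianRelation (gaussianOperator Γ) Γ := by
  have he := parity_mul_gaussianOperator Γ
  refine gaussianRelation_iff.2 ⟨he, fun j => ?_⟩
  have h := annihilate_gaussianOperator hΓ j
  simp only [annihilate_apply, create_apply, parityConj_of_even he] at h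
  have h' := congrArg (fun Z => (2 : ℂ) • Z) h
  simp only [smul_smul, Finset.smul_sum] at h'
  rw [show (2 : ℂ) * (1 / 2) = 1 by norm_num, one_smul] at h'
  rw [h', Finset.smul_sum]
  refine Finset.sum_congr rfl fun k _ => ?_
  rw [smul_smul]; congr 1; ring

/-- Multiplying the relation by `m_l` and taking traces turns the anticommutators on the right into
`2 tr X` at `k = l`. -/
lemma GaussianRelation.covarianceMatrix {X : FockOp ι}
    {Γ : Matrix (MajoranaIndex ι) (MajoranaIndex ι) ℂ} (h : GaussianRelation X Γ) :
    covarianceMatrix X = X.trace • Γ := by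
  ext j l
  have h1 := congrArg (fun Z => (Z * majorana l).trace) ((gaussianRelation_iff.1 h).2 j)
  have h2 : ∀ k, ((X * majorana k + majorana k * X) * majorana l).trace =
      if k = l then 2 * X.trace else 0 := by
    intro k
    have : ((X * majorana k + majorana k * X) * majorana l).trace =
        (X * (majorana k * majorana l + majorana l * majorana k)).trace := by
      rw [add_mul, mul_add, Matrix.trace_add, Matrix.trace_add, mul_assoc,
        Matrix.trace_mul_cycle (majorana k), Matrix.trace_mul_comm _ X]
    rw [this, majorana_anticomm]
    split_ifs
    · rw [mul_two, Matrix.trace_add, two_mul]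
    · simp
  simp only [Matrix.smul_mul, Finset.sum_mul, Matrix.trace_smul, Matrix.trace_sum, h2,
    smul_eq_mul, mul_ite, mul_zero, Finset.sum_ite_eq', Finset.mem_univ, if_true] at h1
  have h3 : ((X * majorana j - majorana j * X) * majorana l).trace =
      (X * (majorana j * majorana l - majorana l * majorana j)).trace := by
    rw [sub_mul, mul_sub, Matrix.trace_sub, Matrix.trace_sub, mul_assoc,
      Matrix.trace_mul_cycle (majorana j), Matrix.trace_mul_comm _ X]
  rw [FermionNegativity.covarianceMatrix, Matrix.of_apply, ← h3, h1, Matrix.smul_apply,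
    smul_eq_mul]
  linear_combination (-Γ j l * X.trace) * Complex.I_sq

lemma majorana_mul_majoranaProd_erase (k : MajoranaIndex ι) (l : List (MajoranaIndex ι))
    (hk : k ∈ l) : ∃ ε : ℂ, majorana k * majoranaProd l = ε • majoranaProd (l.erase k) := by
  induction l with
  | nil => simp at hk
  | cons b l ih =>
    by_cases hb : b = k
    · subst hb
      exact ⟨1, by rw [majoranaProd_cons, ← mul_assoc, majorana_mul_self]; simp⟩
    · obtain ⟨ε, hε⟩ := ih (by simpa [Ne.symm hb] using hk)
      refine ⟨-ε, ?_⟩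
      rw [majoranaProd_cons, ← mul_assoc, majorana_mul_of_ne (Ne.symm hb), neg_mul, mul_assoc, hε,
        List.erase_cons_tail (by simpa using hb), majoranaProd_cons]
      simp

/-- Odd moments vanish by parity. For an even moment, split off the first factor `m_a` and apply the
relation: anticommutators with the remaining odd product either vanish or remove one of its factors,
leaving moments of degree two lower. Induction descends to the trace. -/
lemma GaussianRelation.eq_zero_of_trace {X : FockOp ι}
    {Γ : Matrix (MajoranaIndex ι) (MajoranaIndex ι) ℂ} (h : GaussianRelation X Γ)
    (h0 : X.trace = 0) : X = 0 := by
  obtain ⟨he, hr⟩ := gaussianRelation_iff.1 h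
  have key : ∀ (q : ℕ) (l : List (MajoranaIndex ι)), l.Nodup → l.length = q →
      (X * majoranaProd l).trace = 0 := by
    intro q
    induction q using Nat.strong_induction_on with
    | _ q ih =>
      intro l hl hq
      by_cases hodd : Odd l.length
      · refine trace_eq_zero_of_conj (U := parity) (V := parity) parity_mul_self ?_
        rw [← mul_assoc, he, mul_assoc X, parity_mul_majoranaProd, hodd.neg_one_pow,
          Matrix.mul_smul, Matrix.smul_mul, mul_assoc, mul_assoc, parity_mul_self, mul_one,
          neg_one_smul]
      · cases l with
        | nil => simpa using h0
        | cons a l =>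
          rw [List.nodup_cons] at hl
          have hlo : Odd l.length := by
            rw [List.length_cons] at hodd
            by_contra h'
            rw [Nat.not_odd_iff_even] at h'
            exact hodd h'.add_one
          have h1 := congrArg (fun Z => (Z * majoranaProd l).trace) (hr a)
          have h2 : ∀ k, ((X * majorana k + majorana k * X) * majoranaProd l).trace = 0 := by
            intro k
            have h3 : ((X * majorana k + majorana k * X) * majoranaProd l).trace =
                (X * (majorana k * majoranaProd l + majoranaProd l * majorana k)).trace := by
              rw [add_mul, mul_add, Matrix.trace_add, Matrix.trace_add, mul_assoc,
                Matrix.trace_mul_cycle (majorana k), Matrix.trace_mul_comm _ X]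
            rw [h3]
            by_cases hk : k ∈ l
            · have h4 : majoranaProd l * majorana k = majorana k * majoranaProd l := by
                rw [majorana_mul_majoranaProd_of_mem hl.2 hk, hlo.neg_one_pow]; simp
              obtain ⟨ε, hε⟩ := majorana_mul_majoranaProd_erase k l hk
              have h5 := ih (l.erase k).length
                (by rw [List.length_erase_of_mem hk, ← hq, List.length_cons]; omega)
                (l.erase k) (hl.2.erase k) rfl
              rw [h4, hε, mul_add, Matrix.trace_add, Matrix.mul_smul, Matrix.trace_smul, h5]
              simp
            · rw [majorana_mul_majoranaProd_of_notMem hk, hlo.neg_one_pow]; simp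
          simp only [Matrix.smul_mul, Finset.sum_mul, Matrix.trace_smul, Matrix.trace_sum, h2,
            smul_zero, Finset.sum_const_zero] at h1
          have h3 : ((X * majorana a - majorana a * X) * majoranaProd l).trace =
              (X * (majorana a * majoranaProd l - majoranaProd l * majorana a)).trace := by
            rw [sub_mul, mul_sub, Matrix.trace_sub, Matrix.trace_sub, mul_assoc,
              Matrix.trace_mul_cycle (majorana a), Matrix.trace_mul_comm _ X]
          have h4 : majoranaProd l * majorana a = -(majorana a * majoranaProd l) := by
            rw [majorana_mul_majoranaProd_of_notMem hl.1, hlo.neg_one_pow]; simp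
          rw [h3, h4, sub_neg_eq_add, mul_add, Matrix.trace_add] at h1
          rw [majoranaProd_cons]
          linear_combination h1 / 2
  refine ext_moments fun S => ?_
  rw [monomial_eq_majoranaProd, key _ _ (nodup_labelList S) rfl]; simp

lemma GaussianRelation.smul {X : FockOp ι} {Γ : Matrix (MajoranaIndex ι) (MajoranaIndex ι) ℂ}
    (h : GaussianRelation X Γ) (c : ℂ) : GaussianRelation (c • X) Γ :=
  ⟨by rw [Matrix.mul_smul, Matrix.smul_mul, h.1],
    fun w => by rw [Matrix.mul_smul, Matrix.smul_mul, h.2]⟩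

lemma GaussianRelation.sub {X Y : FockOp ι} {Γ : Matrix (MajoranaIndex ι) (MajoranaIndex ι) ℂ}
    (h : GaussianRelation X Γ) (h' : GaussianRelation Y Γ) : GaussianRelation (X - Y) Γ :=
  ⟨by rw [mul_sub, sub_mul, h.1, h'.1], fun w => by rw [mul_sub, sub_mul, h.2, h'.2]⟩

theorem GaussianRelation.eq_smul {X : FockOp ι}
    {Γ : Matrix (MajoranaIndex ι) (MajoranaIndex ι) ℂ} (hΓ : Γᵀ = -Γ)
    (h : GaussianRelation X Γ) : X = X.trace • gaussianOperator Γ := by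
  refine sub_eq_zero.1 ((h.sub ((gaussianRelation_gaussianOperator hΓ).smul _)).eq_zero_of_trace ?_)
  rw [Matrix.trace_sub, Matrix.trace_smul, trace_gaussianOperator]; simp

theorem isGaussianWith_gaussianOperator {Γ : Matrix (MajoranaIndex ι) (MajoranaIndex ι) ℂ}
    (hΓ : Γᵀ = -Γ) : IsGaussianWith (gaussianOperator Γ) Γ := by
  refine ⟨?_, trace_sum_smul_conjTranspose_monomial _⟩
  rw [(gaussianRelation_gaussianOperator hΓ).covarianceMatrix, trace_gaussianOperator, one_smul]

lemma IsGaussianWith.eq_gaussianOperator {X : FockOp ι}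
    {Γ : Matrix (MajoranaIndex ι) (MajoranaIndex ι) ℂ} (h : IsGaussianWith X Γ) :
    X = gaussianOperator Γ :=
  ext_moments fun S => by rw [h.2, gaussianOperator, trace_sum_smul_conjTranspose_monomial]

lemma transpose_covarianceMatrix (X : FockOp ι) :
    (covarianceMatrix X)ᵀ = -covarianceMatrix X := by
  ext j k
  simp only [covarianceMatrix, Matrix.transpose_apply, Matrix.of_apply, Matrix.neg_apply]
  rw [← neg_sub (majorana j * majorana k), mul_neg, Matrix.trace_neg]; ring

/-- The algebra behind the composition of Gaussian operators. -/
lemma composition_identities {κ : Type*} [Fintype κ] [DecidableEq κ] {Γ Γ' : Matrix κ κ ℂ}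
    (hu : IsUnit (1 - Γ' * Γ)) (hu' : IsUnit (1 - Γ * Γ')) :
    (1 + Complex.I • Γ) * (1 - Γ' * Γ)⁻¹ * (1 - Complex.I • Γ') =
        (1 - Complex.I • Γ') * (1 - Γ * Γ')⁻¹ * (1 + Complex.I • Γ) ∧
      (1 + Complex.I • Γ) * (1 - Γ' * Γ)⁻¹ * (1 + Complex.I • Γ') +
        (1 - Complex.I • Γ') * (1 - Γ * Γ')⁻¹ * (1 - Complex.I • Γ) = 1 + 1 := by
  rw [Matrix.isUnit_iff_isUnit_det] at hu hu'
  set F := (1 - Γ' * Γ)⁻¹ with hF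
  set E := (1 - Γ * Γ')⁻¹ with hE
  have hF1 : F * (1 - Γ' * Γ) = 1 := Matrix.nonsing_inv_mul _ hu
  have hF2 : (1 - Γ' * Γ) * F = 1 := Matrix.mul_nonsing_inv _ hu
  have hE1 : E * (1 - Γ * Γ') = 1 := Matrix.nonsing_inv_mul _ hu'
  have hE2 : (1 - Γ * Γ') * E = 1 := Matrix.mul_nonsing_inv _ hu'
  -- Push-through identities for the two inverses; with them both sides of the claims expand to the
  -- same normal form.
  have h1 : Γ' * E = F * Γ' := by
    calc Γ' * E = F * (1 - Γ' * Γ) * (Γ' * E) := by rw [hF1, one_mul]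
      _ = F * Γ' * ((1 - Γ * Γ') * E) := by noncomm_ring
      _ = F * Γ' := by rw [hE2, mul_one]
  have h2 : E * Γ = Γ * F := by
    calc E * Γ = E * Γ * ((1 - Γ' * Γ) * F) := by rw [hF2, mul_one]
      _ = E * (1 - Γ * Γ') * (Γ * F) := by noncomm_ring
      _ = Γ * F := by rw [hE1, one_mul]
  have h3 : F * (Γ' * Γ) = F - 1 := by
    rw [← hF1]; noncomm_ring
  have h4 : Γ * (F * Γ') = E - 1 := by
    rw [← h1, ← hE2]; noncomm_ring
  have hI : ∀ M : Matrix κ κ ℂ,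
      Complex.I • Complex.I • M = -M := fun M => by
    rw [smul_smul, Complex.I_mul_I, neg_one_smul]
  constructor
  · simp only [add_mul, sub_mul, mul_add, mul_sub, one_mul, mul_one, smul_mul_assoc,
      mul_smul_comm, mul_assoc, h1, h2, h3, h4, smul_add, smul_sub, hI]
    abel
  · simp only [add_mul, sub_mul, mul_add, mul_sub, one_mul, mul_one, smul_mul_assoc,
      mul_smul_comm, mul_assoc, h1, h2, h3, h4, smul_add, smul_sub, hI]
    abel

/-- The composition rule for the covariance matrices of Gaussian operators. -/
theorem GaussianRelation.mul {X Y : FockOp ι}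
    {Γ Γ' : Matrix (MajoranaIndex ι) (MajoranaIndex ι) ℂ} (hΓ : Γᵀ = -Γ) (hΓ' : Γ'ᵀ = -Γ')
    (hX : GaussianRelation X Γ) (hY : GaussianRelation Y Γ') (hu : IsUnit (1 - Γ' * Γ))
    (hu' : IsUnit (1 - Γ * Γ')) :
    ∃ C : Matrix (MajoranaIndex ι) (MajoranaIndex ι) ℂ, Cᵀ = -C ∧ GaussianRelation (X * Y) C ∧
      1 + Complex.I • C =
        (1 + Complex.I • Γ) * (1 - Γ' * Γ)⁻¹ * (1 + Complex.I • Γ') := by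
  obtain ⟨hmid, hsum⟩ := composition_identities hu hu'
  set F := (1 - Γ' * Γ)⁻¹ with hF
  set E := (1 - Γ * Γ')⁻¹ with hE
  set C := (-Complex.I) • ((1 + Complex.I • Γ) * F * (1 + Complex.I • Γ') - 1) with hC
  have hC1 : 1 + Complex.I • C = (1 + Complex.I • Γ) * F * (1 + Complex.I • Γ') := by
    rw [hC, smul_smul, mul_neg, Complex.I_mul_I, neg_neg, one_smul]; abel
  have hC2 : 1 - Complex.I • C = (1 - Complex.I • Γ') * E * (1 - Complex.I • Γ) := by
    rw [← hC1] at hsum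
    rw [← sub_eq_zero] at hsum ⊢
    rw [← neg_eq_zero, ← hsum]; abel
  refine ⟨C, ?_, ⟨?_, ?_⟩, hC1⟩
  -- Transposing the formula for `1 + iC` produces exactly the formula for `1 - iC`, which is the
  -- antisymmetry of `C`.
  · have hFt : Fᵀ = E := by
      rw [hF, hE, Matrix.transpose_nonsing_inv, Matrix.transpose_sub, Matrix.transpose_mul, hΓ, hΓ',
        neg_mul_neg, Matrix.transpose_one]
    have h := congrArg Matrix.transpose hC1
    clear_value C
    rw [Matrix.transpose_mul, Matrix.transpose_mul, Matrix.transpose_add, Matrix.transpose_add,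
      Matrix.transpose_add, Matrix.transpose_smul, Matrix.transpose_smul, Matrix.transpose_smul,
      hΓ, hΓ', hFt, Matrix.transpose_one, smul_neg, smul_neg, ← sub_eq_add_neg, ← sub_eq_add_neg,
      ← mul_assoc, ← hC2, sub_eq_add_neg, add_right_inj, ← smul_neg] at h
    exact smul_right_injective _ Complex.I_ne_zero h
  · rw [← mul_assoc, hX.1, mul_assoc, hY.1, mul_assoc]
  · rw [hC1, hC2]
    -- The left factors are chosen so that the image side of `Y` and the source side of `X`
    -- coincide, by the first composition identity.
    have hY' := hY.2.mul_left ((1 + Complex.I • Γ) * F)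
    have hX' := hX.2.mul_left ((1 - Complex.I • Γ') * E)
    rw [← hmid] at hX'
    exact hX'.comp hY'

end GaussianRelation
-- Functional calculus through characteristic polynomials, and the trace norm.
section MatrixFunctions

variable {κ : Type*} [Fintype κ] [DecidableEq κ]

lemma continuousOn_spectrum (A : Matrix κ κ ℂ) (f : ℝ → ℝ) : ContinuousOn f (spectrum ℝ A) :=
  A.finite_real_spectrum.continuousOn f

lemma continuousOn_image_spectrum (A : Matrix κ κ ℂ) (f g : ℝ → ℝ) :
    ContinuousOn f (g '' spectrum ℝ A) :=
  (A.finite_real_spectrum.image g).continuousOn f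

lemma isHermitian_cfc (A : Matrix κ κ ℂ) (f : ℝ → ℝ) : (cfc f A).IsHermitian :=
  cfc_predicate f A

/-- Written through the roots, the trace depends only on the characteristic polynomial, so matrices
such as `M * N` and `N * M` can be compared without an eigenbasis. -/
theorem trace_cfc {A : Matrix κ κ ℂ} (hA : A.IsHermitian) (f : ℝ → ℝ) :
    (cfc f A).trace = (A.charpoly.roots.map fun z => (f z.re : ℂ)).sum := by
  have h1 : (cfc f A).charpoly.roots = Finset.univ.val.map fun i => (f (hA.eigenvalues i) : ℂ) := by
    rw [hA.charpoly_cfc_eq f, Polynomial.roots_prod]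
    · simp [Multiset.bind_singleton]
    · simp [Finset.prod_ne_zero_iff, Polynomial.X_sub_C_ne_zero]
  rw [Matrix.trace_eq_sum_roots_charpoly_of_splits (isHermitian_cfc A f).splits_charpoly, h1,
    hA.roots_charpoly_eq_eigenvalues, Multiset.map_map]
  simp

theorem det_cfc {A : Matrix κ κ ℂ} (hA : A.IsHermitian) (f : ℝ → ℝ) :
    (cfc f A).det = (A.charpoly.roots.map fun z => (f z.re : ℂ)).prod := by
  have h1 : (cfc f A).charpoly.roots = Finset.univ.val.map fun i => (f (hA.eigenvalues i) : ℂ) := by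
    rw [hA.charpoly_cfc_eq f, Polynomial.roots_prod]
    · simp [Multiset.bind_singleton]
    · simp [Finset.prod_ne_zero_iff, Polynomial.X_sub_C_ne_zero]
  rw [Matrix.det_eq_prod_roots_charpoly_of_splits (isHermitian_cfc A f).splits_charpoly, h1,
    hA.roots_charpoly_eq_eigenvalues, Multiset.map_map]
  simp

lemma trace_cfc_eigenvalues {A : Matrix κ κ ℂ} (hA : A.IsHermitian) (f : ℝ → ℝ) :
    (cfc f A).trace = ((∑ i, f (hA.eigenvalues i) : ℝ) : ℂ) := by
  rw [trace_cfc hA, hA.roots_charpoly_eq_eigenvalues, Multiset.map_map]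
  simp

lemma matPow_trace_mul_comm {M N : Matrix κ κ ℂ} (h : (M * N).IsHermitian)
    (h' : (N * M).IsHermitian) (α : ℝ) : (matPow (M * N) α).trace = (matPow (N * M) α).trace := by
  rw [matPow, matPow, trace_cfc h, trace_cfc h', Matrix.charpoly_mul_comm]

lemma cfc_comp_matrix {A : Matrix κ κ ℂ} (hA : A.IsHermitian) (g f : ℝ → ℝ) :
    cfc g (cfc f A) = cfc (fun x => g (f x)) A :=
  (cfc_comp' g f A (continuousOn_image_spectrum A g f) (continuousOn_spectrum A f) hA.isSelfAdjoint).symm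

/-- A unitary matrix pairs with `M` to at most the trace norm of `M`. -/
theorem re_trace_mul_le_traceNorm {K M : Matrix κ κ ℂ} (hK : K * Kᴴ = 1) :
    (K * M).trace.re ≤ traceNorm M := by
  have hA : (Mᴴ * M).IsHermitian := Matrix.isHermitian_conjTranspose_mul_self M
  set U : Matrix κ κ ℂ := (hA.eigenvectorUnitary : Matrix κ κ ℂ) with hU
  have hU1 : Uᴴ * U = 1 := by
    have := Matrix.UnitaryGroup.star_mul_self hA.eigenvectorUnitary
    simpa [Matrix.star_eq_conjTranspose] using this
  have hU2 : U * Uᴴ = 1 := mul_eq_one_comm.1 hU1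
  have hdiag : Uᴴ * (Mᴴ * M) * U = Matrix.diagonal fun i => (hA.eigenvalues i : ℂ) := by
    have := hA.conjStarAlgAut_star_eigenvectorUnitary
    rw [Unitary.conjStarAlgAut_star_apply] at this
    simpa [Matrix.star_eq_conjTranspose, Function.comp_def] using this
  have h1 : (K * M).trace = ((Uᴴ * K) * (M * U)).trace := by
    rw [Matrix.trace_mul_comm (Uᴴ * K), mul_assoc, ← mul_assoc U, hU2, one_mul,
      Matrix.trace_mul_comm]
  -- In an eigenbasis `U` of `Mᴴ * M` the rows of `Uᴴ * K` are unit vectors and column `i` of `M *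
  -- U` has the `i`-th eigenvalue as squared norm. Cauchy-Schwarz on each diagonal entry then gives
  -- the sum of the square roots.
  have h2 : ∀ i, ∑ j, ‖(Uᴴ * K) i j‖ ^ 2 = 1 := by
    intro i
    have h3 : (Uᴴ * K) * (Uᴴ * K)ᴴ = 1 := by
      rw [Matrix.conjTranspose_mul, Matrix.conjTranspose_conjTranspose, mul_assoc, ← mul_assoc K, hK,
        one_mul, hU1]
    have h4 := congrFun (congrFun h3 i) i
    rw [Matrix.mul_apply, Matrix.one_apply_eq] at h4
    have h5 := congrArg Complex.re h4
    rw [Complex.re_sum] at h5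
    rw [← Complex.one_re, ← h5]
    refine Finset.sum_congr rfl fun j _ => ?_
    rw [Matrix.conjTranspose_apply, Complex.star_def, Complex.mul_conj, Complex.ofReal_re,
      Complex.normSq_eq_norm_sq]
  have h3 : ∀ i, ∑ j, ‖(M * U) j i‖ ^ 2 = hA.eigenvalues i := by
    intro i
    have h4 := congrFun (congrFun hdiag i) i
    rw [← mul_assoc, ← Matrix.conjTranspose_mul, mul_assoc, Matrix.mul_apply,
      Matrix.diagonal_apply_eq] at h4
    have h5 := congrArg Complex.re h4
    rw [Complex.re_sum, Complex.ofReal_re] at h5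
    rw [← h5]
    refine Finset.sum_congr rfl fun j _ => ?_
    rw [Matrix.conjTranspose_apply, Complex.star_def, mul_comm, Complex.mul_conj, Complex.ofReal_re,
      Complex.normSq_eq_norm_sq]
  rw [traceNorm, matPow, trace_cfc_eigenvalues hA, Complex.ofReal_re, h1, Matrix.trace,
    Complex.re_sum]
  refine Finset.sum_le_sum fun i _ => ?_
  rw [Matrix.diag_apply, Matrix.mul_apply]
  calc (∑ j, (Uᴴ * K) i j * (M * U) j i).re ≤ ‖∑ j, (Uᴴ * K) i j * (M * U) j i‖ :=
        Complex.re_le_norm _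
    _ ≤ ∑ j, ‖(Uᴴ * K) i j‖ * ‖(M * U) j i‖ := by
        refine (norm_sum_le _ _).trans (le_of_eq ?_)
        simp
    _ ≤ √(∑ j, ‖(Uᴴ * K) i j‖ ^ 2) * √(∑ j, ‖(M * U) j i‖ ^ 2) :=
        Real.sum_mul_le_sqrt_mul_sqrt _ _ _
    _ = hA.eigenvalues i ^ (1 / 2 : ℝ) := by
        rw [h2, h3, Real.sqrt_one, one_mul, Real.sqrt_eq_rpow]

lemma matPow_sq_half {H : Matrix κ κ ℂ} (hH : H.IsHermitian) :
    matPow (H * H) (1 / 2) = cfc (fun x : ℝ => |x|) H := by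
  have h1 : H * H = cfc (fun x : ℝ => x * x) H := by
    rw [cfc_mul _ _ _ (continuousOn_spectrum H _) (continuousOn_spectrum H _), cfc_id' ℝ H hH.isSelfAdjoint]
  rw [matPow, h1, cfc_comp_matrix hH]
  congr 1; ext x
  rw [← Real.sqrt_eq_rpow, Real.sqrt_mul_self_eq_abs]

/-- The trace norm of a Hermitian matrix is attained on a unitary matrix. -/
theorem exists_unitary_trace_eq_traceNorm {H : Matrix κ κ ℂ} (hH : H.IsHermitian) :
    ∃ K : Matrix κ κ ℂ, K * K = 1 ∧ Kᴴ = K ∧ (K * H).trace = (traceNorm H : ℂ) := by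
  -- The value at zero is `1` rather than `0`, so that the resulting matrix squares to the identity
  -- even when `H` is singular.
  set s : ℝ → ℝ := fun x => if x < 0 then -1 else 1 with hs
  refine ⟨cfc s H, ?_, isHermitian_cfc H s, ?_⟩
  · rw [← cfc_mul _ _ _ (continuousOn_spectrum H _) (continuousOn_spectrum H _)]
    have : (fun x => s x * s x) = fun _ => (1 : ℝ) := by
      ext x; simp only [hs]; split_ifs <;> norm_num
    rw [this, cfc_const_one ℝ H hH.isSelfAdjoint]
  · have h1 : cfc s H * H = cfc (fun x : ℝ => |x|) H := by
      have h2 : cfc s H * H = cfc s H * cfc (fun x : ℝ => x) H := by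
        rw [cfc_id' ℝ H hH.isSelfAdjoint]
      rw [h2, ← cfc_mul _ _ _ (continuousOn_spectrum H _) (continuousOn_spectrum H _)]
      congr 1; ext x; simp only [hs]
      split_ifs with h
      · rw [abs_of_neg h]; ring
      · rw [abs_of_nonneg (not_lt.1 h), one_mul]
    rw [h1, traceNorm, hH.eq, matPow_sq_half hH, trace_cfc_eigenvalues hH, Complex.ofReal_re]

lemma traceNorm_eq_half_power {H : Matrix κ κ ℂ} (hH : H.IsHermitian) :
    traceNorm H = (matPow (H * H) (1 / 2)).trace.re := by
  rw [traceNorm, hH.eq]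

lemma matPow_smul {A : Matrix κ κ ℂ} (hA : A.PosSemidef) {c : ℝ} (hc : 0 ≤ c) (α : ℝ) :
    matPow ((c : ℂ) • A) α = ((c ^ α : ℝ) : ℂ) • matPow A α := by
  have h1 : (c : ℂ) • A = cfc (fun x : ℝ => c * x) A := by
    rw [cfc_const_mul _ _ _ (continuousOn_spectrum A _), cfc_id' ℝ A hA.1.isSelfAdjoint]
    ext i j; simp
  have h2 : ((c ^ α : ℝ) : ℂ) • matPow A α = cfc (fun x : ℝ => c ^ α * x ^ α) A := by
    rw [cfc_const_mul _ _ _ (continuousOn_spectrum A _), matPow]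
    ext i j; simp
  rw [h2, matPow, h1, cfc_comp_matrix hA.1]
  refine cfc_congr fun x hx => ?_
  obtain ⟨i, rfl⟩ : x ∈ Set.range hA.1.eigenvalues := by
    rw [← hA.1.spectrum_real_eq_range_eigenvalues]; exact hx
  exact Real.mul_rpow hc (hA.eigenvalues_nonneg i)

lemma matPow_two {A : Matrix κ κ ℂ} (hA : A.IsHermitian) : matPow A 2 = A * A := by
  have h1 : A * A = cfc (fun x : ℝ => x * x) A := by
    rw [cfc_mul _ _ _ (continuousOn_spectrum A _) (continuousOn_spectrum A _), cfc_id' ℝ A hA.isSelfAdjoint]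
  rw [matPow, h1]
  congr 1; ext x
  rw [show (2 : ℝ) = ((2 : ℕ) : ℝ) by norm_num, Real.rpow_natCast, sq]

/-- The one-mode function `((1 + x) / 2) ^ α + ((1 - x) / 2) ^ α`. -/
def modeFun (α x : ℝ) : ℝ := ((1 + x) / 2) ^ α + ((1 - x) / 2) ^ α

lemma matPow_add_matPow {H : Matrix κ κ ℂ} (hH : H.IsHermitian) (α : ℝ) :
    matPow ((1 / 2 : ℂ) • (1 + H)) α + matPow ((1 / 2 : ℂ) • (1 - H)) α = cfc (modeFun α) H := by
  have h1 : (1 / 2 : ℂ) • (1 + H) = cfc (fun x : ℝ => (1 + x) / 2) H := by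
    have : (fun x : ℝ => (1 + x) / 2) = fun x => (1 / 2 : ℝ) + 1 / 2 * x := by ext; ring
    rw [this, cfc_const_add _ _ _ (continuousOn_spectrum H _) hH.isSelfAdjoint,
      cfc_const_mul _ _ _ (continuousOn_spectrum H _), cfc_id' ℝ H hH.isSelfAdjoint, smul_add]
    congr 1
    · rw [Algebra.algebraMap_eq_smul_one]; ext i j; simp
    · ext i j; simp
  have h2 : (1 / 2 : ℂ) • (1 - H) = cfc (fun x : ℝ => (1 - x) / 2) H := by
    have : (fun x : ℝ => (1 - x) / 2) = fun x => (1 / 2 : ℝ) + (-(1 / 2)) * x := by ext; ring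
    rw [this, cfc_const_add _ _ _ (continuousOn_spectrum H _) hH.isSelfAdjoint,
      cfc_const_mul _ _ _ (continuousOn_spectrum H _), cfc_id' ℝ H hH.isSelfAdjoint, smul_sub, sub_eq_add_neg]
    congr 1
    · rw [Algebra.algebraMap_eq_smul_one]; ext i j; simp
    · ext i j; simp
  rw [matPow, matPow, h1, h2, cfc_comp_matrix hH, cfc_comp_matrix hH,
    ← cfc_add _ _ _ (continuousOn_spectrum H _) (continuousOn_spectrum H _)]
  rfl

lemma modeFun_neg (α x : ℝ) : modeFun α (-x) = modeFun α x := by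
  rw [modeFun, modeFun, ← sub_eq_add_neg, sub_neg_eq_add, add_comm]

lemma modeFun_sqrt_sq (α x : ℝ) : modeFun α √(x * x) = modeFun α x := by
  rw [Real.sqrt_mul_self_eq_abs]
  rcases abs_choice x with h | h <;> rw [h]
  exact modeFun_neg α x

/-- `modeFun α` is even, hence a function of the square of its argument. -/
lemma det_cfc_modeFun {H : Matrix κ κ ℂ} (hH : H.IsHermitian) (α : ℝ) :
    (cfc (modeFun α) H).det =
      ((H * H).charpoly.roots.map fun z => (modeFun α √z.re : ℂ)).prod := by
  have h1 : H * H = cfc (fun x : ℝ => x * x) H := by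
    rw [cfc_mul _ _ _ (continuousOn_spectrum H _) (continuousOn_spectrum H _), cfc_id' ℝ H hH.isSelfAdjoint]
  have h2 : (H * H).IsHermitian := by rw [h1]; exact isHermitian_cfc H _
  rw [← det_cfc h2 (fun x => modeFun α √x), h1, cfc_comp_matrix hH]
  simp only [modeFun_sqrt_sq]

end MatrixFunctions
-- Normal form of a real skew map.
section SkewNormalForm

open scoped InnerProductSpace

/-- The square of `T` is symmetric, and nonzero because `T² = 0` would force `‖T x‖² = 0`. A unit
eigenvector with nonzero eigenvalue and its normalized image span the plane. -/
lemma skew_exists_plane {V : Type*} [NormedAddCommGroup V] [InnerProductSpace ℝ V]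
    [FiniteDimensional ℝ V] (T : V →ₗ[ℝ] V) (hT : ∀ x y, ⟪T x, y⟫_ℝ = -⟪x, T y⟫_ℝ) (h0 : T ≠ 0) :
    ∃ (x y : V) (c : ℝ), ‖x‖ = 1 ∧ ‖y‖ = 1 ∧ ⟪x, y⟫_ℝ = 0 ∧ T x = c • y ∧ T y = -(c • x) := by
  have hS : (T * T).IsSymmetric := by
    intro x y
    rw [Module.End.mul_apply, Module.End.mul_apply, hT, hT, neg_neg]
  obtain ⟨i, hi⟩ : ∃ i, hS.eigenvalues rfl i ≠ 0 := by
    by_contra! h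
    have hTT : T * T = 0 := by
      refine (hS.eigenvectorBasis rfl).toBasis.ext fun i => ?_
      rw [OrthonormalBasis.coe_toBasis, hS.apply_eigenvectorBasis, h i]
      simp
    refine h0 (LinearMap.ext fun x => ?_)
    have h1 : ⟪T x, T x⟫_ℝ = 0 := by
      rw [hT, ← Module.End.mul_apply, hTT]; simp
    simpa using h1
  set x := hS.eigenvectorBasis rfl i with hx
  set μ := hS.eigenvalues rfl i with hμ
  have hTx : T (T x) = μ • x := by
    have := hS.apply_eigenvectorBasis rfl i
    rw [Module.End.mul_apply] at this
    exact this
  have hx1 : ‖x‖ = 1 := (hS.eigenvectorBasis rfl).orthonormal.1 i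
  have hsq : ‖T x‖ * ‖T x‖ = -μ := by
    rw [← real_inner_self_eq_norm_mul_norm, hT, hTx, real_inner_smul_right,
      real_inner_self_eq_norm_mul_norm, hx1]; ring
  have hne : ‖T x‖ ≠ 0 := fun h => by
    rw [h] at hsq; exact hi (by linarith)
  refine ⟨x, ‖T x‖⁻¹ • T x, ‖T x‖, hx1, ?_, ?_, ?_, ?_⟩
  · rw [norm_smul, norm_inv, norm_norm, inv_mul_cancel₀ hne]
  · rw [real_inner_smul_right]
    have := hT x x
    rw [real_inner_comm] at this
    have h2 : ⟪x, T x⟫_ℝ = 0 := by linarith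
    rw [h2, mul_zero]
  · rw [smul_smul, mul_inv_cancel₀ hne, one_smul]
  · rw [map_smul, hTx, smul_smul, ← neg_smul]
    congr 1
    have : μ = -(‖T x‖ * ‖T x‖) := by linarith
    rw [this]; field_simp

/-- Induction splits off one invariant plane; skewness makes its orthogonal complement invariant.
The space is quantified inside the induction because it changes. -/
theorem skew_normal_form (m : ℕ) : ∀ {V : Type*} [NormedAddCommGroup V] [InnerProductSpace ℝ V]
    [FiniteDimensional ℝ V] (T : V →ₗ[ℝ] V), Module.finrank ℝ V = 2 * m →
    (∀ x y, ⟪T x, y⟫_ℝ = -⟪x, T y⟫_ℝ) →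
    ∃ (v w : Fin m → V) (c : Fin m → ℝ), (∀ k, ‖v k‖ = 1 ∧ ‖w k‖ = 1) ∧
      (∀ k l, ⟪v k, w l⟫_ℝ = 0) ∧ (∀ k l, k ≠ l → ⟪v k, v l⟫_ℝ = 0 ∧ ⟪w k, w l⟫_ℝ = 0) ∧
      ∀ k, T (v k) = c k • w k ∧ T (w k) = -(c k • v k) := by
  induction m with
  | zero =>
    intro V _ _ _ T _ _
    exact ⟨Fin.elim0, Fin.elim0, Fin.elim0, fun k => k.elim0, fun k => k.elim0, fun k => k.elim0,
      fun k => k.elim0⟩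
  | succ m ih =>
    intro V _ _ _ T hV hT
    obtain ⟨x, y, c, hx, hy, hxy, hTx, hTy⟩ : ∃ (x y : V) (c : ℝ), ‖x‖ = 1 ∧ ‖y‖ = 1 ∧
        ⟪x, y⟫_ℝ = 0 ∧ T x = c • y ∧ T y = -(c • x) := by
      by_cases h0 : T = 0
      -- The zero map preserves every plane, so two vectors of any orthonormal basis do, with `c =
      -- 0`.
      · have b := stdOrthonormalBasis ℝ V
        have h1 : 1 < Module.finrank ℝ V := by omega
        have h2 : 0 < Module.finrank ℝ V := by omega
        refine ⟨b ⟨0, h2⟩, b ⟨1, h1⟩, 0, b.orthonormal.1 _, b.orthonormal.1 _,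
          b.orthonormal.2 (by simp), by simp [h0], by simp [h0]⟩
      · exact skew_exists_plane T hT h0
    set P : Submodule ℝ V := Submodule.span ℝ (Set.range ![x, y]) with hP
    have hmem : ∀ z, z ∈ Pᗮ ↔ ⟪x, z⟫_ℝ = 0 ∧ ⟪y, z⟫_ℝ = 0 := by
      intro z
      rw [Submodule.mem_orthogonal]
      constructor
      · intro h
        exact ⟨h x (Submodule.subset_span ⟨0, rfl⟩), h y (Submodule.subset_span ⟨1, rfl⟩)⟩
      · rintro ⟨h1, h2⟩ u hu
        induction hu using Submodule.span_induction with
        | mem u hu =>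
          obtain ⟨i, rfl⟩ := hu
          fin_cases i
          · exact h1
          · exact h2
        | zero => simp
        | add a b _ _ ha hb => rw [inner_add_left, ha, hb, add_zero]
        | smul a b _ hb => rw [real_inner_smul_left, hb, mul_zero]
    have hon : Orthonormal ℝ ![x, y] := by
      rw [orthonormal_iff_ite]
      have hyx : ⟪y, x⟫_ℝ = 0 := by rw [real_inner_comm]; exact hxy
      intro i j
      fin_cases i <;> fin_cases j <;> simp [hx, hy, hxy, hyx]
    have hdimP : Module.finrank ℝ P = 2 := by
      rw [hP, finrank_span_eq_card hon.linearIndependent, Fintype.card_fin]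
    have hdim : Module.finrank ℝ Pᗮ = 2 * m := by
      have := Submodule.finrank_add_finrank_orthogonal P
      omega
    have hinv : ∀ z ∈ Pᗮ, T z ∈ Pᗮ := by
      intro z hz
      rw [hmem] at hz ⊢
      constructor
      · have := hT x z
        rw [hTx, real_inner_smul_left, hz.2] at this; linarith
      · have := hT y z
        rw [hTy, inner_neg_left, real_inner_smul_left, hz.1] at this; linarith
    obtain ⟨v, w, d, h1, h2, h3, h4⟩ := ih (T.restrict hinv) hdim (fun a b => by
      rw [Submodule.coe_inner, Submodule.coe_inner]
      exact hT a b)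
    have hv : ∀ k, ⟪x, (v k : V)⟫_ℝ = 0 ∧ ⟪y, (v k : V)⟫_ℝ = 0 := fun k => (hmem _).1 (v k).2
    have hw : ∀ k, ⟪x, (w k : V)⟫_ℝ = 0 ∧ ⟪y, (w k : V)⟫_ℝ = 0 := fun k => (hmem _).1 (w k).2
    refine ⟨Fin.cons x fun k => v k, Fin.cons y fun k => w k, Fin.cons c d, ?_, ?_, ?_, ?_⟩
    · intro k
      refine Fin.cases ⟨hx, hy⟩ (fun k => ?_) k
      exact h1 k
    · intro k l
      refine Fin.cases ?_ (fun k => ?_) k <;> refine Fin.cases ?_ (fun l => ?_) l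
      · exact hxy
      · exact (hw l).1
      · rw [real_inner_comm]; exact (hv k).2
      · exact h2 k l
    · intro k l
      refine Fin.cases ?_ (fun k => ?_) k <;> refine Fin.cases ?_ (fun l => ?_) l
      · intro h; exact absurd rfl h
      · intro _; exact ⟨(hv l).1, (hw l).2⟩
      · intro _
        exact ⟨(real_inner_comm _ _).trans (hv k).1, (real_inner_comm _ _).trans (hw k).2⟩
      · intro h; exact h3 k l (fun h' => h (by rw [h']))
    · intro k
      refine Fin.cases ⟨hTx, hTy⟩ (fun k => ?_) k
      exact ⟨congrArg Subtype.val (h4 k).1, congrArg Subtype.val (h4 k).2⟩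

end SkewNormalForm

/-! ### Unitary implementation of orthogonal maps. -/

section OrthogonalImplementation

open scoped InnerProductSpace

variable {ι : Type*} [Fintype ι] [LinearOrder ι]

lemma field_anticomm (u v : MajoranaIndex ι → ℂ) :
    field u * field v + field v * field u = (2 * (u ⬝ᵥ v)) • (1 : FockOp ι) := by
  have h1 : field v * field u = ∑ a, ∑ b, (u a * v b) • (majorana b * majorana a) := by
    rw [field_apply, field_apply, Finset.sum_mul_sum, Finset.sum_comm]
    refine Finset.sum_congr rfl fun a _ => Finset.sum_congr rfl fun b _ => ?_
    rw [smul_mul_smul_comm, mul_comm]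
  rw [h1, field_apply, field_apply, Finset.sum_mul_sum, ← Finset.sum_add_distrib]
  simp_rw [smul_mul_smul_comm, ← Finset.sum_add_distrib, ← smul_add, majorana_anticomm]
  rw [dotProduct, Finset.mul_sum, Finset.sum_smul]
  refine Finset.sum_congr rfl fun a _ => ?_
  rw [Finset.sum_eq_single a]
  · rw [if_pos rfl, ← one_add_one_eq_two (R := FockOp ι), ← two_smul ℂ (1 : FockOp ι), smul_smul,
      mul_comm 2]
  · intro b _ hb; rw [if_neg (Ne.symm hb), smul_zero]
  · simp

/-- The Majorana field of a real vector. -/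
def realField (u : EuclideanSpace ℝ (MajoranaIndex ι)) : FockOp ι := field fun a => (u a : ℂ)

lemma realField_add (u v : EuclideanSpace ℝ (MajoranaIndex ι)) :
    realField (u + v) = realField u + realField v := by
  rw [realField, realField, realField, ← map_add]
  congr 1; ext a; simp

lemma realField_smul (c : ℝ) (u : EuclideanSpace ℝ (MajoranaIndex ι)) :
    realField (c • u) = (c : ℂ) • realField u := by
  rw [realField, realField, ← map_smul]
  congr 1; ext a; simp

lemma realField_anticomm (u v : EuclideanSpace ℝ (MajoranaIndex ι)) :
    realField u * realField v + realField v * realField u =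
      ((2 * ⟪u, v⟫_ℝ : ℝ) : ℂ) • (1 : FockOp ι) := by
  rw [realField, realField, field_anticomm]
  congr 1
  rw [PiLp.inner_apply, dotProduct]
  push_cast
  congr 1
  refine Finset.sum_congr rfl fun a _ => ?_
  simp [mul_comm]

lemma realField_mul_self {u : EuclideanSpace ℝ (MajoranaIndex ι)} (hu : ‖u‖ = 1) :
    realField u * realField u = 1 := by
  have h := realField_anticomm u u
  rw [real_inner_self_eq_norm_mul_norm, hu, ← two_smul ℂ (realField u * realField u)] at h
  have h2 := congrArg (fun Z => (1 / 2 : ℂ) • Z) h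
  simp only [smul_smul] at h2
  norm_num at h2
  exact h2

lemma conjTranspose_realField (u : EuclideanSpace ℝ (MajoranaIndex ι)) :
    (realField u)ᴴ = realField u := by
  rw [realField, field_apply, Matrix.conjTranspose_sum]
  refine Finset.sum_congr rfl fun a _ => ?_
  rw [Matrix.conjTranspose_smul, conjTranspose_majorana]
  simp

lemma parity_mul_realField (u : EuclideanSpace ℝ (MajoranaIndex ι)) :
    parity * realField u = -(realField u * parity) := by
  rw [realField, field_apply, Finset.mul_sum, Finset.sum_mul, ← Finset.sum_neg_distrib]
  refine Finset.sum_congr rfl fun a _ => ?_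
  rw [Matrix.mul_smul, parity_mul_majorana, Matrix.smul_mul, smul_neg]

/-- `U` is a unitary of definite parity that implements the orthogonal map `φ`. -/
def Implements (U : FockOp ι) (φ : EuclideanSpace ℝ (MajoranaIndex ι) ≃ₗᵢ[ℝ]
    EuclideanSpace ℝ (MajoranaIndex ι)) : Prop :=
  Uᴴ * U = 1 ∧ (parity * U = U * parity ∨ parity * U = -(U * parity)) ∧
    ∀ u, U * realField u = realField (φ u) * U

/-- Conjugation by the field of a unit vector is minus the reflection. The parity, which
anticommutes with all fields, supplies the missing sign. -/
lemma implements_reflection (v : EuclideanSpace ℝ (MajoranaIndex ι)) :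
    ∃ U : FockOp ι, Implements U (Submodule.reflection (ℝ ∙ v)ᗮ) := by
  by_cases hv : v = 0
  · refine ⟨1, by simp, Or.inl (by simp), fun u => ?_⟩
    have : Submodule.reflection (ℝ ∙ v)ᗮ u = u := by
      rw [Submodule.reflection_eq_self_iff, hv]; simp
    rw [this, one_mul, mul_one]
  · have hv' : ‖v‖ ≠ 0 := norm_ne_zero_iff.2 hv
    set w := ‖v‖⁻¹ • v with hw
    have hw1 : ‖w‖ = 1 := by rw [hw, norm_smul, norm_inv, norm_norm, inv_mul_cancel₀ hv']
    have hsq := realField_mul_self hw1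
    clear_value w
    refine ⟨parity * realField w, ?_, Or.inr ?_, fun u => ?_⟩
    · rw [Matrix.conjTranspose_mul, conjTranspose_realField, conjTranspose_parity, mul_assoc,
        ← mul_assoc parity, parity_mul_self, one_mul, hsq]
    · rw [mul_assoc, ← mul_neg, parity_mul_realField]
    · have hrefl : Submodule.reflection (ℝ ∙ v)ᗮ u = u + (-(2 * ⟪w, u⟫_ℝ)) • w := by
        rw [Submodule.reflection_orthogonal_apply, Submodule.reflection_singleton_apply, hw,
          real_inner_smul_left, neg_sub, sub_eq_add_neg, neg_smul, two_smul, ← add_smul, smul_smul]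
        congr 3
        simp only [RCLike.ofReal_real_eq_id, id_eq]
        field_simp
        ring
      rw [hrefl, realField_add, realField_smul, add_mul, mul_assoc]
      have h1 := realField_anticomm w u
      have h2 : realField u * (parity * realField w) = -(parity * (realField u * realField w)) := by
        rw [← mul_assoc, ← mul_assoc, parity_mul_realField]; simp
      have h3 : realField w * (parity * realField w) = -parity := by
        have : realField w * parity = -(parity * realField w) := by
          rw [parity_mul_realField, neg_neg]
        rw [← mul_assoc, this, neg_mul, mul_assoc, hsq, mul_one]
      rw [h2, Matrix.smul_mul, h3, eq_sub_of_add_eq h1, mul_sub, Matrix.mul_smul, mul_one]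
      simp only [Complex.ofReal_neg, neg_smul, smul_neg, neg_neg]
      abel

/-- By Cartan-Dieudonné, reflections generate the orthogonal group, and implementations multiply. -/
theorem exists_implements (φ : EuclideanSpace ℝ (MajoranaIndex ι) ≃ₗᵢ[ℝ]
    EuclideanSpace ℝ (MajoranaIndex ι)) : ∃ U : FockOp ι, Implements U φ := by
  obtain ⟨l, hl, rfl⟩ := φ.reflections_generate_dim
  clear hl
  induction l with
  | nil => exact ⟨1, by simp, Or.inl (by simp), fun u => by simp⟩
  | cons v l ih =>
    obtain ⟨U, hU1, hU2, hU3⟩ := ih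
    obtain ⟨W, hW1, hW2, hW3⟩ := implements_reflection v
    refine ⟨W * U, ?_, ?_, fun u => ?_⟩
    · rw [Matrix.conjTranspose_mul, mul_assoc, ← mul_assoc Wᴴ, hW1, one_mul, hU1]
    · rw [← mul_assoc]
      rcases hU2 with h | h <;> rcases hW2 with h' | h'
      · left; rw [h', mul_assoc, h, mul_assoc]
      · right; rw [h', neg_mul, mul_assoc, h, mul_assoc]
      · right; rw [h', mul_assoc, h, mul_neg, mul_assoc]
      · left; rw [h', neg_mul, mul_assoc, h, mul_neg, neg_neg, mul_assoc]
    · rw [mul_assoc, hU3, ← mul_assoc, hW3, mul_assoc, List.map_cons, List.prod_cons]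
      rfl

end OrthogonalImplementation
-- Gaussian operators with real covariance matrix as products of independent modes.
section NormalForm

open scoped InnerProductSpace

variable {ι : Type*} [Fintype ι] [LinearOrder ι]

lemma sum_prod_ite {R : Type*} [CommSemiring R] (f g : ι → R) :
    ∑ K : Finset ι, ∏ k, (if k ∈ K then f k else g k) = ∏ k, (f k + g k) := by
  rw [Finset.prod_add, Finset.powerset_univ]
  refine Finset.sum_congr rfl fun K _ => ?_
  rw [Finset.prod_ite]
  congr 1
  · exact Finset.prod_congr (by ext; simp) fun _ _ => rfl
  · exact Finset.prod_congr (by ext; simp) fun _ _ => rfl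

/-- The eigenvalues of the Gaussian state with mode expectations `c`. -/
def modeWeight (c : ι → ℝ) (K : Finset ι) : ℝ :=
  ∏ k, if k ∈ K then (1 + c k) / 2 else (1 - c k) / 2

lemma sum_modeWeight (c : ι → ℝ) : ∑ K, modeWeight c K = 1 := by
  simp only [modeWeight]
  rw [sum_prod_ite]
  exact Finset.prod_eq_one fun k _ => by ring

lemma sum_modeWeight_rpow {c : ι → ℝ} (hc : ∀ k, |c k| ≤ 1) (α : ℝ) :
    ∑ K, modeWeight c K ^ α = ∏ k, modeFun α (c k) := by
  have h : ∀ K, modeWeight c K ^ α =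
      ∏ k, if k ∈ K then ((1 + c k) / 2) ^ α else ((1 - c k) / 2) ^ α := by
    intro K
    rw [modeWeight, ← Real.finsetProd_rpow]
    · refine Finset.prod_congr rfl fun k _ => ?_
      split_ifs <;> rfl
    · intro k _
      have := abs_le.1 (hc k)
      split_ifs <;> linarith
  simp only [h]
  rw [sum_prod_ite]
  rfl

lemma modeWeight_nonneg {c : ι → ℝ} (hc : ∀ k, |c k| ≤ 1) (K : Finset ι) :
    0 ≤ modeWeight c K :=
  Finset.prod_nonneg fun k _ => by
    have := abs_le.1 (hc k)
    split_ifs <;> linarith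

/-- The weights differ only in the factor of mode `k`, and the two possible factors have sum `1` and
difference `± c k`. This is the Gaussian relation for one mode. -/
lemma modeWeight_symmDiff (c : ι → ℝ) (T : Finset ι) (k : ι) :
    modeWeight c (symmDiff T {k}) - modeWeight c T =
      c k * (if k ∈ T then -1 else 1) * (modeWeight c (symmDiff T {k}) + modeWeight c T) := by
  have h1 : ∀ S : Finset ι, modeWeight c S = (if k ∈ S then (1 + c k) / 2 else (1 - c k) / 2) *
      ∏ l ∈ Finset.univ.erase k, if l ∈ S then (1 + c l) / 2 else (1 - c l) / 2 := fun S =>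
    (Finset.mul_prod_erase Finset.univ _ (Finset.mem_univ k)).symm
  have h2 : ∏ l ∈ Finset.univ.erase k,
      (if l ∈ symmDiff T {k} then (1 + c l) / 2 else (1 - c l) / 2) =
      ∏ l ∈ Finset.univ.erase k, if l ∈ T then (1 + c l) / 2 else (1 - c l) / 2 := by
    refine Finset.prod_congr rfl fun l hl => ?_
    have : l ≠ k := (Finset.mem_erase.1 hl).1
    simp [Finset.mem_symmDiff, this]
  have h3 : k ∈ symmDiff T {k} ↔ k ∉ T := by simp [Finset.mem_symmDiff]
  rw [h1 (symmDiff T {k}), h1 T, h2]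
  simp only [h3]
  split_ifs <;> first | contradiction | ring

/-- The covariance matrix in normal form. -/
def blockMatrix (c : ι → ℝ) : Matrix (MajoranaIndex ι) (MajoranaIndex ι) ℂ :=
  Matrix.of fun a b => if (ofLex a).1 = (ofLex b).1 then
    (if (ofLex a).2 = (ofLex b).2 then 0 else if (ofLex a).2 = 0 then (c (ofLex a).1 : ℂ)
      else -(c (ofLex a).1 : ℂ)) else 0

lemma transpose_blockMatrix (c : ι → ℝ) : (blockMatrix c)ᵀ = -blockMatrix c := by
  ext a b
  simp only [blockMatrix, Matrix.transpose_apply, Matrix.of_apply, Matrix.neg_apply]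
  by_cases h : (ofLex a).1 = (ofLex b).1
  · simp only [h, if_true]
    generalize (ofLex a).2 = i
    generalize (ofLex b).2 = j
    fin_cases i <;> fin_cases j <;> simp
  · simp [h, Ne.symm h]

/-- The label of the other Majorana operator of the same mode. -/
def partner (a : MajoranaIndex ι) : MajoranaIndex ι := toLex ((ofLex a).1, 1 - (ofLex a).2)

/-- The only nonzero entry of a row of the normal form. -/
def blockEntry (c : ι → ℝ) (a : MajoranaIndex ι) : ℝ :=
  if (ofLex a).2 = 0 then c (ofLex a).1 else -c (ofLex a).1

lemma blockMatrix_apply (c : ι → ℝ) (a b : MajoranaIndex ι) :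
    blockMatrix c a b = if b = partner a then (blockEntry c a : ℂ) else 0 := by
  have hb : b = partner a ↔ (ofLex a).1 = (ofLex b).1 ∧ (ofLex b).2 = 1 - (ofLex a).2 := by
    constructor
    · rintro rfl; exact ⟨rfl, rfl⟩
    · rintro ⟨h1, h2⟩; exact majoranaIndex_ext h1.symm h2
  have h2 : ∀ i j : Fin 2, j = 1 - i ↔ i ≠ j := by decide
  simp only [hb, h2, blockMatrix, blockEntry, Matrix.of_apply]
  split_ifs <;> simp_all

lemma blockMatrix_mul_self (c : ι → ℝ) :
    blockMatrix c * blockMatrix c = Matrix.diagonal fun a => -((c (ofLex a).1 : ℂ) ^ 2) := by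
  have h0 : ∀ i : Fin 2, 1 - (1 - i) = i := by decide
  have h1 : ∀ a : MajoranaIndex ι, partner (partner a) = a := fun a =>
    majoranaIndex_ext rfl (h0 _)
  ext a b
  rw [Matrix.mul_apply]
  simp only [blockMatrix_apply, ite_mul, zero_mul, Finset.sum_ite_eq',
    Finset.mem_univ, if_true, h1, Matrix.diagonal_apply, @eq_comm _ b a]
  split_ifs with h
  · have h2 : ∀ i : Fin 2, (1 - i = 0 ↔ i ≠ 0) := by decide
    simp only [blockEntry, partner, ofLex_toLex, h2]
    by_cases h3 : (ofLex a).2 = 0 <;> simp [h3] <;> ring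
  · simp

lemma gaussianRelation_diagonal (c : ι → ℝ) :
    GaussianRelation (Matrix.diagonal fun K => (modeWeight c K : ℂ)) (blockMatrix c) := by
  refine gaussianRelation_iff.2 ⟨?_, fun j => ?_⟩
  · rw [parity, Matrix.diagonal_mul_diagonal, Matrix.diagonal_mul_diagonal]
    simp only [mul_comm]
  · simp only [blockMatrix_apply, ite_smul, zero_smul, Finset.sum_ite_eq', Finset.mem_univ,
      if_true]
    ext S T
    rw [Matrix.sub_apply, Matrix.diagonal_mul, Matrix.mul_diagonal, Matrix.smul_apply,
      Matrix.smul_apply, Matrix.add_apply, Matrix.diagonal_mul, Matrix.mul_diagonal,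
      majorana_apply, majorana_apply]
    have hp : (ofLex (partner j)).1 = (ofLex j).1 := rfl
    rw [hp]
    split_ifs with hS
    swap
    · simp
    subst hS
    have h := congrArg (fun x : ℝ => (x : ℂ)) (modeWeight_symmDiff c T (ofLex j).1)
    push_cast at h
    have h2 : ∀ i : Fin 2, (1 - i = 0 ↔ i ≠ 0) := by decide
    simp only [majoranaEntry, blockEntry, partner, ofLex_toLex, h2, smul_eq_mul]
    have hI := Complex.I_sq
    by_cases h3 : (ofLex j).2 = 0 <;> by_cases h4 : (ofLex j).1 ∈ T <;>
      simp only [h3, h4, if_true, if_false, not_true_eq_false, not_false_eq_true, ne_eq,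
        Complex.ofReal_neg, Complex.ofReal_one] at h ⊢
    · linear_combination jwSign (ofLex j).1 T * h - (c (ofLex j).1 *
        (modeWeight c (symmDiff T {(ofLex j).1}) + modeWeight c T) * jwSign (ofLex j).1 T) * hI
    · linear_combination jwSign (ofLex j).1 T * h + (c (ofLex j).1 *
        (modeWeight c (symmDiff T {(ofLex j).1}) + modeWeight c T) * jwSign (ofLex j).1 T) * hI
    · linear_combination -Complex.I * jwSign (ofLex j).1 T * h
    · linear_combination Complex.I * jwSign (ofLex j).1 T * h

lemma gaussianOperator_blockMatrix (c : ι → ℝ) :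
    gaussianOperator (blockMatrix c) = Matrix.diagonal fun K => (modeWeight c K : ℂ) := by
  have h := (gaussianRelation_diagonal c).eq_smul (transpose_blockMatrix c)
  rw [Matrix.trace_diagonal, ← Complex.ofReal_sum, sum_modeWeight, Complex.ofReal_one,
    one_smul] at h
  exact h.symm

lemma exists_skew_basis {G : Matrix (MajoranaIndex ι) (MajoranaIndex ι) ℝ} (hG : Gᵀ = -G) :
    ∃ (b : OrthonormalBasis (MajoranaIndex ι) ℝ (EuclideanSpace ℝ (MajoranaIndex ι)))
      (c : ι → ℝ), ∀ a, Matrix.toEuclideanLin Gᵀ (b a) = blockEntry c a • b (partner a) := by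
  -- The transpose appears because `Intertwines` lets matrices act on row vectors.
  set T := Matrix.toEuclideanLin Gᵀ with hT
  have hskew : ∀ x y, ⟪T x, y⟫_ℝ = -⟪x, T y⟫_ℝ := by
    intro x y
    have h1 : LinearMap.adjoint T = -T := by
      rw [hT, ← Matrix.toEuclideanLin_conjTranspose_eq_adjoint, ← map_neg]
      congr 1
      rw [hG, Matrix.conjTranspose_neg, Matrix.conjTranspose_eq_transpose_of_trivial, hG]
    rw [← LinearMap.adjoint_inner_right, h1, LinearMap.neg_apply, inner_neg_right]
  have hdim : Module.finrank ℝ (EuclideanSpace ℝ (MajoranaIndex ι)) = 2 * Fintype.card ι := by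
    rw [finrank_euclideanSpace, Fintype.card_lex, Fintype.card_prod, Fintype.card_fin, mul_comm]
  obtain ⟨v, w, d, h1, h2, h3, h4⟩ := skew_normal_form _ T hdim hskew
  set e := Fintype.equivFin ι
  set f : MajoranaIndex ι → EuclideanSpace ℝ (MajoranaIndex ι) := fun a =>
    if (ofLex a).2 = 0 then v (e (ofLex a).1) else w (e (ofLex a).1) with hf
  have h5 : ∀ k l, ⟪w k, v l⟫_ℝ = 0 := fun k l => (real_inner_comm _ _).trans (h2 l k)
  have h0 : ∀ i : Fin 2, i ≠ 0 → i = 1 := by decide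
  have hon : Orthonormal ℝ f := by
    refine ⟨fun a => ?_, fun a b hab => ?_⟩
    · simp only [hf]; split_ifs
      · exact (h1 _).1
      · exact (h1 _).2
    · simp only [hf]
      by_cases h6 : (ofLex a).1 = (ofLex b).1
      · have h7 : (ofLex a).2 ≠ (ofLex b).2 := fun h => hab (majoranaIndex_ext h6 h)
        split_ifs with h8 h9 h9
        · exact absurd (h8.trans h9.symm) h7
        · exact h2 _ _
        · exact h5 _ _
        · exact absurd ((h0 _ h8).trans (h0 _ h9).symm) h7
      · have h7 : e (ofLex a).1 ≠ e (ofLex b).1 := fun h => h6 (e.injective h)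
        split_ifs
        · exact (h3 _ _ h7).1
        · exact h2 _ _
        · exact h5 _ _
        · exact (h3 _ _ h7).2
  have hsp : Submodule.span ℝ (Set.range f) = ⊤ :=
    hon.linearIndependent.span_eq_top_of_card_eq_finrank' (by rw [finrank_euclideanSpace])
  refine ⟨OrthonormalBasis.mk hon hsp.ge, fun k => d (e k), fun a => ?_⟩
  rw [OrthonormalBasis.coe_mk]
  have h6 : ∀ i : Fin 2, (1 - i = 0 ↔ i ≠ 0) := by decide
  simp only [hf, partner, blockEntry, ofLex_toLex, h6]
  by_cases h7 : (ofLex a).2 = 0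
  · simp only [h7, if_true, ne_eq, not_true_eq_false, if_false]
    exact (h4 _).1
  · simp only [h7, ne_eq, not_false_eq_true, if_false, if_true]
    rw [(h4 _).2, neg_smul]

lemma realField_single (a : MajoranaIndex ι) :
    realField (EuclideanSpace.single a (1 : ℝ)) = majorana a := by
  rw [realField, field_apply, Finset.sum_eq_single a]
  · simp
  · intro b _ hb; simp [hb]
  · simp

lemma vecMul_map_ofReal (G : Matrix (MajoranaIndex ι) (MajoranaIndex ι) ℝ)
    (u : EuclideanSpace ℝ (MajoranaIndex ι)) :
    (fun a => (u a : ℂ)) ᵥ* G.map Complex.ofReal =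
      fun a => ((Matrix.toEuclideanLin Gᵀ u) a : ℂ) := by
  ext a
  rw [Matrix.toLpLin_apply]
  simp only [Matrix.vecMul, Matrix.mulVec, dotProduct, Matrix.map_apply, Matrix.transpose_apply]
  push_cast
  exact Finset.sum_congr rfl fun b _ => mul_comm _ _

/-- Normal form of Gaussian operators with a real covariance matrix. -/
theorem gaussian_normal_form {G : Matrix (MajoranaIndex ι) (MajoranaIndex ι) ℝ} (hG : Gᵀ = -G) :
    ∃ (c : ι → ℝ) (U : FockOp ι) (V : Matrix (MajoranaIndex ι) (MajoranaIndex ι) ℂ),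
      Uᴴ * U = 1 ∧ V * Vᴴ = 1 ∧ G.map Complex.ofReal = Vᴴ * blockMatrix c * V ∧
      gaussianOperator (G.map Complex.ofReal) =
        U * (Matrix.diagonal fun K => (modeWeight c K : ℂ)) * Uᴴ := by
  obtain ⟨b, c, hb⟩ := exists_skew_basis hG
  obtain ⟨U, hU1, hU2, hU3⟩ := exists_implements b.repr.symm
  set Γ := G.map Complex.ofReal with hΓdef
  have hΓ : Γᵀ = -Γ := by
    ext i j
    have := congrFun (congrFun hG i) j
    simp only [Matrix.transpose_apply, Matrix.neg_apply] at this
    simp [hΓdef, this]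
  set X := gaussianOperator Γ with hX
  have hrel := gaussianRelation_gaussianOperator hΓ
  have hUU : U * Uᴴ = 1 := mul_eq_one_comm.1 hU1
  have hfield : ∀ u, realField (b.repr.symm u) = U * realField u * Uᴴ := fun u => by
    rw [hU3, mul_assoc, hUU, mul_one]
  set V : Matrix (MajoranaIndex ι) (MajoranaIndex ι) ℂ :=
    Matrix.of fun a d => ((b a) d : ℂ) with hV
  have hVV : V * Vᴴ = 1 := by
    ext a d
    have h := b.inner_eq_ite a d
    rw [PiLp.inner_apply] at h
    rw [Matrix.mul_apply, Matrix.one_apply]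
    have h' := congrArg Complex.ofReal h
    rw [apply_ite Complex.ofReal, Complex.ofReal_one, Complex.ofReal_zero,
      Complex.ofReal_sum] at h'
    rw [← h']
    refine Finset.sum_congr rfl fun k _ => ?_
    simp [hV, mul_comm]
  have hVΓ : V * Γ = blockMatrix c * V := by
    ext a d
    have h := congrFun (vecMul_map_ofReal G (b a)) d
    rw [hb] at h
    have h1 : (V * Γ) a d = ((fun k => ((b a) k : ℂ)) ᵥ* Γ) d := rfl
    rw [h1, h, Matrix.mul_apply]
    simp [blockMatrix_apply, hV]
  refine ⟨c, U, V, hU1, hVV, ?_, ?_⟩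
  · rw [mul_assoc, ← hVΓ, ← mul_assoc, mul_eq_one_comm.1 hVV, one_mul]
  have key : ∀ u, X * (realField u + Complex.I • realField (Matrix.toEuclideanLin Gᵀ u)) =
      (realField u - Complex.I • realField (Matrix.toEuclideanLin Gᵀ u)) * X := by
    intro u
    have h := hrel.2 fun a => (u a : ℂ)
    rw [Matrix.vecMul_add, Matrix.vecMul_sub, Matrix.vecMul_one, Matrix.vecMul_smul,
      vecMul_map_ofReal, map_add, map_sub, map_smul] at h
    exact h
  -- After conjugation the relation is that of the normal form, and uniqueness identifies the
  -- operator with the diagonal one. An odd `U` is harmless: the signs from `U` and `Uᴴ` cancel.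
  have hX' : GaussianRelation (Uᴴ * X * U) (blockMatrix c) := by
    refine ⟨?_, intertwines_of_rows fun j => ?_⟩
    · have h1 : parity * Uᴴ = Uᴴ * parity ∧ parity * U = U * parity ∨
          parity * Uᴴ = -(Uᴴ * parity) ∧ parity * U = -(U * parity) := by
        rcases hU2 with h | h
        · left
          have := congrArg Matrix.conjTranspose h
          rw [Matrix.conjTranspose_mul, Matrix.conjTranspose_mul, conjTranspose_parity] at this
          exact ⟨this.symm, h⟩
        · right
          have := congrArg Matrix.conjTranspose h
          rw [Matrix.conjTranspose_mul, Matrix.conjTranspose_neg, Matrix.conjTranspose_mul,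
            conjTranspose_parity] at this
          exact ⟨by rw [this, neg_neg], h⟩
      rcases h1 with ⟨h1, h2⟩ | ⟨h1, h2⟩
      · rw [← mul_assoc, ← mul_assoc, h1, mul_assoc Uᴴ, hrel.1, mul_assoc, mul_assoc, h2]
        simp only [mul_assoc]
        rfl
      · rw [← mul_assoc, ← mul_assoc, h1, neg_mul, mul_assoc Uᴴ, hrel.1, neg_mul, mul_assoc,
          mul_assoc, h2]
        simp only [mul_assoc, mul_neg, neg_neg]
        rfl
    · rw [field_one_add, field_one_sub]
      simp only [blockMatrix_apply, ite_smul, zero_smul, Finset.sum_ite_eq', Finset.mem_univ,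
        if_true]
      have h1 : b.repr.symm (EuclideanSpace.single j (1 : ℝ)) = b j := b.repr_symm_single j
      have h2 : b.repr.symm (EuclideanSpace.single (partner j) (1 : ℝ)) = b (partner j) :=
        b.repr_symm_single _
      have h3 := key (b j)
      rw [hb, realField_smul, ← h1, ← h2, hfield, hfield, realField_single, realField_single] at h3
      have h4 : ∀ Y : FockOp ι, Uᴴ * (U * Y * Uᴴ) = Y * Uᴴ := fun Y => by
        rw [← mul_assoc, ← mul_assoc, hU1, one_mul]
      have h5 : ∀ Y : FockOp ι, U * Y * Uᴴ * U = U * Y := fun Y => by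
        rw [mul_assoc, hU1, mul_one]
      have h6 := congrArg (fun Z => Uᴴ * Z * U) h3
      simp only [mul_add, add_mul, mul_sub, sub_mul, Matrix.mul_smul, Matrix.smul_mul] at h6 ⊢
      have h7 : ∀ Y : FockOp ι, Uᴴ * (X * (U * Y * Uᴴ)) * U = Uᴴ * X * U * Y := fun Y => by
        rw [← mul_assoc X, ← mul_assoc Uᴴ, mul_assoc _ Uᴴ, hU1, mul_one]
        simp only [mul_assoc]
      have h8 : ∀ Y : FockOp ι, Uᴴ * (U * Y * Uᴴ * X) * U = Y * (Uᴴ * X * U) := fun Y => by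
        rw [mul_assoc (U * Y), ← mul_assoc Uᴴ, ← mul_assoc Uᴴ, hU1, one_mul]
        simp only [mul_assoc]
      rw [h7, h7, h8, h8] at h6
      exact h6
  have h := hX'.eq_smul (transpose_blockMatrix c)
  rw [gaussianOperator_blockMatrix, Matrix.trace_mul_comm, ← mul_assoc, hUU, one_mul, hX,
    trace_gaussianOperator, one_smul] at h
  rw [← h, ← mul_assoc, ← mul_assoc, hUU, one_mul, mul_assoc, hUU, mul_one]

end NormalForm
-- Spectra, power traces and purity of Gaussian states.
section GaussianStates

variable {ι : Type*} [Fintype ι] [LinearOrder ι]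

lemma trace_mul_majorana_mul_majorana (X : FockOp ι) (j k : MajoranaIndex ι) :
    (X * (majorana j * majorana k)).trace =
      (X.trace • (1 : Matrix (MajoranaIndex ι) (MajoranaIndex ι) ℂ) -
        Complex.I • covarianceMatrix X) j k := by
  have h1 := congrArg (fun Z => (X * Z).trace) (majorana_anticomm j k)
  have h2 : (X * (if j = k then (2 : FockOp ι) else 0)).trace = if j = k then 2 * X.trace else 0 := by
    split_ifs
    · rw [mul_two, Matrix.trace_add, two_mul]
    · simp
  simp only [h2, mul_add, Matrix.trace_add] at h1
  simp only [Matrix.sub_apply, Matrix.smul_apply, covarianceMatrix, Matrix.of_apply, smul_eq_mul,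
    mul_sub, Matrix.trace_sub, Matrix.one_apply]
  have h3 : (if j = k then 2 * X.trace else 0) = 2 * (X.trace * if j = k then 1 else 0) := by
    split_ifs <;> ring
  rw [h3] at h1
  linear_combination h1 / 2 + (((X * (majorana j * majorana k)).trace -
    (X * (majorana k * majorana j)).trace) / 2) * Complex.I_sq

lemma star_covarianceMatrix {X : FockOp ι} (hX : X.IsHermitian) (j k : MajoranaIndex ι) :
    star (covarianceMatrix X j k) = covarianceMatrix X j k := by
  simp only [covarianceMatrix, Matrix.of_apply, star_mul']
  rw [← Matrix.trace_conjTranspose, Matrix.conjTranspose_mul, Matrix.conjTranspose_sub,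
    Matrix.conjTranspose_mul, Matrix.conjTranspose_mul, conjTranspose_majorana,
    conjTranspose_majorana, hX.eq, Matrix.trace_mul_comm,
    ← neg_sub (majorana j * majorana k) (majorana k * majorana j), mul_neg, Matrix.trace_neg]
  have : star (Complex.I / 2) = -(Complex.I / 2) := by
    rw [star_div₀]; simp [neg_div]
  rw [this]; ring

lemma exists_real_covarianceMatrix {X : FockOp ι} (hX : X.IsHermitian) :
    ∃ G : Matrix (MajoranaIndex ι) (MajoranaIndex ι) ℝ, Gᵀ = -G ∧
      covarianceMatrix X = G.map Complex.ofReal := by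
  refine ⟨(covarianceMatrix X).map Complex.re, ?_, ?_⟩
  · ext j k
    have := congrArg Complex.re (congrFun (congrFun (transpose_covarianceMatrix X) j) k)
    simpa using this
  · ext j k
    rw [Matrix.map_apply, Matrix.map_apply]
    exact (Complex.conj_eq_iff_re.1 (star_covarianceMatrix hX j k)).symm

/-- The matrix collects the second moments `tr (X m_j m_k)`, so its quadratic form is the trace of
`field w * X * (field w)ᴴ`. -/
lemma posSemidef_one_sub_covarianceMatrix {X : FockOp ι} (hX : X.PosSemidef) (h1 : X.trace = 1) :
    (1 - Complex.I • covarianceMatrix X).PosSemidef := by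
  refine Matrix.PosSemidef.of_dotProduct_mulVec_nonneg ?_ fun w => ?_
  · ext j k
    have h := congrFun (congrFun (transpose_covarianceMatrix X) j) k
    simp only [Matrix.transpose_apply, Matrix.neg_apply] at h
    simp [star_covarianceMatrix hX.1, Matrix.one_apply, h, eq_comm, sub_eq_add_neg]
  · have h2 : star w ⬝ᵥ (1 - Complex.I • covarianceMatrix X) *ᵥ w =
        (field w * X * (field w)ᴴ).trace := by
      rw [Matrix.trace_mul_cycle, Matrix.trace_mul_comm, field_apply, Matrix.conjTranspose_sum,
        Finset.sum_mul_sum, Finset.mul_sum, Matrix.trace_sum, dotProduct]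
      refine Finset.sum_congr rfl fun j _ => ?_
      rw [Finset.mul_sum, Matrix.trace_sum, Matrix.mulVec, dotProduct, Finset.mul_sum]
      refine Finset.sum_congr rfl fun k _ => ?_
      rw [Matrix.conjTranspose_smul, conjTranspose_majorana, smul_mul_smul_comm, Matrix.mul_smul,
        Matrix.trace_smul, trace_mul_majorana_mul_majorana, h1, one_smul, smul_eq_mul,
        Pi.star_apply]
      ring
    rw [h2]
    exact (hX.mul_mul_conjTranspose_same _).trace_nonneg

lemma posSemidef_one_add_covarianceMatrix {X : FockOp ι} (hX : X.PosSemidef) (h1 : X.trace = 1) :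
    (1 + Complex.I • covarianceMatrix X).PosSemidef := by
  have h := (posSemidef_one_sub_covarianceMatrix hX h1).transpose
  rwa [Matrix.transpose_sub, Matrix.transpose_smul, transpose_covarianceMatrix,
    Matrix.transpose_one, smul_neg, sub_neg_eq_add] at h

lemma prod_majoranaIndex {R : Type*} [CommMonoid R] (f : ι → R) :
    ∏ a : MajoranaIndex ι, f (ofLex a).1 = (∏ k, f k) ^ 2 := by
  have h : ∏ a : MajoranaIndex ι, f (ofLex a).1 = ∏ p : ι × Fin 2, f p.1 :=
    Fintype.prod_equiv ofLex _ _ fun _ => rfl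
  rw [h, Fintype.prod_prod_type]
  simp [Finset.prod_pow]

open Polynomial in
lemma charpoly_conj_diagonal {κ : Type*} [Fintype κ] [DecidableEq κ] {U : Matrix κ κ ℂ}
    (hU : U * Uᴴ = 1) (d : κ → ℂ) :
    (U * Matrix.diagonal d * Uᴴ).charpoly.roots = Finset.univ.val.map d := by
  rw [Matrix.charpoly_mul_comm, ← mul_assoc, mul_eq_one_comm.1 hU, one_mul,
    Matrix.charpoly_diagonal, Polynomial.roots_prod]
  · simp [Multiset.bind_singleton]
  · simp [Finset.prod_ne_zero_iff, Polynomial.X_sub_C_ne_zero]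

/-- The spectral data of a Gaussian state. -/
theorem gaussian_spectrum {Γ : Matrix (MajoranaIndex ι) (MajoranaIndex ι) ℂ}
    (hΓ : ∃ G : Matrix (MajoranaIndex ι) (MajoranaIndex ι) ℝ, Gᵀ = -G ∧ Γ = G.map Complex.ofReal)
    (hp : (1 + Complex.I • Γ).PosSemidef) (hm : (1 - Complex.I • Γ).PosSemidef) :
    ∃ (c : ι → ℝ) (V : Matrix (MajoranaIndex ι) (MajoranaIndex ι) ℂ),
      (∀ k, |c k| ≤ 1) ∧ V * Vᴴ = 1 ∧
      Γ * Γ = V * (Matrix.diagonal fun a => -((c (ofLex a).1 : ℂ) ^ 2)) * Vᴴ ∧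
      (gaussianOperator Γ).PosSemidef ∧
      ∀ α : ℝ, (matPow (gaussianOperator Γ) α).trace = ((∏ k, modeFun α (c k) : ℝ) : ℂ) := by
  obtain ⟨G, hG, rfl⟩ := hΓ
  obtain ⟨c, U, V, hU, hV, hΓ, hX⟩ := gaussian_normal_form hG
  set Γ := G.map Complex.ofReal
  have hV' : Vᴴ * V = 1 := mul_eq_one_comm.1 hV
  have hU' : U * Uᴴ = 1 := mul_eq_one_comm.1 hU
  have hVΓ : V * Γ * Vᴴ = blockMatrix c := by
    rw [hΓ, ← mul_assoc, ← mul_assoc, hV, one_mul, mul_assoc, hV, mul_one]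
  have hp' : (1 + Complex.I • blockMatrix c).PosSemidef := by
    have h := hp.mul_mul_conjTranspose_same V
    rwa [mul_add, add_mul, mul_one, hV, Matrix.mul_smul, Matrix.smul_mul, hVΓ] at h
  have hm' : (1 - Complex.I • blockMatrix c).PosSemidef := by
    have h := hm.mul_mul_conjTranspose_same V
    rwa [mul_sub, sub_mul, mul_one, hV, Matrix.mul_smul, Matrix.smul_mul, hVΓ] at h
  -- The test vector `e_(k,0) + i e_(k,1)` is an eigenvector of the block of mode `k`. At `s = i`
  -- and `s = -i` the form equals `2 - 2 c k` and `2 + 2 c k`, so positivity bounds `c k`.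
  have hdet : ∀ (s : ℂ) (k : ι) (w : MajoranaIndex ι → ℂ),
      w = Pi.single (toLex (k, 0)) 1 + Pi.single (toLex (k, 1)) Complex.I →
      star w ⬝ᵥ (1 + s • blockMatrix c) *ᵥ w = 2 + 2 * Complex.I * s * c k := by
    intro s k w hw
    have h01 : (toLex (k, (0 : Fin 2)) : MajoranaIndex ι) ≠ toLex (k, 1) := by
      intro h; simp at h
    have hI := Complex.I_sq
    have hstar : star w = Pi.single (toLex (k, 0)) 1 + Pi.single (toLex (k, 1)) (-Complex.I) := by
      rw [hw, star_add, Pi.star_single, Pi.star_single]; simp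
    rw [hstar, hw, add_dotProduct, single_dotProduct, single_dotProduct, Matrix.mulVec_add,
      Matrix.mulVec_single, Matrix.mulVec_single]
    simp [blockMatrix]
    linear_combination -hI
  have hc : ∀ k, |c k| ≤ 1 := by
    intro k
    rw [abs_le]
    have h1 := hp'.dotProduct_mulVec_nonneg
      (Pi.single (toLex (k, 0)) 1 + Pi.single (toLex (k, 1)) Complex.I)
    have h2 := hm'.dotProduct_mulVec_nonneg
      (Pi.single (toLex (k, 0)) 1 + Pi.single (toLex (k, 1)) Complex.I)
    rw [hdet _ _ _ rfl] at h1
    rw [sub_eq_add_neg, ← neg_smul, hdet _ _ _ rfl] at h2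
    have h3 := (Complex.le_def.1 h1).1
    have h4 := (Complex.le_def.1 h2).1
    simp at h3 h4
    constructor <;> linarith
  have hpsd : (gaussianOperator Γ).PosSemidef := by
    rw [hX]
    refine Matrix.PosSemidef.mul_mul_conjTranspose_same (Matrix.PosSemidef.diagonal ?_) _
    intro K
    exact Complex.zero_le_real.2 (modeWeight_nonneg hc K)
  refine ⟨c, Vᴴ, hc, by rwa [Matrix.conjTranspose_conjTranspose], ?_, hpsd, fun α => ?_⟩
  · rw [hΓ, ← blockMatrix_mul_self, Matrix.conjTranspose_conjTranspose]
    calc Vᴴ * blockMatrix c * V * (Vᴴ * blockMatrix c * V)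
        = Vᴴ * blockMatrix c * (V * Vᴴ) * blockMatrix c * V := by simp only [mul_assoc]
      _ = _ := by rw [hV, mul_one]; simp only [mul_assoc]
  · rw [matPow, trace_cfc hpsd.1, hX, charpoly_conj_diagonal hU', Multiset.map_map,
      ← sum_modeWeight_rpow hc]
    push_cast
    rfl

/-- `X` is a Gaussian state with covariance matrix `Γ`, in terms of `Γ` only. -/
def IsStateCovariance (Γ : Matrix (MajoranaIndex ι) (MajoranaIndex ι) ℂ) : Prop :=
  (∃ G : Matrix (MajoranaIndex ι) (MajoranaIndex ι) ℝ, Gᵀ = -G ∧ Γ = G.map Complex.ofReal) ∧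
    (1 + Complex.I • Γ).PosSemidef ∧ (1 - Complex.I • Γ).PosSemidef

lemma IsStateCovariance.of_posSemidef {X : FockOp ι} (hX : X.PosSemidef) (h1 : X.trace = 1) :
    IsStateCovariance (covarianceMatrix X) :=
  ⟨exists_real_covarianceMatrix hX.1, posSemidef_one_add_covarianceMatrix hX h1,
    posSemidef_one_sub_covarianceMatrix hX h1⟩

lemma IsStateCovariance.transpose {Γ : Matrix (MajoranaIndex ι) (MajoranaIndex ι) ℂ}
    (h : IsStateCovariance Γ) : Γᵀ = -Γ := by
  obtain ⟨⟨G, hG, rfl⟩, _⟩ := h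
  ext i j
  have := congrFun (congrFun hG i) j
  simp only [Matrix.transpose_apply, Matrix.neg_apply] at this
  simp [this]

lemma IsStateCovariance.isHermitian {Γ : Matrix (MajoranaIndex ι) (MajoranaIndex ι) ℂ}
    (h : IsStateCovariance Γ) : (Complex.I • Γ).IsHermitian := by
  obtain ⟨⟨G, hG, rfl⟩, _⟩ := h
  ext i j
  have := congrFun (congrFun hG i) j
  simp only [Matrix.transpose_apply, Matrix.neg_apply] at this
  simp [this]

lemma modeFun_nonneg {α x : ℝ} (hx : |x| ≤ 1) : 0 ≤ modeFun α x := by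
  have := abs_le.1 hx
  exact add_nonneg (Real.rpow_nonneg (by linarith) _) (Real.rpow_nonneg (by linarith) _)

lemma modeFun_pos {α x : ℝ} (hx : |x| ≤ 1) : 0 < modeFun α x := by
  have h := abs_le.1 hx
  rcases le_total 0 x with h0 | h0
  · exact add_pos_of_pos_of_nonneg (Real.rpow_pos_of_pos (by linarith) _)
      (Real.rpow_nonneg (by linarith) _)
  · exact add_pos_of_nonneg_of_pos (Real.rpow_nonneg (by linarith) _)
      (Real.rpow_pos_of_pos (by linarith) _)

lemma modeFun_one (α : ℝ) (hα : 0 < α) : modeFun α 1 = 1 := by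
  simp [modeFun, Real.zero_rpow hα.ne']

lemma modeFun_two (x : ℝ) : modeFun 2 x = (1 + x ^ 2) / 2 := by
  have h : ∀ y : ℝ, y ^ (2 : ℝ) = y ^ 2 := fun y => by
    rw [show (2 : ℝ) = ((2 : ℕ) : ℝ) by norm_num, Real.rpow_natCast]
  rw [modeFun, h, h]; ring

/-- The square of `tr X ^ α` for a Gaussian state, as a function of a polynomial: the
characteristic polynomial of the squared covariance matrix. -/
def rootProd (α : ℝ) (p : Polynomial ℂ) : ℂ :=
  (p.roots.map fun z => (modeFun α √(-z.re) : ℂ)).prod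

/-- Every mode carries two labels, so `Γ²` has each eigenvalue `-c_k²` twice; this is why the trace
enters squared. -/
theorem trace_matPow_sq {Γ : Matrix (MajoranaIndex ι) (MajoranaIndex ι) ℂ}
    (hΓ : IsStateCovariance Γ) (α : ℝ) :
    (matPow (gaussianOperator Γ) α).trace ^ 2 = rootProd α (Γ * Γ).charpoly := by
  obtain ⟨c, V, hc, hV, hΓΓ, -, htr⟩ := gaussian_spectrum hΓ.1 hΓ.2.1 hΓ.2.2
  rw [rootProd, hΓΓ, charpoly_conj_diagonal hV, Multiset.map_map, htr]
  have h : ∀ a : MajoranaIndex ι, modeFun α √(-(-((c (ofLex a).1 : ℂ) ^ 2)).re) =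
      modeFun α (c (ofLex a).1) := by
    intro a
    rw [← modeFun_sqrt_sq α (c (ofLex a).1), ← Complex.ofReal_pow, Complex.neg_re, neg_neg,
      Complex.ofReal_re, sq]
  simp only [Function.comp_def, h]
  rw [← Complex.ofReal_pow, ← prod_majoranaIndex]
  push_cast
  rfl

theorem trace_matPow_pos {Γ : Matrix (MajoranaIndex ι) (MajoranaIndex ι) ℂ}
    (hΓ : IsStateCovariance Γ) (α : ℝ) :
    0 < (matPow (gaussianOperator Γ) α).trace.re ∧
      (matPow (gaussianOperator Γ) α).trace = ((matPow (gaussianOperator Γ) α).trace.re : ℂ) := by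
  obtain ⟨c, V, hc, hV, hΓΓ, -, htr⟩ := gaussian_spectrum hΓ.1 hΓ.2.1 hΓ.2.2
  rw [htr, Complex.ofReal_re]
  exact ⟨Finset.prod_pos fun k _ => modeFun_pos (hc k), rfl⟩

theorem IsStateCovariance.posSemidef_gaussianOperator
    {Γ : Matrix (MajoranaIndex ι) (MajoranaIndex ι) ℂ} (hΓ : IsStateCovariance Γ) :
    (gaussianOperator Γ).PosSemidef := by
  obtain ⟨c, V, hc, hV, hΓΓ, h, htr⟩ := gaussian_spectrum hΓ.1 hΓ.2.1 hΓ.2.2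
  exact h

lemma eq_sqrt_of_sq_eq {z w : ℂ} (h0 : 0 < z.re) (hz : z = (z.re : ℂ)) (h : z ^ 2 = w) :
    z = (√w.re : ℝ) := by
  rw [← h, hz, ← Complex.ofReal_pow, Complex.ofReal_re, Real.sqrt_sq h0.le]

theorem trace_matPow_eq_sqrt_det {Γ : Matrix (MajoranaIndex ι) (MajoranaIndex ι) ℂ}
    (hΓ : IsStateCovariance Γ) (α : ℝ) :
    (matPow (gaussianOperator Γ) α).trace =
      (√((matPow ((1 / 2 : ℂ) • (1 + Complex.I • Γ)) α +
        matPow ((1 / 2 : ℂ) • (1 - Complex.I • Γ)) α).det.re) : ℝ) := by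
  obtain ⟨h1, h2⟩ := trace_matPow_pos hΓ α
  refine eq_sqrt_of_sq_eq h1 h2 ?_
  have hH := hΓ.isHermitian
  rw [matPow_add_matPow hH, det_cfc_modeFun hH, trace_matPow_sq hΓ]
  have h3 : (Complex.I • Γ) * (Complex.I • Γ) = -(Γ * Γ) := by
    rw [smul_mul_smul_comm, Complex.I_mul_I, neg_one_smul]
  obtain ⟨c, V, hc, hV, hΓΓ, -, htr⟩ := gaussian_spectrum hΓ.1 hΓ.2.1 hΓ.2.2
  have h4 : -(Γ * Γ) = V * (Matrix.diagonal fun a => ((c (ofLex a).1 : ℂ) ^ 2)) * Vᴴ := by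
    rw [hΓΓ, ← neg_mul, ← mul_neg, Matrix.diagonal_neg]
    simp only [neg_neg]
  rw [rootProd, h3, h4, hΓΓ, charpoly_conj_diagonal hV, charpoly_conj_diagonal hV,
    Multiset.map_map, Multiset.map_map]
  simp only [Function.comp_def, Complex.neg_re, neg_neg]

/-- Both sides are `∏ (1 + c_k²)/2`. No factor vanishes, which also gives invertibility. -/
theorem trace_mul_self_eq_sqrt_det {Γ : Matrix (MajoranaIndex ι) (MajoranaIndex ι) ℂ}
    (hΓ : IsStateCovariance Γ) :
    (gaussianOperator Γ * gaussianOperator Γ).trace =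
        (√(((1 / 2 : ℂ) • (1 - Γ * Γ)).det.re) : ℝ) ∧
      0 < (gaussianOperator Γ * gaussianOperator Γ).trace.re ∧ IsUnit (1 - Γ * Γ) := by
  have hX := hΓ.posSemidef_gaussianOperator
  obtain ⟨h1, h2⟩ := trace_matPow_pos hΓ 2
  rw [matPow_two hX.1] at h1 h2
  obtain ⟨c, V, hc, hV, hΓΓ, -, htr⟩ := gaussian_spectrum hΓ.1 hΓ.2.1 hΓ.2.2
  have h3 := htr 2
  rw [matPow_two hX.1] at h3
  have h4 : (1 / 2 : ℂ) • (1 - Γ * Γ) =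
      V * (Matrix.diagonal fun a => ((modeFun 2 (c (ofLex a).1) : ℝ) : ℂ)) * Vᴴ := by
    have h5 : (Matrix.diagonal fun a : MajoranaIndex ι => ((modeFun 2 (c (ofLex a).1) : ℝ) : ℂ)) =
        (1 / 2 : ℂ) • (1 - Matrix.diagonal fun a => -((c (ofLex a).1 : ℂ) ^ 2)) := by
      rw [← Matrix.diagonal_one, Matrix.diagonal_sub, ← Matrix.diagonal_smul]
      congr 1; ext a
      simp [modeFun_two]; ring
    rw [h5, hΓΓ, Matrix.mul_smul, Matrix.smul_mul, mul_sub, sub_mul, mul_one, hV]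
  have h5 : ((1 / 2 : ℂ) • (1 - Γ * Γ)).det =
      (((∏ k, modeFun 2 (c k)) ^ 2 : ℝ) : ℂ) := by
    rw [h4, Matrix.det_mul_comm, ← mul_assoc, mul_eq_one_comm.1 hV, one_mul, Matrix.det_diagonal,
      ← prod_majoranaIndex]
    push_cast
    rfl
  refine ⟨eq_sqrt_of_sq_eq h1 h2 ?_, h1, ?_⟩
  · rw [h3, h5]; push_cast; rfl
  · rw [Matrix.isUnit_iff_isUnit_det, isUnit_iff_ne_zero]
    intro h0
    rw [Matrix.det_smul, h0, mul_zero] at h5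
    have h6 : 0 < ∏ k, modeFun 2 (c k) := Finset.prod_pos fun k _ => modeFun_pos (hc k)
    have h7 := Complex.ofReal_eq_zero.1 h5.symm
    exact absurd h7 (pow_pos h6 2).ne'

/-- Purity says that `∏ (1 + c_k²)/2 = 1`. As no factor exceeds one, every `c_k²` equals one. -/
theorem mul_self_eq_neg_one_of_pure {Γ : Matrix (MajoranaIndex ι) (MajoranaIndex ι) ℂ}
    (hΓ : IsStateCovariance Γ)
    (hpure : gaussianOperator Γ * gaussianOperator Γ = gaussianOperator Γ) : Γ * Γ = -1 := by
  have hX := hΓ.posSemidef_gaussianOperator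
  obtain ⟨c, V, hc, hV, hΓΓ, -, htr⟩ := gaussian_spectrum hΓ.1 hΓ.2.1 hΓ.2.2
  have h1 := htr 2
  rw [matPow_two hX.1, hpure, trace_gaussianOperator] at h1
  have h2 : ∏ k, modeFun 2 (c k) = 1 := by exact_mod_cast h1.symm
  have hle : ∀ k, modeFun 2 (c k) ≤ 1 := fun k => by
    rw [modeFun_two]
    have := (sq_le_one_iff_abs_le_one (c k)).2 (hc k)
    linarith
  have h3 : ∀ k, c k ^ 2 = 1 := by
    intro k
    have h4 := Finset.mul_prod_erase Finset.univ (fun k => modeFun 2 (c k)) (Finset.mem_univ k)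
    have h5 : ∏ l ∈ Finset.univ.erase k, modeFun 2 (c l) ≤ 1 :=
      Finset.prod_le_one (fun l _ => modeFun_nonneg (hc l)) fun l _ => hle l
    have h6 := modeFun_pos (α := 2) (hc k)
    have h7 : modeFun 2 (c k) = 1 := by
      refine le_antisymm (hle k) ?_
      calc 1 = modeFun 2 (c k) * ∏ l ∈ Finset.univ.erase k, modeFun 2 (c l) := by
            rw [h4, h2]
        _ ≤ modeFun 2 (c k) * 1 := mul_le_mul_of_nonneg_left h5 h6.le
        _ = _ := mul_one _
    rw [modeFun_two] at h7
    linarith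
  have h4 : ∀ k, ((c k : ℂ)) ^ 2 = 1 := fun k => by exact_mod_cast h3 k
  rw [hΓΓ]
  simp only [h4]
  rw [show (Matrix.diagonal fun _ : MajoranaIndex ι => (-1 : ℂ)) = -1 by
    rw [← Matrix.diagonal_one, ← Matrix.diagonal_neg], mul_neg, mul_one, neg_mul, hV]

end GaussianStates
-- Rescaling the labels in `B` and the partial transpose.
section Cut

variable {ι : Type*} [Fintype ι] [LinearOrder ι]

lemma prod_fin_two_mul {R : Type*} [CommMonoid R] (p : ℕ) (f : Fin (2 * p) → R) :
    ∏ i, f i = ∏ l : Fin p, f ⟨2 * (l : ℕ), by have := l.isLt; omega⟩ *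
      f ⟨2 * (l : ℕ) + 1, by have := l.isLt; omega⟩ := by
  induction p with
  | zero =>
    have : IsEmpty (Fin (2 * 0)) := Fin.isEmpty
    simp
  | succ p ih =>
    rw [Fin.prod_univ_succ]
    refine (Fin.prod_univ_succ (n := 2 * p + 1) f).trans ?_
    rw [Fin.prod_univ_succ, ih fun i => f i.succ.succ, ← mul_assoc]
    rfl

lemma cutMatrix_apply_mul (B : Finset ι) (s : ℂ)
    (Γ : Matrix (MajoranaIndex ι) (MajoranaIndex ι) ℂ) (a b : MajoranaIndex ι) :
    (cutMatrix B s * Γ * cutMatrix B s) a b =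
      (if (ofLex a).1 ∈ B then s else 1) * (if (ofLex b).1 ∈ B then s else 1) * Γ a b := by
  rw [cutMatrix, Matrix.mul_diagonal, Matrix.diagonal_mul]; ring

/-- A pairing uses every label of `S` exactly once, so all pairings acquire the same factor. -/
theorem wickValue_cut (B : Finset ι) (s : ℂ)
    (Γ : Matrix (MajoranaIndex ι) (MajoranaIndex ι) ℂ) (S : Finset (MajoranaIndex ι)) :
    wickValue (cutMatrix B s * Γ * cutMatrix B s) S = s ^ countIn B S * wickValue Γ S := by
  by_cases h : Even S.card
  · obtain ⟨p, hp⟩ := h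
    have hp : S.card = 2 * p := by omega
    rw [wickValue_of_card hp, wickValue_of_card hp, mul_left_comm]
    congr 1
    rw [Finset.mul_sum]
    refine Finset.sum_congr rfl fun σ _ => ?_
    rw [mul_left_comm]
    congr 1
    simp only [pairProd, cutMatrix_apply_mul]
    rw [Finset.prod_mul_distrib]
    congr 1
    rw [← prod_fin_two_mul p fun i =>
      if (ofLex ((S.orderEmbOfFin hp ∘ σ) i)).1 ∈ B then s else 1]
    simp only [Function.comp_apply]
    rw [Equiv.prod_comp σ fun i => if (ofLex (S.orderEmbOfFin hp i)).1 ∈ B then s else 1]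
    have h1 : ∏ i, (if (ofLex (S.orderEmbOfFin hp i)).1 ∈ B then s else 1) =
        ∏ a ∈ S, if (ofLex a).1 ∈ B then s else 1 := by
      conv_rhs => rw [← Finset.map_orderEmbOfFin_univ S hp]
      rw [Finset.prod_map]
      rfl
    rw [h1, countIn, Finset.prod_ite]
    simp
  · rw [wickValue_of_odd h, wickValue_of_odd h, mul_zero]

lemma transpose_cut (B : Finset ι) (s : ℂ) {Γ : Matrix (MajoranaIndex ι) (MajoranaIndex ι) ℂ}
    (hΓ : Γᵀ = -Γ) :
    (cutMatrix B s * Γ * cutMatrix B s)ᵀ = -(cutMatrix B s * Γ * cutMatrix B s) := by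
  rw [Matrix.transpose_mul, Matrix.transpose_mul, hΓ, cutMatrix, Matrix.diagonal_transpose]
  noncomm_ring

/-- The expansion of the Gaussian operator of a rescaled covariance matrix. -/
lemma gaussianOperator_cut (B : Finset ι) (s : ℂ)
    (Γ : Matrix (MajoranaIndex ι) (MajoranaIndex ι) ℂ) :
    gaussianOperator (cutMatrix B s * Γ * cutMatrix B s) =
      ∑ S, (s ^ countIn B S * wickValue Γ S / 2 ^ Fintype.card ι) • (monomial S)ᴴ := by
  simp only [gaussianOperator, wickValue_cut]

lemma trace_gaussianOperator_mul_monomial (Γ : Matrix (MajoranaIndex ι) (MajoranaIndex ι) ℂ)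
    (S : Finset (MajoranaIndex ι)) : (gaussianOperator Γ * monomial S).trace = wickValue Γ S :=
  trace_sum_smul_conjTranspose_monomial _ S

lemma star_wickValue {Γ : Matrix (MajoranaIndex ι) (MajoranaIndex ι) ℂ}
    (hH : (gaussianOperator Γ).IsHermitian) {S : Finset (MajoranaIndex ι)} {ε : ℂ}
    (hε : (monomial S)ᴴ = ε • monomial S) : star (wickValue Γ S) = ε * wickValue Γ S := by
  rw [← trace_gaussianOperator_mul_monomial, ← Matrix.trace_conjTranspose,
    Matrix.conjTranspose_mul, hH.eq, hε, Matrix.smul_mul, Matrix.trace_smul, smul_eq_mul,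
    Matrix.trace_mul_comm]

/-- Hermiticity of the unscaled operator makes the moments agree with their conjugates up to the
reversal sign of the monomial, so the adjoint only conjugates the powers of `s`. -/
theorem conjTranspose_gaussianOperator_cut (B : Finset ι) (s : ℂ)
    {Γ : Matrix (MajoranaIndex ι) (MajoranaIndex ι) ℂ} (hH : (gaussianOperator Γ).IsHermitian) :
    (gaussianOperator (cutMatrix B s * Γ * cutMatrix B s))ᴴ =
      gaussianOperator (cutMatrix B (star s) * Γ * cutMatrix B (star s)) := by
  rw [gaussianOperator_cut, gaussianOperator_cut, Matrix.conjTranspose_sum]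
  refine Finset.sum_congr rfl fun S _ => ?_
  obtain ⟨ε, h1, h2, h3⟩ := conjTranspose_monomial S
  rw [Matrix.conjTranspose_smul, Matrix.conjTranspose_conjTranspose, h3, smul_smul, star_div₀,
    star_mul', star_wickValue hH h3, star_pow, star_pow]
  congr 1
  simp only [star_ofNat]; ring

/-- The sequence 1, 1, -1, -1 of period four has Fourier components only at `i` and `-i`. -/
lemma partialTranspose_sign (k : ℕ) :
    (if k % 4 = 0 ∨ k % 4 = 1 then 1 else -1 : ℂ) =
      (1 - Complex.I) / 2 * Complex.I ^ k + (1 + Complex.I) / 2 * (-Complex.I) ^ k := by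
  have hI := Complex.I_sq
  have h4 : Complex.I ^ k = Complex.I ^ (k % 4) := Complex.I_pow_eq_pow_mod k
  have h5 : (-Complex.I) ^ k = (-Complex.I) ^ (k % 4) := by
    conv_lhs => rw [← Nat.div_add_mod k 4, pow_add, pow_mul]
    rw [neg_pow, Complex.I_pow_four]; norm_num
  rw [h4, h5]
  have : k % 4 < 4 := Nat.mod_lt _ (by norm_num)
  interval_cases k % 4
  · norm_num; ring
  · norm_num; linear_combination hI
  · norm_num; ring
  · norm_num; linear_combination (Complex.I ^ 2 / 2 + Complex.I / 2 - 1) * hI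

theorem partialTranspose_gaussianOperator (B : Finset ι)
    (Γ : Matrix (MajoranaIndex ι) (MajoranaIndex ι) ℂ) :
    partialTranspose B (gaussianOperator Γ) =
      ((1 - Complex.I) / 2) •
        gaussianOperator (cutMatrix B Complex.I * Γ * cutMatrix B Complex.I) +
      ((1 + Complex.I) / 2) •
        gaussianOperator (cutMatrix B (-Complex.I) * Γ * cutMatrix B (-Complex.I)) := by
  rw [gaussianOperator_cut, gaussianOperator_cut, partialTranspose, Finset.smul_sum,
    Finset.smul_sum, ← Finset.sum_add_distrib]
  refine Finset.sum_congr rfl fun S _ => ?_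
  obtain ⟨ε, h1, h2, h3⟩ := conjTranspose_monomial S
  rw [partialTranspose_sign, majoranaCoeff, h3, Matrix.smul_mul, Matrix.trace_smul,
    Matrix.trace_mul_comm, trace_gaussianOperator_mul_monomial]
  simp only [smul_smul, ← add_smul, smul_eq_mul]
  congr 1; ring

/-- Monomials are orthogonal, so only equal label sets meet, and there the scale factors cancel. -/
theorem trace_gaussianOperator_cut_mul (B : Finset ι) {s t : ℂ} (hst : s * t = 1)
    (Γ : Matrix (MajoranaIndex ι) (MajoranaIndex ι) ℂ) :
    (gaussianOperator (cutMatrix B s * Γ * cutMatrix B s) *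
        gaussianOperator (cutMatrix B t * Γ * cutMatrix B t)).trace =
      (gaussianOperator Γ * gaussianOperator Γ).trace := by
  have hexp : ∀ Y : FockOp ι, (gaussianOperator Γ * Y) =
      (∑ S, (wickValue Γ S / 2 ^ Fintype.card ι) • (monomial S)ᴴ) * Y := fun Y => rfl
  rw [gaussianOperator_cut B s, hexp, Finset.sum_mul, Finset.sum_mul, Matrix.trace_sum, Matrix.trace_sum]
  refine Finset.sum_congr rfl fun S _ => ?_
  obtain ⟨ε, h1, h2, h3⟩ := conjTranspose_monomial S
  rw [h3, Matrix.smul_mul, Matrix.smul_mul, Matrix.smul_mul, Matrix.smul_mul, Matrix.trace_smul,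
    Matrix.trace_smul, Matrix.trace_smul, Matrix.trace_smul, Matrix.trace_mul_comm,
    Matrix.trace_mul_comm (monomial S), trace_gaussianOperator_mul_monomial,
    trace_gaussianOperator_mul_monomial, wickValue_cut]
  have h4 : s ^ countIn B S * t ^ countIn B S = 1 := by rw [← mul_pow, hst, one_pow]
  simp only [smul_eq_mul]
  linear_combination (wickValue Γ S ^ 2 * ε / 2 ^ Fintype.card ι) * h4

lemma countIn_univ (B : Finset ι) : countIn B Finset.univ = 2 * B.card := by
  have h : (Finset.univ.filter fun a : MajoranaIndex ι => (ofLex a).1 ∈ B) =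
      (B ×ˢ (Finset.univ : Finset (Fin 2))).map toLex.toEmbedding := by
    ext a
    simp only [Finset.mem_filter, Finset.mem_univ, true_and, Finset.mem_map, Finset.mem_product,
      and_true]
    exact ⟨fun h => ⟨ofLex a, h, rfl⟩, by rintro ⟨b, hb, rfl⟩; exact hb⟩
  rw [countIn, h, Finset.card_map, Finset.card_product, Finset.card_univ, Fintype.card_fin,
    mul_comm]

lemma countIn_add_countIn_compl (B : Finset ι) (S : Finset (MajoranaIndex ι)) :
    countIn B S + countIn B Sᶜ = 2 * B.card := by
  rw [← countIn_univ, countIn, countIn, countIn, ← Finset.card_union_of_disjoint,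
    ← Finset.filter_union, Finset.union_compl]
  exact Finset.disjoint_filter_filter disjoint_compl_right

lemma trace_parity_mul_monomials {S T : Finset (MajoranaIndex ι)} (hS : Even S.card)
    (hT : Even T.card) (hST : T ≠ Sᶜ) :
    (parity * ((monomial S)ᴴ * (monomial T)ᴴ)).trace = 0 := by
  obtain ⟨a, ha⟩ : ∃ a, (a ∈ S ∧ a ∈ T) ∨ (a ∉ S ∧ a ∉ T) := by
    by_contra! h
    refine hST (Finset.ext fun a => ?_)
    rw [Finset.mem_compl]
    exact ⟨fun ha ha' => (h a).1 ha' ha, fun ha => (h a).2 ha⟩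
  refine trace_eq_zero_of_conj (U := majorana a) (V := majorana a) (majorana_mul_self a) ?_
  have h1 : majorana a * (parity * ((monomial S)ᴴ * (monomial T)ᴴ)) * majorana a =
      -(parity * ((majorana a * (monomial S)ᴴ * majorana a) *
        (majorana a * (monomial T)ᴴ * majorana a))) := by
    have h2 : majorana a * parity = -(parity * majorana a) := by
      rw [parity_mul_majorana, neg_neg]
    rw [← mul_assoc, h2]
    simp only [mul_assoc, neg_mul]
    rw [← mul_assoc (majorana a) (majorana a), majorana_mul_self, one_mul]
  rw [h1, majorana_mul_conjTranspose_monomial_mul_majorana,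
    majorana_mul_conjTranspose_monomial_mul_majorana, Matrix.smul_mul, Matrix.mul_smul,
    Matrix.mul_smul, Matrix.mul_smul, smul_smul]
  have h2 : commSign a S * commSign a T = 1 := by
    simp only [commSign, hS.neg_one_pow, hT.neg_one_pow]
    rcases ha with ⟨h4, h5⟩ | ⟨h4, h5⟩ <;> simp [h4, h5]
  rw [h2, one_smul]

/-- In the presence of the parity only complementary label sets contribute. Together they contain
all `2|B|` labels in `B`, an even number, so the sign of `s` drops out. -/
theorem trace_parity_mul_sq_cut (B : Finset ι) (s : ℂ)
    (Γ : Matrix (MajoranaIndex ι) (MajoranaIndex ι) ℂ) :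
    (parity * (gaussianOperator (cutMatrix B (-s) * Γ * cutMatrix B (-s)) *
        gaussianOperator (cutMatrix B (-s) * Γ * cutMatrix B (-s)))).trace =
      (parity * (gaussianOperator (cutMatrix B s * Γ * cutMatrix B s) *
        gaussianOperator (cutMatrix B s * Γ * cutMatrix B s))).trace := by
  rw [gaussianOperator_cut, gaussianOperator_cut, Finset.sum_mul_sum, Finset.sum_mul_sum]
  simp only [Finset.mul_sum, Matrix.trace_sum, smul_mul_smul_comm, Matrix.mul_smul, Matrix.trace_smul, smul_eq_mul]
  refine Finset.sum_congr rfl fun S _ => Finset.sum_congr rfl fun T _ => ?_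
  by_cases hS : Even S.card
  · by_cases hT : Even T.card
    · by_cases hST : T = Sᶜ
      · have h1 : (-s) ^ countIn B S * (-s) ^ countIn B T =
            s ^ countIn B S * s ^ countIn B T := by
          rw [← pow_add, ← pow_add, hST, countIn_add_countIn_compl]
          exact (even_two_mul _).neg_pow _
        linear_combination (wickValue Γ S * wickValue Γ T / (2 ^ Fintype.card ι) ^ 2 *
          (parity * ((monomial S)ᴴ * (monomial T)ᴴ)).trace) * h1
      · rw [trace_parity_mul_monomials hS hT hST]; simp
    · rw [wickValue_of_odd hT]; simp
  · rw [wickValue_of_odd hS]; simp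

end Cut

/-! ### Reduced states. -/

section Reduced

variable {ι : Type*} [Fintype ι] [LinearOrder ι]

/-- The inclusion of the labels of the modes in `A`. -/
def labelEmb (A : Finset ι) (a : MajoranaIndex {i // i ∈ A}) : MajoranaIndex ι :=
  toLex (((ofLex a).1 : ι), (ofLex a).2)

lemma labelEmb_strictMono (A : Finset ι) : StrictMono (labelEmb A) := by
  intro a b h
  rw [Prod.Lex.lt_iff] at h
  rw [Prod.Lex.lt_iff]
  rcases h with h | ⟨h1, h2⟩
  · exact Or.inl h
  · exact Or.inr ⟨congrArg Subtype.val h1, h2⟩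

/-- The inclusion of labels is increasing, so it carries the ordered enumeration of `S` to that of
the image and no sign arises. -/
lemma wickValue_image_labelEmb (A : Finset ι)
    (Γ : Matrix (MajoranaIndex ι) (MajoranaIndex ι) ℂ)
    (S : Finset (MajoranaIndex {i // i ∈ A})) :
    wickValue Γ (S.image (labelEmb A)) =
      wickValue (Γ.submatrix (labelEmb A) (labelEmb A)) S := by
  have hcard : (S.image (labelEmb A)).card = S.card :=
    Finset.card_image_of_injective _ (labelEmb_strictMono A).injective
  by_cases h : Even S.card
  · obtain ⟨p, hp⟩ := h
    have hp : S.card = 2 * p := by omega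
    rw [wickValue_of_card (hcard.trans hp), wickValue_of_card hp]
    have h1 : ⇑((S.image (labelEmb A)).orderEmbOfFin (hcard.trans hp)) =
        labelEmb A ∘ S.orderEmbOfFin hp := by
      symm
      refine Finset.orderEmbOfFin_unique _ (fun x => ?_)
        ((labelEmb_strictMono A).comp (S.orderEmbOfFin hp).strictMono)
      exact Finset.mem_image_of_mem _ (Finset.orderEmbOfFin_mem S hp x)
    rw [h1]
    rfl
  · rw [wickValue_of_odd h, wickValue_of_odd (by rwa [hcard])]

theorem reducedState_gaussianOperator (A : Finset ι)
    (Γ : Matrix (MajoranaIndex ι) (MajoranaIndex ι) ℂ) :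
    reducedState A (gaussianOperator Γ) =
      gaussianOperator (Γ.submatrix (labelEmb A) (labelEmb A)) := by
  rw [reducedState, gaussianOperator]
  refine Finset.sum_congr rfl fun S _ => ?_
  rw [← wickValue_image_labelEmb, ← trace_gaussianOperator_mul_monomial, Fintype.card_coe]
  rfl

lemma IsStateCovariance.submatrix {Γ : Matrix (MajoranaIndex ι) (MajoranaIndex ι) ℂ}
    (h : IsStateCovariance Γ) (A : Finset ι) :
    IsStateCovariance (Γ.submatrix (labelEmb A) (labelEmb A)) := by
  obtain ⟨⟨G, hG, rfl⟩, hp, hm⟩ := h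
  have h1 : (1 : Matrix (MajoranaIndex ι) (MajoranaIndex ι) ℂ).submatrix (labelEmb A)
      (labelEmb A) = 1 := Matrix.submatrix_one _ (labelEmb_strictMono A).injective
  refine ⟨⟨G.submatrix (labelEmb A) (labelEmb A), ?_, rfl⟩, ?_, ?_⟩
  · rw [Matrix.transpose_submatrix, hG]; rfl
  · have := hp.submatrix (labelEmb A)
    rwa [Matrix.submatrix_add, Pi.add_apply, Pi.add_apply, h1] at this
  · have := hm.submatrix (labelEmb A)
    rwa [Matrix.submatrix_sub, Pi.sub_apply, Pi.sub_apply, h1] at this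

end Reduced
-- Matrix algebra of the rescaled covariance matrices.
section CutAlgebra

lemma charpoly_eq_of_charpoly_one_add_smul {κ : Type*} [Fintype κ] [DecidableEq κ]
    {M N : Matrix κ κ ℂ} {c : ℂ} (hc : c ≠ 0)
    (h : (1 + c • M).charpoly = (1 + c • N).charpoly) : M.charpoly = N.charpoly := by
  have key : ∀ (L : Matrix κ κ ℂ) (x : ℂ), (1 + c • L).charpoly.eval (1 + c * x) =
      c ^ Fintype.card κ * L.charpoly.eval x := by
    intro L x
    rw [Matrix.eval_charpoly, Matrix.eval_charpoly, ← Matrix.det_smul]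
    congr 1
    simp only [Matrix.scalar_apply, ← Matrix.smul_one_eq_diagonal, add_smul, smul_sub, mul_smul,
      one_smul]
    abel
  refine Polynomial.funext fun x => ?_
  have := key M x
  rw [h, key N x] at this
  exact (mul_left_cancel₀ (pow_ne_zero _ hc) this).symm

lemma charpoly_conj {κ : Type*} [Fintype κ] [DecidableEq κ] {T T' : Matrix κ κ ℂ}
    (h : T' * T = 1) (M : Matrix κ κ ℂ) : (T * M * T').charpoly = M.charpoly := by
  rw [mul_assoc, Matrix.charpoly_mul_comm, mul_assoc, h, mul_one]

variable {ι : Type*} [Fintype ι] [LinearOrder ι]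

lemma cutMatrix_mul (B : Finset ι) (s t : ℂ) :
    cutMatrix B s * cutMatrix B t = cutMatrix B (s * t) := by
  rw [cutMatrix, cutMatrix, cutMatrix, Matrix.diagonal_mul_diagonal]
  congr 1; funext a; split_ifs <;> simp

lemma cutMatrix_one (B : Finset ι) : cutMatrix B (1 : ℂ) = 1 := by
  simp [cutMatrix]

lemma cutMatrix_mul_eq_one (B : Finset ι) {s t : ℂ} (h : s * t = 1) :
    cutMatrix B s * cutMatrix B t = 1 := by rw [cutMatrix_mul, h, cutMatrix_one]

variable (B : Finset ι) (Γ : Matrix (MajoranaIndex ι) (MajoranaIndex ι) ℂ) {s t : ℂ}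

lemma one_sub_cut_mul_cut (h : s * t = 1) :
    1 - (cutMatrix B s * Γ * cutMatrix B s) * (cutMatrix B t * Γ * cutMatrix B t) =
      cutMatrix B s * (1 - Γ * Γ) * cutMatrix B t := by
  have h1 := cutMatrix_mul_eq_one B h
  calc _ = 1 - cutMatrix B s * Γ * (cutMatrix B s * cutMatrix B t) * Γ * cutMatrix B t := by
        noncomm_ring
    _ = cutMatrix B s * cutMatrix B t - cutMatrix B s * Γ * Γ * cutMatrix B t := by
        rw [h1, mul_one]
    _ = _ := by noncomm_ring

lemma isUnit_one_sub_cut_mul_cut (h : s * t = 1) (hu : IsUnit (1 - Γ * Γ)) :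
    IsUnit (1 - (cutMatrix B s * Γ * cutMatrix B s) * (cutMatrix B t * Γ * cutMatrix B t)) := by
  rw [one_sub_cut_mul_cut B Γ h]
  refine (IsUnit.mul ?_ hu).mul ?_
  · exact IsUnit.of_mul_eq_one _ (cutMatrix_mul_eq_one B h)
  · exact IsUnit.of_mul_eq_one _ (cutMatrix_mul_eq_one B (mul_comm s t ▸ h))

lemma one_sub_cut_mul_cut_inv (h : s * t = 1) (hu : IsUnit (1 - Γ * Γ)) :
    (1 - (cutMatrix B s * Γ * cutMatrix B s) * (cutMatrix B t * Γ * cutMatrix B t))⁻¹ =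
      cutMatrix B s * (1 - Γ * Γ)⁻¹ * cutMatrix B t := by
  have hN : (1 - Γ * Γ) * (1 - Γ * Γ)⁻¹ = 1 :=
    Matrix.mul_nonsing_inv _ ((Matrix.isUnit_iff_isUnit_det _).1 hu)
  refine Matrix.inv_eq_right_inv ?_
  rw [one_sub_cut_mul_cut B Γ h]
  calc _ = cutMatrix B s * (1 - Γ * Γ) * (cutMatrix B t * cutMatrix B s) * (1 - Γ * Γ)⁻¹ *
        cutMatrix B t := by simp only [mul_assoc]
    _ = cutMatrix B s * ((1 - Γ * Γ) * (1 - Γ * Γ)⁻¹) * cutMatrix B t := by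
        rw [cutMatrix_mul_eq_one B (mul_comm s t ▸ h), mul_one]; simp only [mul_assoc]
    _ = _ := by rw [hN, mul_one, cutMatrix_mul_eq_one B h]

lemma det_one_sub_cut_mul_cut (h : s * t = 1) (c : ℂ) :
    (c • (1 - (cutMatrix B s * Γ * cutMatrix B s) * (cutMatrix B t * Γ * cutMatrix B t))).det =
      (c • (1 - Γ * Γ)).det := by
  rw [one_sub_cut_mul_cut B Γ h, Matrix.det_smul, Matrix.det_smul, Matrix.det_mul_comm,
    ← mul_assoc, cutMatrix_mul_eq_one B (mul_comm s t ▸ h), one_mul]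

/-- The covariance matrix of the product, conjugated to a form symmetric in both factors. -/
lemma product_covariance_eq (hu : IsUnit (1 - Γ * Γ)) :
    (1 + Complex.I • (cutMatrix B Complex.I * Γ * cutMatrix B Complex.I)) *
        (1 - (cutMatrix B (-Complex.I) * Γ * cutMatrix B (-Complex.I)) *
          (cutMatrix B Complex.I * Γ * cutMatrix B Complex.I))⁻¹ *
        (1 + Complex.I • (cutMatrix B (-Complex.I) * Γ * cutMatrix B (-Complex.I))) =
      cutMatrix B Complex.I * ((cutMatrix B (-1) + Complex.I • Γ) * (1 - Γ * Γ)⁻¹ *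
        (cutMatrix B (-1) + Complex.I • Γ)) * cutMatrix B (-Complex.I) := by
  have hI : (-Complex.I) * Complex.I = 1 := by simp
  have hI' : Complex.I * (-Complex.I) = 1 := by simp
  rw [one_sub_cut_mul_cut_inv B Γ hI hu]
  set T := cutMatrix B Complex.I with hT
  set T' := cutMatrix B (-Complex.I) with hT'
  set R := cutMatrix B (-1) with hR
  have h1 : T * T' = 1 := cutMatrix_mul_eq_one B hI'
  have h2 : T' * T = 1 := cutMatrix_mul_eq_one B hI
  have h3 : T * R = T' := by rw [hT, hR, cutMatrix_mul]; simp [hT']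
  have h4 : R * T' = T := by rw [hT', hR, cutMatrix_mul]; simp [hT]
  have h5 : (1 + Complex.I • (T * Γ * T)) * T' = T * (R + Complex.I • Γ) := by
    rw [add_mul, mul_add, h3, one_mul, Matrix.smul_mul, mul_assoc, h1, mul_one, Matrix.mul_smul]
  have h6 : T * (1 + Complex.I • (T' * Γ * T')) = (R + Complex.I • Γ) * T' := by
    rw [add_mul, mul_add, h4, mul_one, Matrix.smul_mul, Matrix.mul_smul, mul_assoc, ← mul_assoc T,
      h1, one_mul]
  calc _ = ((1 + Complex.I • (T * Γ * T)) * T') * (1 - Γ * Γ)⁻¹ *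
        (T * (1 + Complex.I • (T' * Γ * T'))) := by simp only [mul_assoc]
    _ = _ := by rw [h5, h6]; simp only [mul_assoc]

/-- Source of the combination `γR + Rγ`: since `R² = 1`, it is the cross term of the square. -/
lemma sq_reflection_add :
    (cutMatrix B (-1) + Complex.I • Γ) * (cutMatrix B (-1) + Complex.I • Γ) =
      (1 - Γ * Γ) + Complex.I • (Γ * cutMatrix B (-1) + cutMatrix B (-1) * Γ) := by
  have h : cutMatrix B (-1) * cutMatrix B (-1) = (1 : Matrix (MajoranaIndex ι) _ ℂ) :=
    cutMatrix_mul_eq_one B (by norm_num)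
  rw [mul_add, add_mul, add_mul, h, Matrix.smul_mul, Matrix.mul_smul, Matrix.smul_mul,
    Matrix.mul_smul, smul_smul, Complex.I_mul_I, smul_add, neg_one_smul]
  abel

variable {B Γ} {C : Matrix (MajoranaIndex ι) (MajoranaIndex ι) ℂ}

/-- Up to conjugation `1 + iC` is `(R + iΓ)(1 - Γ²)⁻¹(R + iΓ)`. Moving the first factor to the end,
which keeps the characteristic polynomial, brings out the square of `R + iΓ`. -/
theorem charpoly_product_covariance (hu : IsUnit (1 - Γ * Γ))
    (hC : 1 + Complex.I • C =
      (1 + Complex.I • (cutMatrix B Complex.I * Γ * cutMatrix B Complex.I)) *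
        (1 - (cutMatrix B (-Complex.I) * Γ * cutMatrix B (-Complex.I)) *
          (cutMatrix B Complex.I * Γ * cutMatrix B Complex.I))⁻¹ *
        (1 + Complex.I • (cutMatrix B (-Complex.I) * Γ * cutMatrix B (-Complex.I)))) :
    C.charpoly =
      ((1 - Γ * Γ)⁻¹ * (Γ * cutMatrix B (-1) + cutMatrix B (-1) * Γ)).charpoly := by
  have hN : (1 - Γ * Γ)⁻¹ * (1 - Γ * Γ) = 1 :=
    Matrix.nonsing_inv_mul _ ((Matrix.isUnit_iff_isUnit_det _).1 hu)
  refine charpoly_eq_of_charpoly_one_add_smul Complex.I_ne_zero ?_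
  rw [hC, product_covariance_eq B Γ hu, charpoly_conj (cutMatrix_mul_eq_one B (by simp)),
    mul_assoc, Matrix.charpoly_mul_comm, mul_assoc, sq_reflection_add, mul_add, hN,
    Matrix.mul_smul]

/-- The two matrices are conjugate by `T_B⁺`, because the square of `T_B⁻` is `R`. -/
theorem charpoly_product_covariance' (hu : IsUnit (1 - Γ * Γ)) :
    ((1 - (cutMatrix B Complex.I * Γ * cutMatrix B Complex.I) *
        (cutMatrix B (-Complex.I) * Γ * cutMatrix B (-Complex.I)))⁻¹ *
      (cutMatrix B Complex.I * Γ * cutMatrix B Complex.I +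
        cutMatrix B (-Complex.I) * Γ * cutMatrix B (-Complex.I))).charpoly =
      ((1 - Γ * Γ)⁻¹ * (Γ * cutMatrix B (-1) + cutMatrix B (-1) * Γ)).charpoly := by
  have hI : (-Complex.I) * Complex.I = 1 := by simp
  have hI' : Complex.I * (-Complex.I) = 1 := by simp
  rw [one_sub_cut_mul_cut_inv B Γ hI' hu]
  set T := cutMatrix B Complex.I with hT
  set T' := cutMatrix B (-Complex.I) with hT'
  set R := cutMatrix B (-1) with hR
  have h1 : T * T' = 1 := cutMatrix_mul_eq_one B hI'
  have h2 : T' * T = 1 := cutMatrix_mul_eq_one B hI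
  have h3 : T' * T' = R := by rw [hT', cutMatrix_mul]; simp [hR]
  have h4 : R * T' = T := by rw [hT', hR, cutMatrix_mul]; simp [hT]
  rw [← charpoly_conj h2 ((1 - Γ * Γ)⁻¹ * (Γ * R + R * Γ))]
  congr 1
  calc T * (1 - Γ * Γ)⁻¹ * T' * (T * Γ * T + T' * Γ * T') =
      T * (1 - Γ * Γ)⁻¹ * ((T' * T) * Γ * T + (T' * T') * Γ * T') := by
        simp only [mul_assoc, mul_add]
    _ = T * (1 - Γ * Γ)⁻¹ * (Γ * (R * T') + R * Γ * T') := by rw [h2, h3, h4, one_mul]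
    _ = _ := by simp only [mul_assoc, mul_add, add_mul]

lemma half_smul_inv_mul_half_smul {κ : Type*} [Fintype κ] [DecidableEq κ] (N M : Matrix κ κ ℂ)
    (hu : IsUnit N) : ((1 / 2 : ℂ) • N)⁻¹ * ((1 / 2 : ℂ) • M) = N⁻¹ * M := by
  have hN : N * N⁻¹ = 1 := Matrix.mul_nonsing_inv _ ((Matrix.isUnit_iff_isUnit_det _).1 hu)
  have h : ((1 / 2 : ℂ) • N)⁻¹ = (2 : ℂ) • N⁻¹ := by
    refine Matrix.inv_eq_right_inv ?_
    rw [smul_mul_smul_comm, hN]; norm_num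
  rw [h, smul_mul_smul_comm]; norm_num

end CutAlgebra
-- The product of the two Gaussian operators and the bound on the trace norm.
section Product

variable {ι : Type*} [Fintype ι] [LinearOrder ι]

/-- The Gaussian operator whose covariance matrix is `Γ`, rescaled by `s` on the modes in `B`. -/
def cutGaussian (B : Finset ι) (s : ℂ) (Γ : Matrix (MajoranaIndex ι) (MajoranaIndex ι) ℂ) :
    FockOp ι :=
  gaussianOperator (cutMatrix B s * Γ * cutMatrix B s)

variable (B : Finset ι) {Γ : Matrix (MajoranaIndex ι) (MajoranaIndex ι) ℂ}
  (hΓ : IsStateCovariance Γ)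
include hΓ

lemma conjTranspose_cutGaussian :
    (cutGaussian B Complex.I Γ)ᴴ = cutGaussian B (-Complex.I) Γ := by
  rw [cutGaussian, conjTranspose_gaussianOperator_cut B _ hΓ.posSemidef_gaussianOperator.1,
    Complex.star_def, Complex.conj_I, cutGaussian]

lemma posSemidef_cutGaussian_mul :
    (cutGaussian B Complex.I Γ * cutGaussian B (-Complex.I) Γ).PosSemidef := by
  rw [← conjTranspose_cutGaussian B hΓ]
  exact Matrix.posSemidef_self_mul_conjTranspose _

lemma trace_cutGaussian_mul :
    (cutGaussian B Complex.I Γ * cutGaussian B (-Complex.I) Γ).trace =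
      (gaussianOperator Γ * gaussianOperator Γ).trace :=
  trace_gaussianOperator_cut_mul B (by simp) Γ

lemma trace_cutGaussian_mul_pos :
    0 < (cutGaussian B Complex.I Γ * cutGaussian B (-Complex.I) Γ).trace := by
  obtain ⟨h1, h2, -⟩ := trace_mul_self_eq_sqrt_det hΓ
  rw [trace_cutGaussian_mul B hΓ, Complex.pos_iff]
  refine ⟨h2, ?_⟩
  rw [h1, Complex.ofReal_im]

/-- The product of the two Gaussian operators is a multiple of a Gaussian state. -/
theorem exists_product_covariance :
    ∃ C, IsStateCovariance C ∧
      cutGaussian B Complex.I Γ * cutGaussian B (-Complex.I) Γ =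
        (cutGaussian B Complex.I Γ * cutGaussian B (-Complex.I) Γ).trace • gaussianOperator C ∧
      1 + Complex.I • C =
        (1 + Complex.I • (cutMatrix B Complex.I * Γ * cutMatrix B Complex.I)) *
          (1 - (cutMatrix B (-Complex.I) * Γ * cutMatrix B (-Complex.I)) *
            (cutMatrix B Complex.I * Γ * cutMatrix B Complex.I))⁻¹ *
          (1 + Complex.I • (cutMatrix B (-Complex.I) * Γ * cutMatrix B (-Complex.I))) := by
  obtain ⟨-, -, hu⟩ := trace_mul_self_eq_sqrt_det hΓ
  have ht := hΓ.transpose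
  obtain ⟨C, hC, hrel, hcov⟩ := GaussianRelation.mul
    (transpose_cut B Complex.I ht) (transpose_cut B (-Complex.I) ht)
    (gaussianRelation_gaussianOperator (transpose_cut B Complex.I ht))
    (gaussianRelation_gaussianOperator (transpose_cut B (-Complex.I) ht))
    (isUnit_one_sub_cut_mul_cut B Γ (by simp) hu) (isUnit_one_sub_cut_mul_cut B Γ (by simp) hu)
  have heq := hrel.eq_smul hC
  have hpos := trace_cutGaussian_mul_pos B hΓ
  refine ⟨C, ?_, heq, hcov⟩
  have hG : gaussianOperator C =
      (cutGaussian B Complex.I Γ * cutGaussian B (-Complex.I) Γ).trace⁻¹ •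
        (cutGaussian B Complex.I Γ * cutGaussian B (-Complex.I) Γ) := by
    have := congrArg (fun Z =>
      (cutGaussian B Complex.I Γ * cutGaussian B (-Complex.I) Γ).trace⁻¹ • Z) heq
    refine Eq.trans ?_ this.symm
    exact (inv_smul_smul₀ hpos.ne' _).symm
  -- That `C` is real with `1 ± iC` positive is not read off its formula: it follows from the
  -- positivity of `O_+ O_+†`.
  have hpsd : (gaussianOperator C).PosSemidef := by
    rw [hG]
    exact (posSemidef_cutGaussian_mul B hΓ).smul (inv_nonneg.2 hpos.le)
  have := IsStateCovariance.of_posSemidef hpsd (trace_gaussianOperator C)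
  rwa [(isGaussianWith_gaussianOperator hC).1] at this

lemma traceNorm_cutGaussian :
    traceNorm (cutGaussian B Complex.I Γ) =
      (matPow (cutGaussian B Complex.I Γ * cutGaussian B (-Complex.I) Γ) (1 / 2)).trace.re := by
  rw [traceNorm, ← conjTranspose_cutGaussian B hΓ,
    matPow_trace_mul_comm (Matrix.isHermitian_conjTranspose_mul_self _)
      (Matrix.isHermitian_mul_conjTranspose_self _)]

lemma traceNorm_cutGaussian_neg :
    traceNorm (cutGaussian B (-Complex.I) Γ) =
      (matPow (cutGaussian B Complex.I Γ * cutGaussian B (-Complex.I) Γ) (1 / 2)).trace.re := by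
  rw [traceNorm, ← conjTranspose_cutGaussian B hΓ, Matrix.conjTranspose_conjTranspose]

/-- Pairing with the identity bounds the trace norm below by the trace, which is one. -/
lemma half_power_cutGaussian_pos :
    0 < (matPow (cutGaussian B Complex.I Γ * cutGaussian B (-Complex.I) Γ) (1 / 2)).trace.re := by
  rw [← traceNorm_cutGaussian B hΓ]
  refine lt_of_lt_of_le one_pos (le_trans (le_of_eq ?_)
    (re_trace_mul_le_traceNorm (K := 1) (by simp)))
  rw [one_mul, cutGaussian, trace_gaussianOperator, Complex.one_re]

omit hΓ in
lemma partialTranspose_eq_cutGaussian : partialTranspose B (gaussianOperator Γ) =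
    ((1 - Complex.I) / 2) • cutGaussian B Complex.I Γ +
      ((1 + Complex.I) / 2) • cutGaussian B (-Complex.I) Γ :=
  partialTranspose_gaussianOperator B Γ

lemma isHermitian_partialTranspose : (partialTranspose B (gaussianOperator Γ)).IsHermitian := by
  rw [partialTranspose_eq_cutGaussian, Matrix.IsHermitian, Matrix.conjTranspose_add,
    Matrix.conjTranspose_smul, Matrix.conjTranspose_smul, ← conjTranspose_cutGaussian B hΓ,
    Matrix.conjTranspose_conjTranspose, add_comm]
  congr 2 <;> simp [star_div₀, sub_eq_add_neg]

lemma traceNorm_partialTranspose_pos : 0 < traceNorm (partialTranspose B (gaussianOperator Γ)) := by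
  refine lt_of_lt_of_le one_pos (le_trans (le_of_eq ?_)
    (re_trace_mul_le_traceNorm (K := 1) (by simp)))
  rw [one_mul, partialTranspose_eq_cutGaussian, Matrix.trace_add, Matrix.trace_smul,
    Matrix.trace_smul, cutGaussian, cutGaussian, trace_gaussianOperator, trace_gaussianOperator]
  simp
  norm_num

theorem traceNorm_partialTranspose_le :
    traceNorm (partialTranspose B (gaussianOperator Γ)) ≤ √2 *
      (matPow (cutGaussian B Complex.I Γ * cutGaussian B (-Complex.I) Γ) (1 / 2)).trace.re := by
  obtain ⟨K, hKK, hK, htr⟩ := exists_unitary_trace_eq_traceNorm (isHermitian_partialTranspose B hΓ)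
  have hs : (√2 : ℂ) * √2 = 2 := by
    rw [← Complex.ofReal_mul, Real.mul_self_sqrt (by norm_num)]; norm_num
  -- The coefficients are `u / 2` with `|u| = √2`. The phase `u / √2` is absorbed into the unitary
  -- `K`, leaving the modulus `√2 / 2` for each of the two terms.
  have key : ∀ (u : ℂ) (M : FockOp ι), u * star u = 2 →
      (u / 2 * (K * M).trace).re ≤ √2 / 2 * traceNorm M := by
    intro u M hu
    have h1 := re_trace_mul_le_traceNorm (K := (u / √2) • K) (M := M) (by
      rw [Matrix.conjTranspose_smul, hK, smul_mul_smul_comm, hKK, star_div₀]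
      have : u / (√2 : ℂ) * (star u / star (√2 : ℂ)) = 1 := by
        rw [Complex.star_def, Complex.conj_ofReal, div_mul_div_comm, hs,
          ← Complex.star_def, hu]
        norm_num
      rw [this, one_smul])
    rw [Matrix.smul_mul, Matrix.trace_smul, smul_eq_mul] at h1
    have h2 : u / 2 * (K * M).trace = ((√2 / 2 : ℝ) : ℂ) * (u / √2 * (K * M).trace) := by
      have h0 : (√2 : ℂ) ≠ 0 := by
        intro h; rw [h, zero_mul] at hs; norm_num at hs
      push_cast
      field_simp
    rw [h2, Complex.re_ofReal_mul]
    exact mul_le_mul_of_nonneg_left h1 (by positivity)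
  have h1 : traceNorm (partialTranspose B (gaussianOperator Γ)) =
      ((1 - Complex.I) / 2 * (K * cutGaussian B Complex.I Γ).trace).re +
        ((1 + Complex.I) / 2 * (K * cutGaussian B (-Complex.I) Γ).trace).re := by
    rw [← Complex.ofReal_re (traceNorm _), ← htr, partialTranspose_eq_cutGaussian, mul_add,
      Matrix.trace_add, Matrix.mul_smul, Matrix.mul_smul, Matrix.trace_smul, Matrix.trace_smul,
      Complex.add_re, smul_eq_mul, smul_eq_mul]
  have hI := Complex.I_sq
  have h2 := key (1 - Complex.I) (cutGaussian B Complex.I Γ) (by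
    simp; linear_combination -hI)
  have h3 := key (1 + Complex.I) (cutGaussian B (-Complex.I) Γ) (by
    simp; linear_combination -hI)
  rw [traceNorm_cutGaussian B hΓ] at h2
  rw [traceNorm_cutGaussian_neg B hΓ] at h3
  rw [h1]
  linarith

end Product
-- Pure states: the partial transpose squares to the product.
section Pure

variable {ι : Type*} [Fintype ι] [LinearOrder ι]

lemma two_smul_one_inv {κ : Type*} [Fintype κ] [DecidableEq κ] :
    ((2 : ℂ) • (1 : Matrix κ κ ℂ))⁻¹ = (1 / 2 : ℂ) • 1 :=
  Matrix.inv_eq_right_inv (by rw [smul_mul_smul_comm]; norm_num)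

/-- The inverse in the composition rule is just one half, and the composed covariance matrix becomes
the mean, which is symmetric in the two factors. -/
lemma half_smul_mul_of_mul_eq_neg_one {κ : Type*} [Fintype κ] [DecidableEq κ]
    {Γ Γ' : Matrix κ κ ℂ} (h : Γ * Γ' = -1) (h' : Γ' * Γ = -1) :
    (1 + Complex.I • Γ) * (1 - Γ' * Γ)⁻¹ * (1 + Complex.I • Γ') =
      1 + Complex.I • ((1 / 2 : ℂ) • (Γ + Γ')) := by
  rw [h', sub_neg_eq_add, ← two_smul ℂ (1 : Matrix κ κ ℂ), two_smul_one_inv, Matrix.mul_smul,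
    mul_one, Matrix.smul_mul, mul_add, mul_one, add_mul, one_mul, smul_mul_smul_comm, h,
    Complex.I_mul_I]
  module

lemma GaussianRelation.mul_of_mul_eq_neg_one {X Y : FockOp ι}
    {Γ Γ' : Matrix (MajoranaIndex ι) (MajoranaIndex ι) ℂ} (hΓ : Γᵀ = -Γ) (hΓ' : Γ'ᵀ = -Γ')
    (hX : GaussianRelation X Γ) (hY : GaussianRelation Y Γ') (h : Γ * Γ' = -1)
    (h' : Γ' * Γ = -1) : GaussianRelation (X * Y) ((1 / 2 : ℂ) • (Γ + Γ')) := by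
  have hu : IsUnit ((1 : Matrix (MajoranaIndex ι) (MajoranaIndex ι) ℂ) - -1) := by
    rw [sub_neg_eq_add, ← two_smul ℂ (1 : Matrix (MajoranaIndex ι) (MajoranaIndex ι) ℂ)]
    exact IsUnit.of_mul_eq_one ((1 / 2 : ℂ) • 1) (by rw [smul_mul_smul_comm]; norm_num)
  obtain ⟨C, -, hC, hcov⟩ := GaussianRelation.mul hΓ hΓ' hX hY (by rwa [h']) (by rwa [h])
  rw [half_smul_mul_of_mul_eq_neg_one h h'] at hcov
  rwa [smul_right_injective _ Complex.I_ne_zero (add_left_cancel hcov)] at hC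

lemma parity_mul_field (w : MajoranaIndex ι → ℂ) : parity * field w = -(field w * parity) := by
  rw [field_apply, Finset.mul_sum, Finset.sum_mul, ← Finset.sum_neg_distrib]
  exact Finset.sum_congr rfl fun a _ => by
    rw [Matrix.mul_smul, Matrix.smul_mul, parity_mul_majorana, smul_neg]

/-- The square of a Gaussian operator, multiplied by the parity, for an invertible covariance
matrix. -/
lemma GaussianRelation.parity_mul_sq {X : FockOp ι}
    {Γ Γ' : Matrix (MajoranaIndex ι) (MajoranaIndex ι) ℂ} (hX : GaussianRelation X Γ)
    (h : Γ' * Γ = -1) : GaussianRelation (parity * (X * X)) ((1 / 2 : ℂ) • (Γ + Γ')) := by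
  refine ⟨?_, ?_⟩
  · have h1 : parity * (X * X) = (X * X) * parity := by
      rw [← mul_assoc, hX.1, mul_assoc, hX.1, mul_assoc]
    rw [mul_assoc, h1]
  have hcomm : (1 - Complex.I • Γ) * (1 + Complex.I • Γ) =
      (1 + Complex.I • Γ) * (1 - Complex.I • Γ) := by
    rw [mul_add, mul_one, mul_sub, mul_one, sub_mul, add_mul, one_mul]
    abel
  have h1 : Intertwines (X * X) ((1 + Complex.I • Γ) * (1 + Complex.I • Γ))
      ((1 - Complex.I • Γ) * (1 - Complex.I • Γ)) := by
    refine Intertwines.comp (B := (1 + Complex.I • Γ) * (1 - Complex.I • Γ)) ?_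
      (hX.2.mul_left _)
    rw [← hcomm]
    exact hX.2.mul_left _
  -- Since `Γ'Γ = -1`, this factor turns `(1 ± iΓ)²` into `±1 + (i/2)(Γ + Γ')`. On the minus side
  -- this is the negative of the desired matrix, and moving the parity past a field repairs the
  -- sign.
  have h2 := h1.mul_left ((Complex.I / 2) • Γ')
  have h5 : Γ' * (Γ * Γ) = -Γ := by rw [← mul_assoc, h, neg_one_mul]
  have h3 : ((Complex.I / 2) • Γ') * ((1 + Complex.I • Γ) * (1 + Complex.I • Γ)) =
      1 + Complex.I • ((1 / 2 : ℂ) • (Γ + Γ')) := by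
    have h6 : (1 + Complex.I • Γ) * (1 + Complex.I • Γ) = 1 + (2 * Complex.I) • Γ - Γ * Γ := by
      rw [mul_add, mul_one, add_mul, one_mul, smul_mul_smul_comm, Complex.I_mul_I]
      module
    rw [h6, mul_sub, mul_add, mul_one, Matrix.smul_mul, Matrix.smul_mul, Matrix.mul_smul, h, h5,
      smul_smul, show Complex.I / 2 * (2 * Complex.I) = -1 by linear_combination Complex.I_sq]
    module
  have h4 : ((Complex.I / 2) • Γ') * ((1 - Complex.I • Γ) * (1 - Complex.I • Γ)) =
      -(1 - Complex.I • ((1 / 2 : ℂ) • (Γ + Γ'))) := by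
    have h6 : (1 - Complex.I • Γ) * (1 - Complex.I • Γ) = 1 - (2 * Complex.I) • Γ - Γ * Γ := by
      rw [mul_sub, mul_one, sub_mul, one_mul, smul_mul_smul_comm, Complex.I_mul_I]
      module
    rw [h6, mul_sub, mul_sub, mul_one, Matrix.smul_mul, Matrix.smul_mul, Matrix.mul_smul, h, h5,
      smul_smul, show Complex.I / 2 * (2 * Complex.I) = -1 by linear_combination Complex.I_sq]
    module
  rw [h3, h4] at h2
  intro w
  rw [mul_assoc, h2 w, ← mul_assoc, parity_mul_field, Matrix.vecMul_neg, map_neg, neg_mul,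
    neg_mul, neg_mul, neg_neg, mul_assoc]

variable (B : Finset ι) {Γ : Matrix (MajoranaIndex ι) (MajoranaIndex ι) ℂ}
  (hΓ : IsStateCovariance Γ) (hpure : Γ * Γ = -1)

lemma cut_mul_cut_of_pure (hpure : Γ * Γ = -1) {s t : ℂ} (h : s * t = 1) :
    (cutMatrix B s * Γ * cutMatrix B s) * (cutMatrix B t * Γ * cutMatrix B t) = -1 := by
  have h1 := one_sub_cut_mul_cut B Γ h
  rw [hpure, sub_neg_eq_add, mul_add, add_mul, mul_one, cutMatrix_mul_eq_one B h,
    sub_eq_add_neg] at h1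
  rw [← neg_neg (_ * (cutMatrix B t * Γ * cutMatrix B t)), add_left_cancel h1]

include hΓ hpure

/-- Both products satisfy the Gaussian relation of the mean and have the same trace, so their
difference vanishes. -/
theorem cutGaussian_mul_comm :
    cutGaussian B Complex.I Γ * cutGaussian B (-Complex.I) Γ =
      cutGaussian B (-Complex.I) Γ * cutGaussian B Complex.I Γ := by
  have h1 := cut_mul_cut_of_pure B hpure (s := Complex.I) (t := -Complex.I) (by simp)
  have h2 := cut_mul_cut_of_pure B hpure (s := -Complex.I) (t := Complex.I) (by simp)
  have hp := transpose_cut B Complex.I hΓ.transpose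
  have hm := transpose_cut B (-Complex.I) hΓ.transpose
  have h3 := (gaussianRelation_gaussianOperator hp).mul_of_mul_eq_neg_one hp hm
    (gaussianRelation_gaussianOperator hm) h1 h2
  have h4 := (gaussianRelation_gaussianOperator hm).mul_of_mul_eq_neg_one hm hp
    (gaussianRelation_gaussianOperator hp) h2 h1
  rw [add_comm] at h4
  refine sub_eq_zero.1 ((h3.sub h4).eq_zero_of_trace ?_)
  rw [Matrix.trace_sub, Matrix.trace_mul_comm, sub_self]

/-- The same comparison after multiplication by the invertible parity operator; the traces agree by
`trace_parity_mul_sq_cut`. -/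
theorem cutGaussian_sq_eq :
    cutGaussian B (-Complex.I) Γ * cutGaussian B (-Complex.I) Γ =
      cutGaussian B Complex.I Γ * cutGaussian B Complex.I Γ := by
  have h1 := cut_mul_cut_of_pure B hpure (s := Complex.I) (t := -Complex.I) (by simp)
  have h2 := cut_mul_cut_of_pure B hpure (s := -Complex.I) (t := Complex.I) (by simp)
  have hp := transpose_cut B Complex.I hΓ.transpose
  have hm := transpose_cut B (-Complex.I) hΓ.transpose
  have h3 := (gaussianRelation_gaussianOperator hp).parity_mul_sq h2
  have h4 := (gaussianRelation_gaussianOperator hm).parity_mul_sq h1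
  rw [add_comm] at h3
  have h5 := sub_eq_zero.1 ((h4.sub h3).eq_zero_of_trace (by
    rw [Matrix.trace_sub, trace_parity_mul_sq_cut, sub_self]))
  have h6 := congrArg (fun Z => parity * Z) h5
  simp only [← mul_assoc, parity_mul_self, one_mul] at h6
  exact h6

/-- The coefficients `(1 ∓ i)/2` have squares `∓i/2`, so the equal squares of the two operators
cancel, and the mixed terms add up. -/
theorem partialTranspose_mul_self :
    partialTranspose B (gaussianOperator Γ) * partialTranspose B (gaussianOperator Γ) =
      cutGaussian B Complex.I Γ * cutGaussian B (-Complex.I) Γ := by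
  rw [partialTranspose_eq_cutGaussian, mul_add, add_mul, add_mul, smul_mul_smul_comm,
    smul_mul_smul_comm, smul_mul_smul_comm, smul_mul_smul_comm, cutGaussian_sq_eq B hΓ hpure,
    ← cutGaussian_mul_comm B hΓ hpure]
  have hI := Complex.I_sq
  have h1 : (1 - Complex.I) / 2 * ((1 - Complex.I) / 2) = -Complex.I / 2 := by
    linear_combination hI / 4
  have h2 : (1 + Complex.I) / 2 * ((1 + Complex.I) / 2) = Complex.I / 2 := by
    linear_combination hI / 4
  have h3 : (1 - Complex.I) / 2 * ((1 + Complex.I) / 2) = 1 / 2 := by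
    linear_combination -hI / 4
  rw [h1, h2, mul_comm ((1 + Complex.I) / 2), h3]
  module

theorem traceNorm_partialTranspose_of_pure :
    traceNorm (partialTranspose B (gaussianOperator Γ)) =
      (matPow (cutGaussian B Complex.I Γ * cutGaussian B (-Complex.I) Γ) (1 / 2)).trace.re := by
  rw [traceNorm_eq_half_power (isHermitian_partialTranspose B hΓ),
    partialTranspose_mul_self B hΓ hpure]

end Pure

/-! ### Comparison of the two blocks of a pure covariance matrix. -/

section Bipartition

open Polynomial in
lemma charpoly_neg_one_sub {κ : Type*} [Fintype κ] [DecidableEq κ] (M : Matrix κ κ ℂ) (x : ℂ) :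
    (-1 - M).charpoly.eval x = (-1) ^ Fintype.card κ * M.charpoly.eval (-1 - x) := by
  rw [Matrix.eval_charpoly, Matrix.eval_charpoly, ← Matrix.det_smul]
  congr 1
  simp only [Matrix.scalar_apply, ← Matrix.smul_one_eq_diagonal, sub_smul, smul_sub]
  module

open Polynomial in
/-- The off-diagonal blocks of a matrix with square `-1` relate the characteristic polynomials of
the squares of its diagonal blocks. -/
theorem charpoly_mul_X_add_one_pow {κ ν : Type*} [Fintype κ] [DecidableEq κ] [Fintype ν]
    [DecidableEq ν] (b : Matrix κ ν ℂ) (c : Matrix ν κ ℂ) :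
    (-1 - b * c).charpoly * (X + 1) ^ Fintype.card ν =
      (-1 - c * b).charpoly * (X + 1) ^ Fintype.card κ := by
  refine Polynomial.funext fun x => ?_
  have h := congrArg (Polynomial.eval (-1 - x)) (Matrix.charpoly_mul_comm' b c)
  simp only [eval_mul, eval_pow, eval_X] at h
  simp only [eval_mul, eval_pow, eval_add, eval_X, eval_one, charpoly_neg_one_sub]
  have h1 : x + 1 = -1 * (-1 - x) := by ring
  rw [h1, mul_pow, mul_pow]
  linear_combination ((-1) ^ Fintype.card κ * (-1) ^ Fintype.card ν) * h

lemma rootProd_mul {α : ℝ} {p q : Polynomial ℂ} (hp : p ≠ 0) (hq : q ≠ 0) :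
    rootProd α (p * q) = rootProd α p * rootProd α q := by
  rw [rootProd, Polynomial.roots_mul (mul_ne_zero hp hq), Multiset.map_add, Multiset.prod_add,
    rootProd, rootProd]

open Polynomial in
-- The root `-1` belongs to modes with `|c| = 1`, whose power traces are one. Positivity of `α` is
-- needed since `0 ^ 0 = 1`.
lemma rootProd_X_add_one_pow {α : ℝ} (hα : 0 < α) (k : ℕ) :
    rootProd α ((X + 1) ^ k) = 1 := by
  have h : (X + 1 : ℂ[X]) = X - C (-1) := by simp
  rw [rootProd, h, roots_pow, roots_X_sub_C, Multiset.map_nsmul, Multiset.prod_nsmul]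
  simp [modeFun_one α hα]

variable {ι : Type*} [Fintype ι] [LinearOrder ι]

lemma labelEmb_sum_bijective (B : Finset ι) :
    Function.Bijective (Sum.elim (labelEmb Bᶜ) (labelEmb B)) := by
  constructor
  · rintro (a | a) (b | b) h
    · exact congrArg _ ((labelEmb_strictMono Bᶜ).injective h)
    · have h1 : ((ofLex a).1 : ι) = (ofLex b).1 := congrArg (fun z => (ofLex z).1) h
      exact absurd (h1 ▸ (ofLex b).1.2) (Finset.mem_compl.1 (ofLex a).1.2)
    · have h1 : ((ofLex a).1 : ι) = (ofLex b).1 := congrArg (fun z => (ofLex z).1) h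
      exact absurd (h1 ▸ (ofLex a).1.2) (Finset.mem_compl.1 (ofLex b).1.2)
    · exact congrArg _ ((labelEmb_strictMono B).injective h)
  · intro a
    by_cases h : (ofLex a).1 ∈ B
    · exact ⟨Sum.inr (toLex (⟨(ofLex a).1, h⟩, (ofLex a).2)), rfl⟩
    · exact ⟨Sum.inl (toLex (⟨(ofLex a).1, Finset.mem_compl.2 h⟩, (ofLex a).2)), rfl⟩

/-- The labels split into those of the modes outside `B` and those of the modes in `B`. -/
def labelSum (B : Finset ι) :
    MajoranaIndex {i // i ∈ Bᶜ} ⊕ MajoranaIndex {i // i ∈ B} ≃ MajoranaIndex ι :=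
  Equiv.ofBijective _ (labelEmb_sum_bijective B)

lemma submatrix_labelSum (B : Finset ι) (M : Matrix (MajoranaIndex ι) (MajoranaIndex ι) ℂ) :
    M.submatrix (labelSum B) (labelSum B) =
      Matrix.fromBlocks (M.submatrix (labelEmb Bᶜ) (labelEmb Bᶜ))
        (M.submatrix (labelEmb Bᶜ) (labelEmb B)) (M.submatrix (labelEmb B) (labelEmb Bᶜ))
        (M.submatrix (labelEmb B) (labelEmb B)) := by
  ext (a | a) (b | b) <;> rfl

/-- Mixed entries carry `i` and `-i` and cancel in the mean; entries within `B` carry `-1` in both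
terms. -/
lemma mean_cut_submatrix (B : Finset ι) (Γ : Matrix (MajoranaIndex ι) (MajoranaIndex ι) ℂ) :
    ((1 / 2 : ℂ) • (cutMatrix B Complex.I * Γ * cutMatrix B Complex.I +
      cutMatrix B (-Complex.I) * Γ * cutMatrix B (-Complex.I))).submatrix
        (labelSum B) (labelSum B) =
      Matrix.fromBlocks (Γ.submatrix (labelEmb Bᶜ) (labelEmb Bᶜ)) 0 0
        (-Γ.submatrix (labelEmb B) (labelEmb B)) := by
  have hA : ∀ a : MajoranaIndex {i // i ∈ Bᶜ}, (ofLex (labelEmb Bᶜ a)).1 ∉ B := fun a =>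
    Finset.mem_compl.1 (ofLex a).1.2
  have hB : ∀ a : MajoranaIndex {i // i ∈ B}, (ofLex (labelEmb B a)).1 ∈ B := fun a =>
    (ofLex a).1.2
  have hI := Complex.I_mul_I
  rw [submatrix_labelSum]
  congr 1 <;> ext a b <;>
    simp only [Matrix.submatrix_apply, Matrix.smul_apply, Matrix.add_apply, cutMatrix_apply_mul,
      hA, hB, if_true, if_false, smul_eq_mul, Matrix.zero_apply, Matrix.neg_apply]
  · ring
  · ring
  · ring
  · linear_combination Γ (labelEmb B a) (labelEmb B b) * hI

/-- Writing `Γ² = -1` in blocks gives the squares of the diagonal blocks as `-1 - bc` and `-1 - cb`.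
Their spectra differ only in the multiplicity of `-1`, which `rootProd` ignores, so both blocks
contribute equally. -/
theorem rootProd_charpoly_mean_cut (B : Finset ι)
    {Γ : Matrix (MajoranaIndex ι) (MajoranaIndex ι) ℂ} (hpure : Γ * Γ = -1) {α : ℝ} (hα : 0 < α)
    {C : Matrix (MajoranaIndex ι) (MajoranaIndex ι) ℂ}
    (hC : C = (1 / 2 : ℂ) • (cutMatrix B Complex.I * Γ * cutMatrix B Complex.I +
      cutMatrix B (-Complex.I) * Γ * cutMatrix B (-Complex.I))) :
    rootProd α (C * C).charpoly =
      rootProd α (Γ.submatrix (labelEmb Bᶜ) (labelEmb Bᶜ) *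
        Γ.submatrix (labelEmb Bᶜ) (labelEmb Bᶜ)).charpoly ^ 2 := by
  have h1 : (C * C).submatrix (labelSum B) (labelSum B) =
      C.submatrix (labelSum B) (labelSum B) * C.submatrix (labelSum B) (labelSum B) :=
    (Matrix.submatrix_mul_equiv C C _ (labelSum B) _).symm
  have h2 : (Γ * Γ).submatrix (labelSum B) (labelSum B) =
      Γ.submatrix (labelSum B) (labelSum B) * Γ.submatrix (labelSum B) (labelSum B) :=
    (Matrix.submatrix_mul_equiv Γ Γ _ (labelSum B) _).symm
  have h3 : (C * C).charpoly = ((C * C).submatrix (labelSum B) (labelSum B)).charpoly :=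
    (Matrix.charpoly_reindex (labelSum B).symm (C * C)).symm
  have h4 : (-1 : Matrix (MajoranaIndex ι) (MajoranaIndex ι) ℂ).submatrix (labelSum B)
      (labelSum B) = -1 := by
    rw [Matrix.submatrix_neg, Pi.neg_apply, Pi.neg_apply, Matrix.submatrix_one_equiv]
  rw [hC, mean_cut_submatrix, ← hC] at h1
  rw [hpure, h4, submatrix_labelSum] at h2
  rw [h3, h1]
  generalize Γ.submatrix (labelEmb Bᶜ) (labelEmb Bᶜ) = P at *
  generalize Γ.submatrix (labelEmb B) (labelEmb B) = Q at *
  generalize Γ.submatrix (labelEmb Bᶜ) (labelEmb B) = b at *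
  generalize Γ.submatrix (labelEmb B) (labelEmb Bᶜ) = c at *
  rw [Matrix.fromBlocks_multiply, ← Matrix.fromBlocks_one, Matrix.fromBlocks_neg,
    Matrix.fromBlocks_inj] at h2
  have hP : P * P = -1 - b * c := by rw [h2.1, add_sub_cancel_right]
  have hQ : Q * Q = -1 - c * b := by rw [h2.2.2.2, add_sub_cancel_left]
  have hne : ∀ k : ℕ, (Polynomial.X + 1 : Polynomial ℂ) ^ k ≠ 0 := fun k =>
    pow_ne_zero _ (Polynomial.X_add_C_ne_zero (1 : ℂ))
  have h5 := congrArg (rootProd α) (charpoly_mul_X_add_one_pow b c)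
  rw [rootProd_mul (Matrix.charpoly_monic _).ne_zero (hne _),
    rootProd_mul (Matrix.charpoly_monic _).ne_zero (hne _), rootProd_X_add_one_pow hα,
    rootProd_X_add_one_pow hα, mul_one, mul_one, ← hP, ← hQ] at h5
  rw [Matrix.fromBlocks_multiply]
  simp only [Matrix.mul_zero, Matrix.zero_mul, add_zero, zero_add, neg_mul_neg]
  rw [Matrix.charpoly_fromBlocks_zero₁₂, rootProd_mul (Matrix.charpoly_monic _).ne_zero
    (Matrix.charpoly_monic _).ne_zero, ← h5, sq]

/-- For a pure state, the powers of the Gaussian state with the mean covariance matrix have the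
traces of two copies of the reduced state. -/
theorem trace_matPow_mean_cut (B : Finset ι)
    {Γ : Matrix (MajoranaIndex ι) (MajoranaIndex ι) ℂ} (hΓ : IsStateCovariance Γ)
    (hpure : Γ * Γ = -1) {α : ℝ} (hα : 0 < α)
    {C : Matrix (MajoranaIndex ι) (MajoranaIndex ι) ℂ} (hCs : IsStateCovariance C)
    (hC : C = (1 / 2 : ℂ) • (cutMatrix B Complex.I * Γ * cutMatrix B Complex.I +
      cutMatrix B (-Complex.I) * Γ * cutMatrix B (-Complex.I))) :
    (matPow (gaussianOperator C) α).trace.re =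
      (matPow (reducedState Bᶜ (gaussianOperator Γ)) α).trace.re ^ 2 := by
  have hA := hΓ.submatrix Bᶜ
  have h1 := trace_matPow_sq hCs α
  have h0 : (matPow (gaussianOperator (Γ.submatrix (labelEmb Bᶜ) (labelEmb Bᶜ))) α).trace ^ 2 =
      rootProd α (Γ.submatrix (labelEmb Bᶜ) (labelEmb Bᶜ) *
        Γ.submatrix (labelEmb Bᶜ) (labelEmb Bᶜ)).charpoly := by
    convert trace_matPow_sq hA α
  rw [rootProd_charpoly_mean_cut B hpure hα hC, ← h0] at h1
  obtain ⟨p1, q1⟩ := trace_matPow_pos hCs α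
  have q2 : (matPow (gaussianOperator (Γ.submatrix (labelEmb Bᶜ) (labelEmb Bᶜ))) α).trace =
      ((matPow (gaussianOperator (Γ.submatrix (labelEmb Bᶜ) (labelEmb Bᶜ))) α).trace.re : ℂ) := by
    convert (trace_matPow_pos hA α).2
  rw [reducedState_gaussianOperator]
  rw [q1, q2] at h1
  have h2 : (matPow (gaussianOperator C) α).trace.re ^ 2 =
      ((matPow (gaussianOperator (Γ.submatrix (labelEmb Bᶜ) (labelEmb Bᶜ))) α).trace.re ^ 2) ^ 2 := by
    exact_mod_cast h1
  exact (pow_left_inj₀ p1.le (by positivity) two_ne_zero).1 h2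

end Bipartition

end FermionNegativity

end

/-! ### Assembly of the theorem. -/

open FermionNegativity in
theorem mainTheorem3 (n : ℕ) (B : Finset (Fin n))
    (ρ : FermionNegativity.FockOp (Fin n)) (hρ : FermionNegativity.IsGaussianState ρ)
    (γ γp γm R : Matrix (FermionNegativity.MajoranaIndex (Fin n))
      (FermionNegativity.MajoranaIndex (Fin n)) ℂ)
    (hγ : γ = FermionNegativity.covarianceMatrix ρ)
    (hγp : γp = FermionNegativity.cutMatrix B Complex.I * γ *
      FermionNegativity.cutMatrix B Complex.I)
    (hγm : γm = FermionNegativity.cutMatrix B (-Complex.I) * γ *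
      FermionNegativity.cutMatrix B (-Complex.I))
    (hR : R = FermionNegativity.cutMatrix B (-1))
    (Op Om ρx : FermionNegativity.FockOp (Fin n))
    (hOp : Op = FermionNegativity.gaussianOperator γp)
    (hOm : Om = FermionNegativity.gaussianOperator γm)
    (hρx : ρx = (Op * Om).trace⁻¹ • (Op * Om))
    (γx : Matrix (FermionNegativity.MajoranaIndex (Fin n))
      (FermionNegativity.MajoranaIndex (Fin n)) ℂ)
    (hγx : γx = FermionNegativity.covarianceMatrix ρx)
    (Ehat : ℝ)
    (hEhat : Ehat = Real.log (FermionNegativity.matPow (Op * Om) (1 / 2)).trace.re) :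
    -- the Gaussian operators and the decomposition of the partial transpose
    (FermionNegativity.IsGaussianWith Op γp ∧ FermionNegativity.IsGaussianWith Om γm ∧
      Om = Opᴴ ∧
      FermionNegativity.partialTranspose B ρ =
        ((1 - Complex.I) / 2) • Op + ((1 + Complex.I) / 2) • Om) ∧
    -- the bounds on the negativity and on the logarithmic negativity
    ((Op * Om).PosSemidef ∧
      0 < (FermionNegativity.matPow (Op * Om) (1 / 2)).trace.re ∧
      0 < FermionNegativity.traceNorm (FermionNegativity.partialTranspose B ρ) ∧
      FermionNegativity.negativity B ρ ≤
        1 / 2 * (√2 * (FermionNegativity.matPow (Op * Om) (1 / 2)).trace.re - 1) ∧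
      FermionNegativity.logNegativity B ρ ≤ Ehat + Real.log √2) ∧
    -- the normalized product is a Gaussian state with an explicit covariance matrix
    (0 < (Op * Om).trace ∧ FermionNegativity.IsGaussianState ρx ∧
      IsUnit (1 - γm * γp) ∧ IsUnit (1 - γp * γm) ∧ IsUnit (1 - γ * γ) ∧
      -(Complex.I • γx) =
        1 - (1 + Complex.I • γp) * (1 - γm * γp)⁻¹ * (1 + Complex.I • γm)) ∧
    -- the trace norm, the normalization and the traces of powers
    (FermionNegativity.traceNorm Op =
        (FermionNegativity.matPow (Op * Om) (1 / 2)).trace.re ∧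
      (FermionNegativity.matPow (Op * Om) (1 / 2)).trace.re =
        (FermionNegativity.matPow ρx (1 / 2)).trace.re * √((Op * Om).trace.re) ∧
      (Op * Om).trace = (√(((1 / 2 : ℂ) • (1 - γp * γm)).det.re) : ℝ) ∧
      (Op * Om).trace = (√(((1 / 2 : ℂ) • (1 - γ * γ)).det.re) : ℝ) ∧
      (((1 / 2 : ℂ) • (1 + Complex.I • γx)).PosSemidef ∧
        ((1 / 2 : ℂ) • (1 - Complex.I • γx)).PosSemidef) ∧
      ∀ α : ℝ, 0 < α →
        (FermionNegativity.matPow ρx α).trace =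
          (√((FermionNegativity.matPow ((1 / 2 : ℂ) • (1 + Complex.I • γx)) α +
            FermionNegativity.matPow ((1 / 2 : ℂ) • (1 - Complex.I • γx)) α).det.re) : ℝ)) ∧
    -- the spectrum of the covariance matrix of the normalized product
    (γx.charpoly = ((1 - γp * γm)⁻¹ * (γp + γm)).charpoly ∧
      γx.charpoly =
        (((1 / 2 : ℂ) • (1 - γ * γ))⁻¹ * ((1 / 2 : ℂ) • (γ * R + R * γ))).charpoly) ∧
    -- the expression through Rényi entropies
    Ehat = 1 / 2 *
      (FermionNegativity.renyiEntropy (1 / 2) ρx - FermionNegativity.renyiEntropy 2 ρ) ∧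
    -- pure states
    (ρ * ρ = ρ →
      Op * Om = Om * Op ∧
      FermionNegativity.renyiEntropy 2 ρ = 0 ∧
      (FermionNegativity.reducedState Bᶜ ρ).PosSemidef ∧
      FermionNegativity.renyiEntropy (1 / 2) ρx =
        2 * FermionNegativity.renyiEntropy (1 / 2) (FermionNegativity.reducedState Bᶜ ρ) ∧
      FermionNegativity.logNegativity B ρ = Ehat ∧
      Ehat = FermionNegativity.renyiEntropy (1 / 2) (FermionNegativity.reducedState Bᶜ ρ)) := by
  have hS := IsStateCovariance.of_posSemidef hρ.1 hρ.2.1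
  have hρG := hρ.2.2.eq_gaussianOperator
  rw [← hγ] at hS hρG
  have hT := hS.transpose
  have hTp : γpᵀ = -γp := hγp ▸ transpose_cut B Complex.I hT
  have hTm : γmᵀ = -γm := hγm ▸ transpose_cut B (-Complex.I) hT
  have hX : Op = cutGaussian B Complex.I γ := by rw [hOp, hγp, cutGaussian]
  have hY : Om = cutGaussian B (-Complex.I) γ := by rw [hOm, hγm, cutGaussian]
  obtain ⟨hdet, htr, hu⟩ := trace_mul_self_eq_sqrt_det hS
  obtain ⟨C, hCs, hCeq, hCcov⟩ := exists_product_covariance B hS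
  have hpos := trace_cutGaussian_mul_pos B hS
  have hpsd := posSemidef_cutGaussian_mul B hS
  have htn := half_power_cutGaussian_pos B hS
  have htrρ := trace_cutGaussian_mul B hS
  have hpt := traceNorm_partialTranspose_pos B hS
  have hle := traceNorm_partialTranspose_le B hS
  rw [← hX, ← hY] at hCeq hpos hpsd htn htrρ hle
  rw [← hγp, ← hγm] at hCcov
  rw [← hρG] at hdet htr htrρ hpt hle
  have hpos' : 0 < (Op * Om).trace.re := (Complex.pos_iff.1 hpos).1
  have hreal : (Op * Om).trace = ((Op * Om).trace.re : ℂ) :=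
    Complex.ext rfl (Complex.pos_iff.1 hpos).2.symm
  have hρxG : ρx = gaussianOperator C := by
    rw [hρx]
    nth_rewrite 2 [hCeq]
    exact inv_smul_smul₀ hpos.ne' _
  have hγxC : γx = C := by
    rw [hγx, hρxG, (isGaussianWith_gaussianOperator hCs.transpose).1]
  have hρxpsd : ρx.PosSemidef := hρxG ▸ hCs.posSemidef_gaussianOperator
  have hup : IsUnit (1 - γp * γm) := by
    rw [hγp, hγm]; exact isUnit_one_sub_cut_mul_cut B γ (by simp) hu
  have hum : IsUnit (1 - γm * γp) := by
    rw [hγp, hγm]; exact isUnit_one_sub_cut_mul_cut B γ (by simp) hu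
  have hhalf : (matPow (Op * Om) (1 / 2)).trace.re =
      (matPow ρx (1 / 2)).trace.re * √((Op * Om).trace.re) := by
    have h1 : Op * Om = (((Op * Om).trace.re : ℝ) : ℂ) • ρx := by
      rw [← hreal, hρx, smul_inv_smul₀ hpos.ne']
    conv_lhs => rw [h1, matPow_smul hρxpsd hpos'.le, Matrix.trace_smul, smul_eq_mul,
      Complex.re_ofReal_mul, ← Real.sqrt_eq_rpow]
    exact mul_comm _ _
  have hx := (trace_matPow_pos hCs (1 / 2)).1
  rw [← hρxG] at hx
  have hmain : Ehat = 1 / 2 * (renyiEntropy (1 / 2) ρx - renyiEntropy 2 ρ) := by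
    -- The prefactors `1 / (1 - α)` are `2` at `α = 1/2` and `-1` at `α = 2`, so the claim is `ln tr
    -- ρ_×^{1/2} + ½ ln tr ρ²`, with `tr ρ² = tr O_+ O_-`.
    rw [hEhat, hhalf, Real.log_mul hx.ne' (Real.sqrt_pos.2 hpos').ne', Real.log_sqrt hpos'.le,
      htrρ, renyiEntropy, renyiEntropy, matPow_two hρ.1.1]
    ring
  refine ⟨⟨?_, ?_, ?_, ?_⟩, ⟨hpsd, htn, hpt, ?_, ?_⟩, ⟨hpos, ⟨hρxpsd, ?_, ?_⟩, hum, hup, hu, ?_⟩,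
    ⟨?_, hhalf, ?_, ?_, ⟨?_, ?_⟩, ?_⟩, ⟨?_, ?_⟩, hmain, ?_⟩
  · rw [hOp]; exact isGaussianWith_gaussianOperator hTp
  · rw [hOm]; exact isGaussianWith_gaussianOperator hTm
  · rw [hX, hY, conjTranspose_cutGaussian B hS]
  · rw [hρG, hX, hY]; exact partialTranspose_eq_cutGaussian B
  · rw [negativity]; linarith
  · rw [logNegativity, hEhat, add_comm, ← Real.log_mul (by positivity) htn.ne']
    exact Real.log_le_log hpt hle
  · rw [hρxG, trace_gaussianOperator]
  · rw [← hγx, hγxC, hρxG]; exact isGaussianWith_gaussianOperator hCs.transpose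
  · rw [← hCcov, hγxC]; abel
  · rw [hX, hY, traceNorm_cutGaussian B hS]
  · rw [htrρ, hdet, hγp, hγm, det_one_sub_cut_mul_cut B γ (by simp)]
  · rw [htrρ, hdet]
  · rw [hγxC]; exact hCs.2.1.smul (by rw [Complex.nonneg_iff]; norm_num)
  · rw [hγxC]; exact hCs.2.2.smul (by rw [Complex.nonneg_iff]; norm_num)
  · intro α _
    rw [hγxC, hρxG]; exact trace_matPow_eq_sqrt_det hCs α
  · rw [hγxC, charpoly_product_covariance hu (by rw [← hγp, ← hγm]; exact hCcov), hγp, hγm,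
      charpoly_product_covariance' hu]
  · rw [hγxC, charpoly_product_covariance hu (by rw [← hγp, ← hγm]; exact hCcov),
      half_smul_inv_mul_half_smul _ _ hu, hR]
  · intro hpure
    have hsq : γ * γ = -1 := mul_self_eq_neg_one_of_pure hS (by rw [← hρG, hpure])
    have hS2 : renyiEntropy 2 ρ = 0 := by
      rw [renyiEntropy, matPow_two hρ.1.1, hpure, hρ.2.1]; simp
    have hCmean : C = (1 / 2 : ℂ) • (γp + γm) := by
      have h1 : γp * γm = -1 := by
        rw [hγp, hγm]; exact cut_mul_cut_of_pure B hsq (by simp)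
      have h2 : γm * γp = -1 := by
        rw [hγp, hγm]; exact cut_mul_cut_of_pure B hsq (by simp)
      rw [half_smul_mul_of_mul_eq_neg_one h1 h2] at hCcov
      exact smul_right_injective _ Complex.I_ne_zero (add_left_cancel hCcov)
    have hred : renyiEntropy (1 / 2) ρx = 2 * renyiEntropy (1 / 2) (reducedState Bᶜ ρ) := by
      have h1 : (matPow ρx (1 / 2)).trace.re =
          (matPow (reducedState Bᶜ ρ) (1 / 2)).trace.re ^ 2 := by
        rw [hρxG, hρG]
        convert trace_matPow_mean_cut B hS hsq one_half_pos hCs (by rw [hCmean, hγp, hγm])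
      rw [renyiEntropy, renyiEntropy, h1, Real.log_pow]
      push_cast; ring
    refine ⟨?_, hS2, ?_, hred, ?_, ?_⟩
    · rw [hX, hY]; exact cutGaussian_mul_comm B hS hsq
    · rw [hρG, reducedState_gaussianOperator]
      exact (hS.submatrix Bᶜ).posSemidef_gaussianOperator
    · rw [logNegativity, hEhat, hρG, traceNorm_partialTranspose_of_pure B hS hsq, ← hX, ← hY]
    · rw [hmain, hS2, hred]; ring
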